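/- Let $\Xi=\mathbb R^n\times(\mathbb R^n)'$ with symplectic form $\sigma((x,\xi),(y,\eta))=y\cdot\xi-x\cdot\eta$ and Haar measure $dX=(2\pi)^{-n}\,dx\,d\xi$. Put $\langle f,g\rangle=\int_\Xi f(X)g(X)\,dX$ for $f,g\in\mathcal S(\Xi)$; write $\langle\cdot,\cdot\rangle$ also for the duality between $\mathcal S'(\Xi)$ and $\mathcal S(\Xi)$, and $\langle\!\langle\cdot,\cdot\rangle\!\rangle$ for the analogous dualities over $\Xi\times\Xi$; Schwartz functions are identified with tempered distributions through these pairings. Put $\widehat f(Y)=\int_\Xi e^{-i\sigma(Y,Z)}f(Z)\,dZ$ and $\mathfrak e_X(Z)=e^{i\sigma(X,Z)}$. Let $\#$ be a bilinear composition law on $\mathcal S(\Xi)$ such that: (A) $\#$ is associative and separately continuous, $\overline{f\# g}=\overline g\#\overline f$, and $\int_\Xi (f\# g)\,dX=\int_\Xi fg\,dX$ for all $f,g\in\mathcal S(\Xi)$. For $u\in\mathcal S'(\Xi)$ and $f\in\mathcal S(\Xi)$ define $f\# u,\ u\# f\in\mathcal S'(\Xi)$ by $\langle f\# u,h\rangle=\langle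 u,h\# f\rangle$ and $\langle u\# f,h\rangle=\langle u,f\# h\rangle$, $h\in\mathcal S(\Xi)$. (B) $f\# u\# g\in\mathcal S(\Xi)$ for all $f,g\in\mathcal S(\Xi)$, $u\in\mathcal S'(\Xi)$. For $u,v\in\mathcal S'(\Xi)$ and $f\in\mathcal S(\Xi)$ put $\langle u\# f\# v,h\rangle=\langle u,f\# v\# h\rangle$, $h\in\mathcal S(\Xi)$. (C) With $\Theta_Z(f)=\mathfrak e_{-Z}\# f\#\mathfrak e_Z$, one has $\int_\Xi\langle\Theta_Z(f),g\rangle\,dZ=\int_\Xi f(Z)\,dZ\int_\Xi g(Y)\,dY$ for all $f,g\in\mathcal S(\Xi)$. Then there are unique continuous linear maps $\mathbf R,\mathbf N:\mathcal S(\Xi\times\Xi)\to\mathcal S'(\Xi\times\Xi)$ with $$\langle\!\langle\mathbf R(f_1\otimes f_2),g_1\otimes g_2\rangle\!\rangle=\langle g_1\# f_1,g_2\# f_2\rangle,\qquad \langle\!\langle\mathbf N(f_1\otimes f_2),g_1\otimes g_2\rangle\!\rangle=\langle\widehat g_1\# f_1,\widehat g_2\# f_2\rangle$$ for all $f_1,f_2,g_1,g_2\in\mathcal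 S(\Xi)$. Let $\mathbf C(F)=F\circ C$, $C(X,Y)=(-X,X-Y)$ (on $\mathcal S(\Xi\times\Xi)$ and, by duality, on $\mathcal S'(\Xi\times\Xi)$), and let the modulation mapping be $\mathbf M=\mathbf N\circ\mathbf C$. Then $\mathbf R$, $\mathbf N$ and $\mathbf M$ take their values in $\mathcal S(\Xi\times\Xi)$ and are topological isomorphisms of $\mathcal S(\Xi\times\Xi)$ onto itself; each of them extends to a linear bijection of $\mathcal S'(\Xi\times\Xi)$ which is a homeomorphism for the strong topology and also for the weak topology of $\mathcal S'(\Xi\times\Xi)$. The same holds for the other version $\mathbf M=\mathbf C\circ\mathbf N$ of the modulation mapping, formally given by $[\mathbf M(f\otimes g)](X,Y)=\langle\mathfrak e_{-X}\# f,\mathfrak e_{X-Y}\# g\rangle$. -/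

import Mathlib

open scoped SchwartzMap

noncomputable section

namespace ModulationMaps

open MeasureTheory

/-! ### Phase space -/

/-- The phase space `Ξ = ℝⁿ × (ℝⁿ)'`, with points `X = (x, ξ)`. -/
abbrev Phase (n : ℕ) : Type := EuclideanSpace ℝ (Fin n) × EuclideanSpace ℝ (Fin n)

/-- The symplectic form `σ((x, ξ), (y, η)) = y · ξ - x · η`. -/
def sigma {n : ℕ} (X Y : Phase n) : ℝ := inner ℝ Y.1 X.2 - inner ℝ X.1 Y.2

/-- The Haar measure `dX = (2π)⁻ⁿ dx dξ` on `Ξ`, for which the symplectic Fourier transform is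
unitary. -/
def haar (n : ℕ) : Measure (Phase n) := ENNReal.ofReal (((2 * Real.pi) ^ n)⁻¹) • volume

instance instHaarMeasure (n : ℕ) : (haar n).IsAddHaarMeasure :=
  haveI : (volume : Measure (Phase n)).IsAddHaarMeasure :=
    inferInstanceAs ((volume : Measure (EuclideanSpace ℝ (Fin n))).prod volume).IsAddHaarMeasure
  Measure.IsAddHaarMeasure.smul volume
    (by simpa [ENNReal.ofReal_eq_zero, not_le] using by positivity) ENNReal.ofReal_ne_top

/-- The product measure `dX dY` on `Ξ × Ξ`. -/
def haar2 (n : ℕ) : Measure (Phase n × Phase n) := (haar n).prod (haar n)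

instance instHaarMeasure2 (n : ℕ) : (haar2 n).IsAddHaarMeasure := by
  have : SFinite (haar n) := by unfold haar; infer_instance
  exact Measure.prod.instIsAddHaarMeasure (haar n) (haar n)

/-! ### Schwartz functions and tempered distributions -/

/-- The Schwartz space `𝓢(Ξ)`. -/
abbrev Sch (n : ℕ) : Type := 𝓢(Phase n, ℂ)

/-- The Schwartz space `𝓢(Ξ × Ξ)`. -/
abbrev Sch2 (n : ℕ) : Type := 𝓢(Phase n × Phase n, ℂ)

/-- The strong dual `𝓢'(Ξ)`: continuous linear functionals, with the topology of uniform
convergence on bounded sets. -/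
abbrev Dist (n : ℕ) : Type := Sch n →L[ℂ] ℂ

/-- The strong dual `𝓢'(Ξ × Ξ)`. -/
abbrev Dist2 (n : ℕ) : Type := Sch2 n →L[ℂ] ℂ

section General

variable {E : Type} [NormedAddCommGroup E] [NormedSpace ℝ E] [MeasurableSpace E] [BorelSpace E]
  [SecondCountableTopology E]

/-- The tempered distribution `f ↦ ∫ φ f dμ` defined by a function `φ` of temperate growth. -/
def regular (μ : Measure E) [μ.HasTemperateGrowth] (φ : E → ℂ) : 𝓢(E, ℂ) →L[ℂ] ℂ :=
  SchwartzMap.integralCLM ℂ μ ∘L SchwartzMap.smulLeftCLM ℂ φ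

theorem regular_apply (μ : Measure E) [μ.HasTemperateGrowth] {φ : E → ℂ}
    (hφ : φ.HasTemperateGrowth) (f : 𝓢(E, ℂ)) : regular μ φ f = ∫ x, φ x * f x ∂μ := by
  simp [regular, hφ]

end General

section Tensor

variable {E F : Type} [NormedAddCommGroup E] [NormedSpace ℝ E] [NormedAddCommGroup F]
  [NormedSpace ℝ F]

/-- Complex conjugation on the Schwartz space. -/
def conj (f : 𝓢(E, ℂ)) : 𝓢(E, ℂ) :=
  SchwartzMap.postcompCLM (𝕜 := ℝ) (Complex.conjCLE : ℂ →L[ℝ] ℂ) f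

theorem conj_apply (f : 𝓢(E, ℂ)) (x : E) : conj f x = starRingEnd ℂ (f x) := rfl

theorem decay_comp_clm {G : Type} [NormedAddCommGroup G] [NormedSpace ℝ G] (L : G →L[ℝ] E)
    (hL : ‖L‖ ≤ 1) (f : 𝓢(E, ℂ)) (k i : ℕ) (x : G) :
    ‖L x‖ ^ k * ‖iteratedFDeriv ℝ i (f ∘ L) x‖ ≤ SchwartzMap.seminorm ℝ k i f := by
  have h1 : ‖iteratedFDeriv ℝ i (f ∘ L) x‖ ≤ ‖iteratedFDeriv ℝ i f (L x)‖ := by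
    rw [L.iteratedFDeriv_comp_right (f.smooth i) x le_rfl]
    refine (ContinuousMultilinearMap.norm_compContinuousLinearMap_le _ _).trans ?_
    simp only [Finset.prod_const, Finset.card_univ, Fintype.card_fin]
    exact mul_le_of_le_one_right (norm_nonneg _) (pow_le_one₀ (norm_nonneg _) hL)
  refine le_trans ?_ (SchwartzMap.le_seminorm ℝ k i f (L x))
  gcongr

/-- The tensor product `(f ⊗ g)(x, y) = f x * g y` of two Schwartz functions. -/
def tensor (f : 𝓢(E, ℂ)) (g : 𝓢(F, ℂ)) : 𝓢(E × F, ℂ) where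
  toFun z := f z.1 * g z.2
  smooth' := ((f.smooth _).comp contDiff_fst).mul ((g.smooth _).comp contDiff_snd)
  decay' k m := by
    let L := ContinuousLinearMap.fst ℝ E F
    let M := ContinuousLinearMap.snd ℝ E F
    refine ⟨∑ i ∈ Finset.range (m + 1), (m.choose i : ℝ) *
      (SchwartzMap.seminorm ℝ k i f * SchwartzMap.seminorm ℝ 0 (m - i) g +
        SchwartzMap.seminorm ℝ 0 i f * SchwartzMap.seminorm ℝ k (m - i) g), fun z => ?_⟩
    have hf : ContDiff ℝ m (f ∘ L) := (f.smooth _).comp L.contDiff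
    have hg : ContDiff ℝ m (g ∘ M) := (g.smooth _).comp M.contDiff
    have key := norm_iteratedFDeriv_mul_le (𝕜 := ℝ) hf hg z (n := m) le_rfl
    have hz : ‖z‖ ^ k ≤ ‖L z‖ ^ k + ‖M z‖ ^ k := by
      rcases le_total ‖z.1‖ ‖z.2‖ with h | h
      · rw [Prod.norm_def, max_eq_right h]
        exact le_add_of_nonneg_left (by positivity)
      · rw [Prod.norm_def, max_eq_left h]
        exact le_add_of_nonneg_right (by positivity)
    refine (mul_le_mul_of_nonneg_left key (by positivity)).trans ?_
    rw [Finset.mul_sum]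
    refine Finset.sum_le_sum fun i _ => ?_
    have a1 := decay_comp_clm L (ContinuousLinearMap.norm_fst_le ℝ E F) f k i z
    have a0 := decay_comp_clm L (ContinuousLinearMap.norm_fst_le ℝ E F) f 0 i z
    have b1 := decay_comp_clm M (ContinuousLinearMap.norm_snd_le ℝ E F) g k (m - i) z
    have b0 := decay_comp_clm M (ContinuousLinearMap.norm_snd_le ℝ E F) g 0 (m - i) z
    rw [pow_zero, one_mul] at a0 b0
    set A := ‖iteratedFDeriv ℝ i (f ∘ L) z‖
    set B := ‖iteratedFDeriv ℝ (m - i) (g ∘ M) z‖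
    have hA : 0 ≤ A := norm_nonneg _
    have hB : 0 ≤ B := norm_nonneg _
    calc ‖z‖ ^ k * ((m.choose i : ℝ) * A * B)
        ≤ (‖L z‖ ^ k + ‖M z‖ ^ k) * ((m.choose i : ℝ) * A * B) := by gcongr
      _ = (m.choose i : ℝ) * ((‖L z‖ ^ k * A) * B + A * (‖M z‖ ^ k * B)) := by ring
      _ ≤ _ := by gcongr

theorem tensor_apply (f : 𝓢(E, ℂ)) (g : 𝓢(F, ℂ)) (z : E × F) :
    tensor f g z = f z.1 * g z.2 := rfl

end Tensor

/-- The bilinear pairing `⟨f, g⟩ = ∫ f(X) g(X) dX` on `𝓢(Ξ)`. -/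
def pairing {n : ℕ} (f g : Sch n) : ℂ := ∫ X, f X * g X ∂(haar n)

/-- The canonical embedding `𝓢(Ξ) → 𝓢'(Ξ)`, `f ↦ ⟨f, ·⟩`. -/
def toDist {n : ℕ} (f : Sch n) : Dist n := regular (haar n) f

theorem toDist_apply {n : ℕ} (f g : Sch n) : toDist f g = pairing f g :=
  regular_apply _ f.hasTemperateGrowth g

/-- The canonical embedding `𝓢(Ξ × Ξ) → 𝓢'(Ξ × Ξ)`, `F ↦ ∫∫ F(X, Y) · dX dY`. -/
def toDist2 {n : ℕ} (F : Sch2 n) : Dist2 n := regular (haar2 n) F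

theorem toDist2_apply {n : ℕ} (F G : Sch2 n) :
    toDist2 F G = ∫ p, F p * G p ∂((haar n).prod (haar n)) :=
  regular_apply _ F.hasTemperateGrowth G

/-! ### Exponentials and the symplectic Fourier transform -/

/-- The function `e_X(Z) = exp(i σ(X, Z))`. -/
def expFun {n : ℕ} (X Z : Phase n) : ℂ := Complex.exp (Complex.I * (sigma X Z : ℂ))

theorem hasTemperateGrowth_cexp_I :
    (fun t : ℝ => Complex.exp (Complex.I * (t : ℂ))).HasTemperateGrowth := by
  refine ⟨(contDiff_const.mul Complex.ofRealCLM.contDiff).cexp, fun m => ⟨0, 1, fun t => ?_⟩⟩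
  have h : ∀ m : ℕ, iteratedDeriv m (fun t : ℝ => Complex.exp (Complex.I * (t : ℂ))) =
      fun t : ℝ => Complex.I ^ m * Complex.exp (Complex.I * (t : ℂ)) := by
    intro m
    induction m with
    | zero => simp
    | succ m ih =>
      rw [iteratedDeriv_succ, ih]
      funext t
      have h1 : HasDerivAt (fun t : ℝ => Complex.I * (t : ℂ)) Complex.I t := by
        simpa using (Complex.ofRealCLM.hasDerivAt (x := t)).const_mul Complex.I
      rw [(h1.cexp.const_mul (Complex.I ^ m)).deriv]
      ring
  rw [norm_iteratedFDeriv_eq_norm_iteratedDeriv, h]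
  simp [Complex.norm_exp]

theorem expFun_hasTemperateGrowth {n : ℕ} (X : Phase n) :
    (expFun X).HasTemperateGrowth := by
  let L : Phase n →L[ℝ] ℝ :=
    (innerSL ℝ X.2) ∘L (ContinuousLinearMap.fst ℝ _ _) -
      (innerSL ℝ X.1) ∘L (ContinuousLinearMap.snd ℝ _ _)
  have hL : ∀ Z, L Z = sigma X Z := fun Z => by
    simp [L, sigma, real_inner_comm]
  have := hasTemperateGrowth_cexp_I.comp L.hasTemperateGrowth
  convert this using 1
  funext Z
  simp [expFun, hL]

/-- `e_X` as a tempered distribution. -/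
def expDist {n : ℕ} (X : Phase n) : Dist n := regular (haar n) (expFun X)

theorem expDist_apply {n : ℕ} (X : Phase n) (f : Sch n) :
    expDist X f = ∫ Z, Complex.exp (Complex.I * (sigma X Z : ℂ)) * f Z ∂(haar n) :=
  regular_apply _ (expFun_hasTemperateGrowth X) f

/-- `Ξ` with its Euclidean structure. -/
abbrev EPhase (n : ℕ) : Type := WithLp 2 (Phase n)

/-- The map `Y = (y, η) ↦ (2π)⁻¹ (η, -y)`, which turns the phase `2π ⟪Z, ·⟫` into `σ(Y, Z)`. -/
def rotate (n : ℕ) : Phase n ≃L[ℝ] EPhase n :=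
  ((ContinuousLinearEquiv.prodComm ℝ _ _).trans
    ((ContinuousLinearEquiv.smulLeft (Units.mk0 ((2 * Real.pi)⁻¹ : ℝ) (by positivity))).prodCongr
      (ContinuousLinearEquiv.smulLeft
        (Units.mk0 (-(2 * Real.pi)⁻¹ : ℝ) (neg_ne_zero.2 (by positivity)))))).trans
    (WithLp.prodContinuousLinearEquiv 2 ℝ _ _).symm

theorem rotate_apply {n : ℕ} (Y : Phase n) :
    rotate n Y = WithLp.toLp 2 ((2 * Real.pi)⁻¹ • Y.2, (-(2 * Real.pi)⁻¹) • Y.1) := rfl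

/-- The symplectic Fourier transform on `𝓢(Ξ)`, obtained from the Fourier transform of Mathlib
by a linear change of variables; see `symplecticFourier_apply`. -/
def symplecticFourier {n : ℕ} (f : Sch n) : Sch n :=
  (((2 * Real.pi) ^ n)⁻¹ : ℝ) • SchwartzMap.compCLMOfContinuousLinearEquiv ℂ (rotate n)
    (FourierTransform.fourier (SchwartzMap.compCLMOfContinuousLinearEquiv ℂ
      (WithLp.prodContinuousLinearEquiv 2 ℝ _ _) f : 𝓢(EPhase n, ℂ)))

theorem symplecticFourier_apply {n : ℕ} (f : Sch n) (Y : Phase n) :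
    symplecticFourier f Y =
      ∫ Z, Complex.exp (-(Complex.I * (sigma Y Z : ℂ))) * f Z ∂(haar n) := by
  have hpi : (0 : ℝ) ≤ ((2 * Real.pi) ^ n)⁻¹ := by positivity
  rw [haar, integral_smul_measure, ENNReal.toReal_ofReal hpi]
  simp only [symplecticFourier, smul_apply,
    SchwartzMap.compCLMOfContinuousLinearEquiv_apply, Function.comp_apply,
    SchwartzMap.fourier_coe, Real.fourier_eq']
  congr 1
  rw [← (WithLp.volume_preserving_ofLp (EuclideanSpace ℝ (Fin n))
    (EuclideanSpace ℝ (Fin n))).integral_comp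
      (MeasurableEquiv.toLp 2 (Phase n)).symm.measurableEmbedding]
  refine integral_congr_ae (Filter.Eventually.of_forall fun v => ?_)
  have h : -2 * Real.pi * inner ℝ v (rotate n Y) = -sigma Y v.ofLp := by
    rw [rotate_apply, WithLp.prod_inner_apply]
    simp only [inner_smul_right, sigma, real_inner_comm Y.1, real_inner_comm Y.2]
    field_simp
    ring
  simp only [h, smul_eq_mul]
  congr 2
  push_cast
  ring

/-! ### The composition law and the hypotheses -/

/-- Hypothesis A for a bilinear composition law `f # g = P f g`: it turns `𝓢(Ξ)`, with complex
conjugation as involution, into a `*`-algebra, it is separately continuous, and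
`∫ f # g = ∫ f g`. -/
structure HypothesisA {n : ℕ} (P : Sch n →ₗ[ℂ] Sch n →ₗ[ℂ] Sch n) : Prop where
  assoc : ∀ f g h, P (P f g) h = P f (P g h)
  conj_mul : ∀ f g, conj (P f g) = P (conj g) (conj f)
  continuous_left : ∀ g, Continuous fun f => P f g
  continuous_right : ∀ f, Continuous fun g => P f g
  integral_mul : ∀ f g, ∫ X, P f g X ∂(haar n) = ∫ X, f X * g X ∂(haar n)

section Product

variable {n : ℕ} {P : Sch n →ₗ[ℂ] Sch n →ₗ[ℂ] Sch n}

/-- `f # u ∈ 𝓢'(Ξ)` for `f ∈ 𝓢(Ξ)` and `u ∈ 𝓢'(Ξ)`, given by `⟨f # u, h⟩ = ⟨u, h # f⟩`. -/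
def HypothesisA.mulDist (hA : HypothesisA P) (f : Sch n) (u : Dist n) : Dist n :=
  u ∘L (⟨P.flip f, hA.continuous_left f⟩ : Sch n →L[ℂ] Sch n)

/-- `u # f ∈ 𝓢'(Ξ)` for `u ∈ 𝓢'(Ξ)` and `f ∈ 𝓢(Ξ)`, given by `⟨u # f, h⟩ = ⟨u, f # h⟩`. -/
def HypothesisA.distMul (hA : HypothesisA P) (u : Dist n) (f : Sch n) : Dist n :=
  u ∘L (⟨P f, hA.continuous_right f⟩ : Sch n →L[ℂ] Sch n)

theorem HypothesisA.mulDist_apply (hA : HypothesisA P) (f : Sch n) (u : Dist n) (h : Sch n) :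
    hA.mulDist f u h = u (P h f) := rfl

theorem HypothesisA.distMul_apply (hA : HypothesisA P) (u : Dist n) (f h : Sch n) :
    hA.distMul u f h = u (P f h) := rfl

/-- Hypothesis B: `𝓢(Ξ) # 𝓢'(Ξ) # 𝓢(Ξ) ⊆ 𝓢(Ξ)`. -/
def HypothesisB (hA : HypothesisA P) : Prop :=
  ∀ (f : Sch n) (u : Dist n) (g : Sch n), ∃ k : Sch n, toDist k = hA.distMul (hA.mulDist f u) g

/-- The Schwartz function `f # u # g`, for `f, g ∈ 𝓢(Ξ)` and `u ∈ 𝓢'(Ξ)`. -/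
def HypothesisB.sandwich {hA : HypothesisA P} (hB : HypothesisB hA) (f : Sch n) (u : Dist n)
    (g : Sch n) : Sch n :=
  (hB f u g).choose

theorem HypothesisB.toDist_sandwich {hA : HypothesisA P} (hB : HypothesisB hA) (f : Sch n)
    (u : Dist n) (g : Sch n) :
    toDist (hB.sandwich f u g) = hA.distMul (hA.mulDist f u) g :=
  (hB f u g).choose_spec

/-- The value `⟨u # f # v, h⟩ = ⟨u, f # v # h⟩` on `h ∈ 𝓢(Ξ)` of the distribution `u # f # v`, for
`u, v ∈ 𝓢'(Ξ)` and `f ∈ 𝓢(Ξ)`. -/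
def HypothesisB.tripleApply {hA : HypothesisA P} (hB : HypothesisB hA) (u : Dist n) (f : Sch n)
    (v : Dist n) (h : Sch n) : ℂ :=
  u (hB.sandwich f v h)

/-- The pairing `⟨Θ_Z f, g⟩ = ∫ [Θ_Z f](Y) g(Y) dY`, where `Θ_Z f = e_{-Z} # f # e_Z`. -/
def HypothesisB.thetaPairing {hA : HypothesisA P} (hB : HypothesisB hA) (Z : Phase n)
    (f g : Sch n) : ℂ :=
  hB.tripleApply (expDist (-Z)) f (expDist Z) g

/-- Hypothesis C: `∫∫ [Θ_Z f](Y) g(Y) dY dZ = (∫ f)(∫ g)`. -/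
def HypothesisC {hA : HypothesisA P} (hB : HypothesisB hA) : Prop :=
  ∀ f g : Sch n, ∫ Z, hB.thetaPairing Z f g ∂(haar n) =
    (∫ Z, f Z ∂(haar n)) * ∫ Y, g Y ∂(haar n)

end Product

/-! ### The canonical mappings -/

/-- The linear continuous map `R : 𝓢(Ξ × Ξ) → 𝓢'(Ξ × Ξ)` satisfies
`⟪R(f₁ ⊗ f₂), g₁ ⊗ g₂⟫ = ⟨g₁ # f₁, g₂ # f₂⟩`. -/
def IsRMap {n : ℕ} (P : Sch n →ₗ[ℂ] Sch n →ₗ[ℂ] Sch n) (R : Sch2 n →L[ℂ] Dist2 n) : Prop :=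
  ∀ f₁ f₂ g₁ g₂ : Sch n,
    R (tensor f₁ f₂) (tensor g₁ g₂) = pairing (P g₁ f₁) (P g₂ f₂)

/-- The linear continuous map `N : 𝓢(Ξ × Ξ) → 𝓢'(Ξ × Ξ)` satisfies
`⟪N(f₁ ⊗ f₂), g₁ ⊗ g₂⟫ = ⟨ĝ₁ # f₁, ĝ₂ # f₂⟩`. -/
def IsNMap {n : ℕ} (P : Sch n →ₗ[ℂ] Sch n →ₗ[ℂ] Sch n) (N : Sch2 n →L[ℂ] Dist2 n) : Prop :=
  ∀ f₁ f₂ g₁ g₂ : Sch n,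
    N (tensor f₁ f₂) (tensor g₁ g₂) =
      pairing (P (symplecticFourier g₁) f₁) (P (symplecticFourier g₂) f₂)

/-- The change of variables `C(X, Y) = (-X, X - Y)`. -/
def changeVar (n : ℕ) : (Phase n × Phase n) ≃L[ℝ] (Phase n × Phase n) :=
  ContinuousLinearEquiv.equivOfInverse
    ((-ContinuousLinearMap.fst ℝ (Phase n) (Phase n)).prod
      (ContinuousLinearMap.fst ℝ (Phase n) (Phase n) -
        ContinuousLinearMap.snd ℝ (Phase n) (Phase n)))
    ((-ContinuousLinearMap.fst ℝ (Phase n) (Phase n)).prod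
      (-ContinuousLinearMap.fst ℝ (Phase n) (Phase n) -
        ContinuousLinearMap.snd ℝ (Phase n) (Phase n)))
    (fun p => by ext <;> simp) (fun p => by ext <;> simp)

theorem changeVar_apply {n : ℕ} (X Y : Phase n) : changeVar n (X, Y) = (-X, X - Y) := rfl

/-- `𝐂 F = F ∘ C` on `𝓢(Ξ × Ξ)`. -/
def compC (n : ℕ) : Sch2 n →L[ℂ] Sch2 n :=
  SchwartzMap.compCLMOfContinuousLinearEquiv ℂ (changeVar n)

/-- `𝐂 u = u ∘ C` on `𝓢'(Ξ × Ξ)`, that is `⟪𝐂 u, G⟫ = ⟪u, G ∘ C⁻¹⟫`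
(the linear map `C` preserves `dX dY`). -/
def compCDist (n : ℕ) : Dist2 n →L[ℂ] Dist2 n :=
  ContinuousLinearMap.precomp ℂ
    (SchwartzMap.compCLMOfContinuousLinearEquiv ℂ (changeVar n).symm : Sch2 n →L[ℂ] Sch2 n)

theorem compCDist_apply {n : ℕ} (u : Dist2 n) (G : Sch2 n) :
    compCDist n u G =
      u (SchwartzMap.compCLMOfContinuousLinearEquiv ℂ (changeVar n).symm G) := rfl

/-- The map `T : 𝓢(Ξ × Ξ) → 𝓢'(Ξ × Ξ)` takes its values in `𝓢(Ξ × Ξ)`, is a topological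
isomorphism `e` of `𝓢(Ξ × Ξ)`, and `e` extends to a linear bijection of `𝓢'(Ξ × Ξ)` that is a
homeomorphism both for the strong topology (`E`) and for the weak topology (`E'`). -/
def IsTopIsoExtending {n : ℕ} (T : Sch2 n →L[ℂ] Dist2 n) : Prop :=
  ∃ e : Sch2 n ≃L[ℂ] Sch2 n, (∀ F, T F = toDist2 (e F)) ∧
    ∃ E : Dist2 n ≃L[ℂ] Dist2 n, (∀ F, E (toDist2 F) = toDist2 (e F)) ∧
      ∃ E' : 𝓢'(Phase n × Phase n, ℂ) ≃L[ℂ] 𝓢'(Phase n × Phase n, ℂ),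
        ∀ u : Dist2 n,
          E' (ContinuousLinearMap.toPointwiseConvergenceCLM ℂ (RingHom.id ℂ) (Sch2 n) ℂ u) =
            ContinuousLinearMap.toPointwiseConvergenceCLM ℂ (RingHom.id ℂ) (Sch2 n) ℂ (E u)

end ModulationMaps

end

/-! The proof expands everything in coherent states $x\mapsto e^{iB(b,x)}g(x-a)$, indexed by
$w=(a,b)$, with $\int g^2=1$. Coefficients of a Schwartz function decay rapidly in $w$
(`IsFourier.stft_decay`), while the seminorms of the states grow polynomially (`sn_coh_le`). The
reconstruction therefore converges in $\mathcal S$, and every tempered distribution passes under the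
integral (`IsFourier.apply_eq_integral`). With a product window the states on $\Xi\times\Xi$ are
tensor products. This yields both the density of tensor products, in the form `dist2_ext`, and a
kernel theorem, `IsFourier.exists_kernel_extension`.

Existence of $\mathbf R$ with values in $\mathcal S$. Write $\langle
g_1\#f_1,g_2\#f_2\rangle=\langle g_1,f_1\#g_2\#f_2\rangle$. For $u\in\mathcal S'$ one has $\langle
u,f_1\#g_2\#f_2\rangle=\langle f_2\#u\#f_1,g_2\rangle$, and $f_2\#u\#f_1$ is Schwartz by (B). With
$g_2$ a coherent state this decays rapidly in its parameter. So the weighted family $f_1\#g_2\#f_2$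
is weakly bounded, hence bounded in $\mathcal S$, and letting $g_1$ be a coherent state gives joint
decay. The Baire argument `exists_uniform_sn_bound_bilin` makes the bound uniform in $f_1,f_2$, and
`IsFourier.exists_operator` synthesises the operator from these values.

Invertibility. $\mathbf R(f\otimes g)$ is the integral kernel of $h\mapsto f\#h\#g$. Hence the
symplectic Fourier transform of this kernel, restricted to first variable $Z$, is the transform of
$g\#\mathfrak e_{-Z}\#f$. Plancherel gives
$\int\langle\Theta_Z(f\#f'),g'\#g\rangle\,dZ=\langle\!\langle\mathbf R(f\otimes g),\mathbf
R(g'\otimes f')\rangle\!\rangle$, and (C) with (A) evaluates the left side as $\langle\!\langle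
f\otimes g,f'\otimes g'\rangle\!\rangle$. Cyclicity of $\int g_1\#f_1\#g_2\#f_2$ shows that the
transpose of $\mathbf R$ is $\mathbf R$ after exchange of variables. Together these say $\mathbf
R^2=1$ (`IsKernelMap.apply_apply`).

Finally $\mathbf N$ is $\mathbf R$ followed by the Fourier transform and a reflection, and $\mathbf
M$ adds the measure-preserving $\mathbf C$. All transposes are again isomorphisms of $\mathcal S$,
so precomposition with them gives the extensions to $\mathcal S'$ in both topologies. -/

namespace ModulationMaps

open MeasureTheory Filter Topology

/-! ### An increasing sequence of seminorms on the Schwartz space -/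

section Seminorms

variable {V : Type} [NormedAddCommGroup V] [NormedSpace ℝ V]

/-- The increasing family of seminorms `max_{k, m ≤ N} sup ‖x‖ ^ k ‖D ^ m f x‖` on `𝓢(V, ℂ)`. -/
noncomputable def sn (N : ℕ) : Seminorm ℂ 𝓢(V, ℂ) :=
  (Finset.Iic (N, N)).sup (schwartzSeminormFamily ℂ V ℂ)

theorem continuous_seminorm (k m : ℕ) :
    Continuous fun f : 𝓢(V, ℂ) => SchwartzMap.seminorm ℂ k m f :=
  (schwartz_withSeminorms ℂ V ℂ).continuous_seminorm (k, m)

theorem seminorm_le_sn {N k m : ℕ} (hk : k ≤ N) (hm : m ≤ N) (f : 𝓢(V, ℂ)) :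
    SchwartzMap.seminorm ℂ k m f ≤ sn N f :=
  Seminorm.le_def.1 (Finset.le_sup (f := schwartzSeminormFamily ℂ V ℂ)
    (Finset.mem_Iic.2 (Prod.mk_le_mk.2 ⟨hk, hm⟩) : (k, m) ∈ Finset.Iic (N, N))) f

theorem sn_le {N : ℕ} {f : 𝓢(V, ℂ)} {C : ℝ} (hC : 0 ≤ C)
    (h : ∀ k m, k ≤ N → m ≤ N → SchwartzMap.seminorm ℂ k m f ≤ C) : sn N f ≤ C := by
  refine Seminorm.finset_sup_apply_le hC fun i hi => ?_
  obtain ⟨h1, h2⟩ := Prod.mk_le_mk.1 (Finset.mem_Iic.1 hi : (i.1, i.2) ≤ (N, N))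
  exact h _ _ h1 h2

theorem sn_mono {M N : ℕ} (h : M ≤ N) (f : 𝓢(V, ℂ)) : sn M f ≤ sn N f :=
  sn_le (apply_nonneg _ _) fun _ _ hk hm => seminorm_le_sn (hk.trans h) (hm.trans h) f

theorem continuous_sn (N : ℕ) : Continuous fun f : 𝓢(V, ℂ) => sn N f :=
  Seminorm.continuous_of_le (q := ∑ i ∈ Finset.Iic (N, N), schwartzSeminormFamily ℂ V ℂ i)
    (by
      have : ⇑(∑ i ∈ Finset.Iic (N, N), schwartzSeminormFamily ℂ V ℂ i) =
          fun f => ∑ i ∈ Finset.Iic (N, N), schwartzSeminormFamily ℂ V ℂ i f := by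
        funext f
        simp
      rw [this]
      exact continuous_finsetSum _ fun i _ =>
        (schwartz_withSeminorms ℂ V ℂ).continuous_seminorm i)
    (Seminorm.finset_sup_le_sum _ _)

/-- The sequence `sn` is cofinal among continuous seminorms, so each continuity statement reduces to
an estimate with a single index. -/
theorem exists_le_sn (q : Seminorm ℂ 𝓢(V, ℂ)) (hq : Continuous q) :
    ∃ N : ℕ, ∃ C : ℝ, 0 < C ∧ ∀ f, q f ≤ C * sn N f := by
  obtain ⟨s, C, hC, h⟩ := Seminorm.bound_of_continuous (schwartz_withSeminorms ℂ V ℂ) q hq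
  refine ⟨s.sup fun i => max i.1 i.2, C, by positivity, fun f => ?_⟩
  refine (h f).trans ?_
  rw [smul_apply, NNReal.smul_def, smul_eq_mul]
  gcongr
  refine Seminorm.finset_sup_apply_le (apply_nonneg _ _) fun i hi => ?_
  have := Finset.le_sup (f := fun i : ℕ × ℕ => max i.1 i.2) hi
  exact seminorm_le_sn ((le_max_left _ _).trans this) ((le_max_right _ _).trans this) f

theorem exists_norm_le_sn {F : Type} [NormedAddCommGroup F] [NormedSpace ℂ F]
    (u : 𝓢(V, ℂ) →L[ℂ] F) : ∃ N : ℕ, ∃ C : ℝ, 0 < C ∧ ∀ f, ‖u f‖ ≤ C * sn N f :=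
  exists_le_sn ((normSeminorm ℂ F).comp u.toLinearMap) (continuous_norm.comp u.continuous)

theorem exists_sn_le_sn {V' : Type} [NormedAddCommGroup V'] [NormedSpace ℝ V']
    (A : 𝓢(V, ℂ) →L[ℂ] 𝓢(V', ℂ)) (N : ℕ) :
    ∃ M : ℕ, ∃ C : ℝ, 0 < C ∧ ∀ f, sn N (A f) ≤ C * sn M f :=
  exists_le_sn ((sn N).comp A.toLinearMap) ((continuous_sn N).comp A.continuous)

theorem one_add_pow_mul_le_sn {N k m : ℕ} (hk : k ≤ N) (hm : m ≤ N) (f : 𝓢(V, ℂ)) (x : V) :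
    (1 + ‖x‖) ^ k * ‖iteratedFDeriv ℝ m f x‖ ≤ 2 ^ N * sn N f :=
  SchwartzMap.one_add_le_sup_seminorm_apply (𝕜 := ℂ) (m := (N, N)) hk hm f x

/-- A linear map between Schwartz spaces that is bounded with respect to the seminorms is
continuous. -/
theorem continuous_of_sn_le {V' : Type} [NormedAddCommGroup V'] [NormedSpace ℝ V']
    (A : 𝓢(V, ℂ) →ₗ[ℂ] 𝓢(V', ℂ))
    (h : ∀ N, ∃ M : ℕ, ∃ C : ℝ, 0 ≤ C ∧ ∀ f, sn N (A f) ≤ C * sn M f) : Continuous A := by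
  refine (schwartz_withSeminorms ℂ V ℂ).continuous_of_isBounded (schwartz_withSeminorms ℂ V' ℂ) _
    fun i => ?_
  obtain ⟨M, C, hC, h⟩ := h (max i.1 i.2)
  refine ⟨Finset.Iic (M, M), ⟨C, hC⟩, fun f => ?_⟩
  exact (seminorm_le_sn (le_max_left _ _) (le_max_right _ _) (A f)).trans (h f)

theorem continuous_of_norm_le_sn {F : Type} [NormedAddCommGroup F] [NormedSpace ℂ F]
    (A : 𝓢(V, ℂ) →ₗ[ℂ] F) {M : ℕ} {C : ℝ} (hC : 0 ≤ C) (h : ∀ f, ‖A f‖ ≤ C * sn M f) :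
    Continuous A :=
  WithSeminorms.continuous_normedSpace_rng F (schwartz_withSeminorms ℂ V ℂ) _
    ⟨Finset.Iic (M, M), ⟨C, hC⟩, h⟩

theorem tendsto_of_seminorm {ι : Type} {l : Filter ι} {ψ : ι → 𝓢(V, ℂ)} {f : 𝓢(V, ℂ)}
    (h : ∀ k m, Tendsto (fun i => SchwartzMap.seminorm ℂ k m (ψ i - f)) l (𝓝 0)) :
    Tendsto ψ l (𝓝 f) := by
  refine ((schwartz_withSeminorms ℂ V ℂ).tendsto_nhds ψ f).2 fun i ε hε => ?_
  exact (h i.1 i.2).eventually (gt_mem_nhds hε)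

end Seminorms

/-! ### Integration of Schwartz-valued families -/

section SchwartzIntegral

variable {V : Type} [NormedAddCommGroup V] [NormedSpace ℝ V]

/-- A linear map from `𝓢(V, ℂ)` into functions on `V`, with continuous and bounded values, as a
continuous linear map into bounded continuous functions. -/
noncomputable def boundedCLM {F : Type} [NormedAddCommGroup F] [NormedSpace ℂ F]
    (A : 𝓢(V, ℂ) →ₗ[ℂ] V → F) (hc : ∀ f, Continuous (A f)) (N : ℕ) (hb : ∀ f x, ‖A f x‖ ≤ sn N f) :
    𝓢(V, ℂ) →L[ℂ] BoundedContinuousFunction V F :=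
  let L : 𝓢(V, ℂ) →ₗ[ℂ] BoundedContinuousFunction V F :=
    { toFun := fun f => BoundedContinuousFunction.ofNormedAddCommGroup (A f) (hc f) (sn N f) (hb f)
      map_add' := fun f g => by
        ext1 x
        exact congrFun (A.map_add f g) x
      map_smul' := fun a f => by
        ext1 x
        exact congrFun (A.map_smul a f) x }
  ⟨L, continuous_of_norm_le_sn L (M := N) zero_le_one fun f => by
    rw [one_mul]
    exact (BoundedContinuousFunction.norm_le (apply_nonneg _ _)).2 (hb f)⟩

/-- The map `f ↦ ‖x‖ ^ k • D ^ m f x` into bounded continuous functions. -/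
noncomputable def jetCLM (V : Type) [NormedAddCommGroup V] [NormedSpace ℝ V] (k m : ℕ) :
    𝓢(V, ℂ) →L[ℂ] BoundedContinuousFunction V (V [×m]→L[ℝ] ℂ) :=
  boundedCLM
    { toFun := fun f x => ‖x‖ ^ k • iteratedFDeriv ℝ m f x
      map_add' := fun f g => by
        funext x
        have := iteratedFDeriv_add_apply (x := x) ((f.smooth m).contDiffAt)
          ((g.smooth m).contDiffAt)
        simp only [FunLike.coe_add, this, smul_add, Pi.add_apply]
      map_smul' := fun a f => by
        funext x
        have := iteratedFDeriv_const_smul_apply (a := a) (x := x) ((f.smooth m).contDiffAt)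
        simp only [FunLike.coe_smul, this, RingHom.id_apply, Pi.smul_apply]
        rw [smul_comm] }
    (fun f => (continuous_norm.pow k).smul ((f.smooth m).continuous_iteratedFDeriv le_rfl))
    (max k m) fun f x => by
      refine le_trans ?_ (seminorm_le_sn (le_max_left k m) (le_max_right k m) f)
      refine le_trans (le_of_eq ?_) (SchwartzMap.le_seminorm ℂ k m f x)
      change ‖‖x‖ ^ k • iteratedFDeriv ℝ m f x‖ = _
      rw [norm_smul, norm_pow, norm_norm]

theorem jetCLM_apply (k m : ℕ) (f : 𝓢(V, ℂ)) (x : V) :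
    jetCLM V k m f x = ‖x‖ ^ k • iteratedFDeriv ℝ m f x := rfl

/-- Together with `norm_jetCLM_le` this makes each Schwartz seminorm the norm of a map into a Banach
space, where Bochner integration, Hahn–Banach and Banach–Steinhaus are available. -/
theorem seminorm_le_norm_jetCLM (k m : ℕ) (f : 𝓢(V, ℂ)) :
    SchwartzMap.seminorm ℂ k m f ≤ ‖jetCLM V k m f‖ := by
  refine SchwartzMap.seminorm_le_bound ℂ k m f (norm_nonneg (jetCLM V k m f)) fun x => ?_
  have := (jetCLM V k m f).norm_coe_le_norm x
  rwa [jetCLM_apply, norm_smul, norm_pow, norm_norm] at this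

theorem norm_jetCLM_le (k m : ℕ) (f : 𝓢(V, ℂ)) :
    ‖jetCLM V k m f‖ ≤ SchwartzMap.seminorm ℂ k m f := by
  refine (BoundedContinuousFunction.norm_le (apply_nonneg _ _)).2 fun x => ?_
  rw [jetCLM_apply, norm_smul, norm_pow, norm_norm]
  exact SchwartzMap.le_seminorm ℂ k m f x

theorem continuous_iteratedFDeriv_apply (m : ℕ) (x : V) :
    Continuous fun f : 𝓢(V, ℂ) => iteratedFDeriv ℝ m f x := by
  have := (BoundedContinuousFunction.evalCLM ℂ x).continuous.comp (jetCLM V 0 m).continuous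
  refine this.congr fun f => ?_
  simp [jetCLM_apply]

theorem continuous_eval (x : V) : Continuous fun f : 𝓢(V, ℂ) => f x := by
  have := (BoundedContinuousFunction.evalCLM ℂ x).continuous.comp
    (SchwartzMap.toBoundedContinuousFunctionCLM ℂ V ℂ).continuous
  exact this

/-- Hahn–Banach: a functional dominated by the norm of `J f` factors through `J`. -/
theorem exists_factor {S B : Type} [AddCommGroup S] [Module ℂ S] [NormedAddCommGroup B]
    [NormedSpace ℂ B] (J : S →ₗ[ℂ] B) (u : S →ₗ[ℂ] ℂ) (C : ℝ) (h : ∀ f, ‖u f‖ ≤ C * ‖J f‖) :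
    ∃ v : B →L[ℂ] ℂ, ∀ f, v (J f) = u f := by
  -- The bound makes `u` vanish on the kernel of `J`, so it descends to a bounded functional on the
  -- range, which is then extended.
  have hker : LinearMap.ker J ≤ LinearMap.ker u := fun f hf => by
    have := h f
    rw [LinearMap.mem_ker.1 hf, norm_zero, mul_zero] at this
    exact LinearMap.mem_ker.2 (norm_le_zero_iff.1 this)
  let u0 : LinearMap.range J →ₗ[ℂ] ℂ :=
    (LinearMap.ker J).liftQ u hker ∘ₗ (J.quotKerEquivRange.symm : _ →ₗ[ℂ] _)
  have hu0 : ∀ f, u0 ⟨J f, LinearMap.mem_range_self J f⟩ = u f := fun f => by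
    have : J.quotKerEquivRange.symm ⟨J f, LinearMap.mem_range_self J f⟩ =
        Submodule.Quotient.mk f := by
      rw [LinearEquiv.symm_apply_eq]; rfl
    simp only [u0, LinearMap.comp_apply, LinearEquiv.coe_coe, this]
    exact Submodule.liftQ_apply _ _ _
  let u1 : LinearMap.range J →L[ℂ] ℂ := u0.mkContinuous C fun y => by
    obtain ⟨y, f, rfl⟩ := y
    rw [hu0]
    exact h f
  obtain ⟨v, hv, -⟩ := exists_extension_norm_eq (LinearMap.range J) u1
  exact ⟨v, fun f => (hv ⟨J f, LinearMap.mem_range_self J f⟩).trans (hu0 f)⟩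

variable {W : Type} [TopologicalSpace W] [MeasurableSpace W] [OpensMeasurableSpace W]
  [SecondCountableTopology W]

theorem integrable_of_seminorm {ν : Measure W} {ψ : W → 𝓢(V, ℂ)} (hψ : Continuous ψ)
    (hi : ∀ k m, Integrable (fun w => SchwartzMap.seminorm ℂ k m (ψ w)) ν)
    {F : Type} [NormedAddCommGroup F] {L : 𝓢(V, ℂ) → F} (hL : Continuous L) {k m : ℕ}
    (hb : ∀ f, ‖L f‖ ≤ SchwartzMap.seminorm ℂ k m f) : Integrable (fun w => L (ψ w)) ν :=
  (hi k m).mono' (hL.comp hψ).aestronglyMeasurable (Eventually.of_forall fun _ => hb _)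

/-- The Schwartz space is not normed, so the integral is taken in a finite product of spaces of
bounded continuous functions, through which `u` factors. Point evaluations identify the integrated
jets with the jets of `I`. -/
theorem apply_eq_integral_of_jets {ν : Measure W} {ψ : W → 𝓢(V, ℂ)} (hψ : Continuous ψ)
    {I : 𝓢(V, ℂ)} {ι : Type} [Fintype ι] {F : ι → Type} [∀ i, NormedAddCommGroup (F i)]
    [∀ i, NormedSpace ℂ (F i)] [∀ i, CompleteSpace (F i)]
    (A : ∀ i, 𝓢(V, ℂ) →L[ℂ] BoundedContinuousFunction V (F i)) {q : ι → 𝓢(V, ℂ) → ℝ}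
    (hq : ∀ i f, ‖A i f‖ ≤ q i f) (hi : ∀ i, Integrable (fun w => q i (ψ w)) ν)
    (hI : ∀ i x, A i I x = ∫ w, A i (ψ w) x ∂ν) (u : 𝓢(V, ℂ) →L[ℂ] ℂ) {C : ℝ}
    (hu : ∀ f, ‖u f‖ ≤ C * ‖fun i => A i f‖) : u I = ∫ w, u (ψ w) ∂ν := by
  let J : 𝓢(V, ℂ) →L[ℂ] ((i : ι) → BoundedContinuousFunction V (F i)) :=
    ContinuousLinearMap.pi A
  obtain ⟨v, hv⟩ := exists_factor J.toLinearMap u.toLinearMap C hu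
  have hjet : ∀ i, Integrable (fun w => A i (ψ w)) ν := fun i =>
    (hi i).mono' ((A i).continuous.comp hψ).aestronglyMeasurable
      (Eventually.of_forall fun w => hq i _)
  have hJi : Integrable (fun w => J (ψ w)) ν := Integrable.of_eval fun i => hjet i
  have hJI : J I = ∫ w, J (ψ w) ∂ν := by
    funext i
    have h1 := (ContinuousLinearMap.proj (R := ℂ)
      (φ := fun i : ι => BoundedContinuousFunction V (F i)) i).integral_comp_comm hJi
    refine Eq.trans ?_ h1
    ext1 x
    have h2 := (BoundedContinuousFunction.evalCLM (β := F i) ℂ x).integral_comp_comm (hjet i)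
    exact (hI i x).trans h2
  calc u I = v (J I) := (hv I).symm
    _ = ∫ w, v (J (ψ w)) ∂ν := by rw [hJI]; exact (v.integral_comp_comm hJi).symm
    _ = ∫ w, u (ψ w) ∂ν := integral_congr_ae (Eventually.of_forall fun w => hv (ψ w))

/-- Integration of a continuous family of Schwartz functions whose seminorms are integrable. -/
theorem exists_schwartz_integral (ν : Measure W) (ψ : W → 𝓢(V, ℂ)) (hψ : Continuous ψ)
    (hi : ∀ k m, Integrable (fun w => SchwartzMap.seminorm ℂ k m (ψ w)) ν) :
    ∃ I : 𝓢(V, ℂ), (∀ x, I x = ∫ w, ψ w x ∂ν) ∧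
      (∀ k m, SchwartzMap.seminorm ℂ k m I ≤ ∫ w, SchwartzMap.seminorm ℂ k m (ψ w) ∂ν) ∧
      ∀ u : 𝓢(V, ℂ) →L[ℂ] ℂ, u I = ∫ w, u (ψ w) ∂ν := by
  have hD : ∀ m x, Integrable (fun w => iteratedFDeriv ℝ m (ψ w) x) ν := fun m x =>
    integrable_of_seminorm hψ hi (continuous_iteratedFDeriv_apply m x) (k := 0) (m := m)
      fun f => SchwartzMap.norm_iteratedFDeriv_le_seminorm ℂ f m x
  have hder : ∀ m x, HasFDerivAt (fun y => ∫ w, iteratedFDeriv ℝ m (ψ w) y ∂ν)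
      (∫ w, (iteratedFDeriv ℝ (m + 1) (ψ w) x).curryLeft ∂ν) x := by
    intro m x
    refine hasFDerivAt_integral_of_dominated_of_fderiv_le (s := Set.univ)
      (bound := fun w => SchwartzMap.seminorm ℂ 0 (m + 1) (ψ w))
      (F' := fun y w => (iteratedFDeriv ℝ (m + 1) (ψ w) y).curryLeft) univ_mem
      (Eventually.of_forall fun y => (hD m y).aestronglyMeasurable) (hD m x) ?_ ?_ (hi 0 (m + 1)) ?_
    · exact (((continuousMultilinearCurryLeftEquiv ℝ (fun _ : Fin (m + 1) => V)
        ℂ).continuous.comp (continuous_iteratedFDeriv_apply (m + 1) x)).comp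
          hψ).aestronglyMeasurable
    · refine Eventually.of_forall fun w y _ => ?_
      rw [ContinuousMultilinearMap.curryLeft_norm]
      exact SchwartzMap.norm_iteratedFDeriv_le_seminorm ℂ (ψ w) (m + 1) y
    · refine Eventually.of_forall fun w y _ => ?_
      exact (contDiff_iff_ftaylorSeries.1 ((ψ w).smooth (m + 1 : ℕ))).fderiv m
        (by exact_mod_cast m.lt_succ_self) y
  have hcurry : ∀ m x, ∫ w, (iteratedFDeriv ℝ (m + 1) (ψ w) x).curryLeft ∂ν =
      (∫ w, iteratedFDeriv ℝ (m + 1) (ψ w) x ∂ν).curryLeft := fun m x => by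
    have h := LinearIsometry.integral_comp_comm (F := V →L[ℝ] V [×m]→L[ℝ] ℂ) (𝕜 := ℝ) (μ := ν)
      (continuousMultilinearCurryLeftEquiv ℝ
      (fun _ : Fin (m + 1) => V) ℂ).toLinearIsometry
      (fun w => iteratedFDeriv ℝ (m + 1) (ψ w) x)
    exact h
  -- The integrated derivatives form a Taylor series of the integral. This gives smoothness and
  -- identifies all iterated derivatives at once.
  have htaylor : HasFTaylorSeriesUpTo (⊤ : ℕ∞) (fun x => ∫ w, ψ w x ∂ν)
      (fun x m => ∫ w, iteratedFDeriv ℝ m (ψ w) x ∂ν) := by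
    refine ⟨fun x => ?_, fun m _ x => ?_, fun m _ => ?_⟩
    · exact (ContinuousLinearMap.integral_comp_comm (continuousMultilinearCurryFin0 ℝ V
        ℂ).toContinuousLinearEquiv.toContinuousLinearMap (hD 0 x)).symm
    · exact (hder m x).congr_fderiv (hcurry m x)
    · exact continuous_iff_continuousAt.2 fun x => (hder m x).continuousAt
  have hbd : ∀ k m x, ‖x‖ ^ k * ‖∫ w, iteratedFDeriv ℝ m (ψ w) x ∂ν‖ ≤
      ∫ w, SchwartzMap.seminorm ℂ k m (ψ w) ∂ν := by
    intro k m x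
    refine (mul_le_mul_of_nonneg_left (norm_integral_le_integral_norm _) (by positivity)).trans ?_
    rw [← integral_const_mul]
    exact integral_mono ((hD m x).norm.const_mul _) (hi k m)
      fun w => SchwartzMap.le_seminorm ℂ k m (ψ w) x
  have hit : ∀ m x, iteratedFDeriv ℝ m (fun x => ∫ w, ψ w x ∂ν) x =
      ∫ w, iteratedFDeriv ℝ m (ψ w) x ∂ν := fun m x =>
    (htaylor.eq_iteratedFDeriv (by exact_mod_cast le_top) x).symm
  let I : 𝓢(V, ℂ) :=
    { toFun := fun x => ∫ w, ψ w x ∂ν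
      smooth' := htaylor.contDiff
      decay' := fun k m => ⟨_, fun x => by rw [hit]; exact hbd k m x⟩ }
  have hI : ∀ m x, iteratedFDeriv ℝ m I x = ∫ w, iteratedFDeriv ℝ m (ψ w) x ∂ν := hit
  refine ⟨I, fun x => rfl, fun k m => ?_, fun u => ?_⟩
  · refine SchwartzMap.seminorm_le_bound ℂ k m I
      (integral_nonneg fun w => apply_nonneg _ _) fun x => ?_
    rw [hI]; exact hbd k m x
  obtain ⟨N, C, hC, hu⟩ := exists_norm_le_sn u
  let s := Finset.Iic (N, N)
  refine apply_eq_integral_of_jets hψ (fun i : s => jetCLM V i.1.1 i.1.2)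
    (q := fun i f => SchwartzMap.seminorm ℂ i.1.1 i.1.2 f) (fun i f => norm_jetCLM_le _ _ f)
    (fun i => hi _ _) (fun i x => ?_) u (C := C) fun f => ?_
  · simp only [jetCLM_apply]
    rw [hI, integral_smul]
  · refine (hu f).trans (mul_le_mul_of_nonneg_left (sn_le (norm_nonneg _) fun k m hk hm => ?_) hC.le)
    have hmem : (k, m) ∈ s := Finset.mem_Iic.2 (Prod.mk_le_mk.2 ⟨hk, hm⟩)
    exact (seminorm_le_norm_jetCLM k m f).trans
      (norm_le_pi_norm (fun i : s => jetCLM V i.1.1 i.1.2 f) ⟨(k, m), hmem⟩)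

end SchwartzIntegral

/-! ### Completeness and uniform boundedness -/

section Complete

variable {V : Type} [NormedAddCommGroup V] [NormedSpace ℝ V]

/-- Integration against counting measure on ℕ. The seminorm bound, applied to tails of a series, is
what completeness needs. -/
theorem exists_schwartz_tsum (ψ : ℕ → 𝓢(V, ℂ))
    (hi : ∀ k m, Summable fun n => SchwartzMap.seminorm ℂ k m (ψ n)) :
    ∃ I : 𝓢(V, ℂ), (∀ x, I x = ∑' n, ψ n x) ∧
      ∀ k m, SchwartzMap.seminorm ℂ k m I ≤ ∑' n, SchwartzMap.seminorm ℂ k m (ψ n) := by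
  have hint : ∀ k m, Integrable (fun n => SchwartzMap.seminorm ℂ k m (ψ n)) Measure.count :=
    fun k m => integrable_count_iff.2 (hi k m).norm
  obtain ⟨I, h1, h2, -⟩ := exists_schwartz_integral Measure.count ψ continuous_of_discreteTopology
    hint
  refine ⟨I, fun x => ?_, fun k m => ?_⟩
  · rw [h1, integral_countable]
    · simp
    · refine integrable_of_seminorm continuous_of_discreteTopology hint (k := 0) (m := 0)
        (L := fun f : 𝓢(V, ℂ) => f x) (continuous_eval x)
        fun f => SchwartzMap.norm_le_seminorm ℂ f x
  · refine (h2 k m).trans (le_of_eq ?_)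
    rw [integral_countable (hint k m)]
    simp

/-- A sequence controlled at rate $2^{-n}$ in `sn n` has summable increments in every seminorm, so
its limit is the sum of a series whose tails tend to zero. Completeness gives the Baire property. -/
instance instCompleteSpaceSchwartz : CompleteSpace 𝓢(V, ℂ) := by
  have hcg : (uniformity 𝓢(V, ℂ)).IsCountablyGenerated :=
    IsUniformAddGroup.uniformity_countably_generated
  refine UniformSpace.complete_of_convergent_controlled_sequences
    (fun n => {p : 𝓢(V, ℂ) × 𝓢(V, ℂ) | sn n (p.2 - p.1) < (1 / 2) ^ n}) (fun n => ?_)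
    fun u hu => ?_
  · rw [uniformity_eq_comap_nhds_zero]
    refine ⟨{f | sn n f < (1 / 2) ^ n}, ?_, fun p hp => hp⟩
    refine (continuous_sn n).continuousAt.eventually (gt_mem_nhds ?_)
    change sn n (0 : 𝓢(V, ℂ)) < _
    rw [map_zero]; positivity
  let ψ : ℕ → 𝓢(V, ℂ) := fun n => u (n + 1) - u n
  have hψ : ∀ k m, Summable fun n => SchwartzMap.seminorm ℂ k m (ψ n) := fun k m => by
    rw [← summable_nat_add_iff (max k m)]
    refine Summable.of_nonneg_of_le (fun n => apply_nonneg _ _) (fun n => ?_)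
      ((summable_nat_add_iff (max k m)).2 summable_geometric_two)
    refine le_trans (seminorm_le_sn (N := n + max k m) (by omega) (by omega) _) ?_
    exact (hu (n + max k m) _ _ le_rfl (Nat.le_succ _)).le
  obtain ⟨I, hI, -⟩ := exists_schwartz_tsum ψ hψ
  refine ⟨u 0 + I, tendsto_of_seminorm fun k m => ?_⟩
  have htail : ∀ N, SchwartzMap.seminorm ℂ k m (u N - (u 0 + I)) ≤
      ∑' n, SchwartzMap.seminorm ℂ k m (ψ (n + N)) := fun N => by
    obtain ⟨T, hT, hT'⟩ := exists_schwartz_tsum (fun n => ψ (n + N))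
      fun k m => (summable_nat_add_iff N).2 (hψ k m)
    have : u N - (u 0 + I) = -T := by
      ext x
      have hs : Summable fun n => ψ n x := Summable.of_norm_bounded (hψ 0 0)
        fun n => SchwartzMap.norm_le_seminorm ℂ (ψ n) x
      have h1 := hs.sum_add_tsum_nat_add N
      have h2 : ∑ i ∈ Finset.range N, ψ i x = u N x - u 0 x :=
        Finset.sum_range_sub (fun n => u n x) N
      rw [h2, ← hI, ← hT] at h1
      have h3 : (u N - (u 0 + I)) x = u N x - (u 0 x + I x) := rfl
      have h4 : (-T) x = -(T x) := rfl
      rw [h3, h4, ← h1]; ring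
    rw [this, map_neg_eq_map]
    exact hT' k m
  exact squeeze_zero (fun N => apply_nonneg _ _) htail
    (tendsto_sum_nat_add fun n => SchwartzMap.seminorm ℂ k m (ψ n))

instance instBaireSpaceSchwartz : BaireSpace 𝓢(V, ℂ) := by
  have hcg : (uniformity 𝓢(V, ℂ)).IsCountablyGenerated :=
    IsUniformAddGroup.uniformity_countably_generated
  infer_instance

/-- Uniform boundedness principle for functionals on the Schwartz space. -/
theorem exists_uniform_sn_bound {ι : Type} (u : ι → 𝓢(V, ℂ) →L[ℂ] ℂ)
    (h : ∀ f, ∃ C, ∀ i, ‖u i f‖ ≤ C) :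
    ∃ N : ℕ, ∃ C : ℝ, 0 < C ∧ ∀ i f, ‖u i f‖ ≤ C * sn N f := by
  have h1 := (norm_withSeminorms ℂ ℂ).banach_steinhaus (𝓕 := u) fun _ f => by
    obtain ⟨C, hC⟩ := h f
    exact ⟨C, by rintro _ ⟨i, rfl⟩; exact hC i⟩
  obtain ⟨p, hp, hle⟩ := ((norm_withSeminorms ℂ
    ℂ).uniformEquicontinuous_iff_exists_continuous_seminorm
      (fun i => (u i).toLinearMap)).1 h1 0
  obtain ⟨N, C, hC, hN⟩ := exists_le_sn p hp
  exact ⟨N, C, hC, fun i f => (hle i f).trans (hN f)⟩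

theorem exists_sn_lt_subset {A : Set 𝓢(V, ℂ)} (hA : A ∈ 𝓝 (0 : 𝓢(V, ℂ))) :
    ∃ N : ℕ, ∃ ε : ℝ, 0 < ε ∧ ∀ f, sn N f < ε → f ∈ A := by
  obtain ⟨s, ε, hε, hs⟩ := ((schwartz_withSeminorms ℂ V ℂ).mem_nhds_iff 0 _).1 hA
  refine ⟨s.sup fun i => max i.1 i.2, ε, hε, fun f hf => hs ?_⟩
  rw [Seminorm.mem_ball_zero]
  refine lt_of_le_of_lt (Seminorm.finset_sup_apply_le (apply_nonneg _ _) fun i hi => ?_) hf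
  have := Finset.le_sup (f := fun i : ℕ × ℕ => max i.1 i.2) hi
  exact seminorm_le_sn ((le_max_left _ _).trans this) ((le_max_right _ _).trans this) f

/-- Uniform boundedness principle for separately continuous bilinear forms. -/
theorem exists_uniform_sn_bound_bilin {ι : Type} (b : ι → 𝓢(V, ℂ) →ₗ[ℂ] 𝓢(V, ℂ) →ₗ[ℂ] ℂ)
    (hl : ∀ i g, Continuous fun f => b i f g) (hr : ∀ i f, Continuous fun g => b i f g)
    (h : ∀ f g, ∃ C, ∀ i, ‖b i f g‖ ≤ C) :
    ∃ N : ℕ, ∃ C : ℝ, 0 < C ∧ ∀ i f g, ‖b i f g‖ ≤ C * sn N f * sn N g := by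
  -- One integer serves both as constant and as seminorm index. The sets are closed by continuity in
  -- `f` and cover the space by the one-variable principle in `g`, so Baire applies.
  let A : ℕ → Set 𝓢(V, ℂ) := fun n => {f | ∀ i g, ‖b i f g‖ ≤ n * sn n g}
  have hA : ∀ n, IsClosed (A n) := fun n => by
    have : A n = ⋂ i, ⋂ g, {f | ‖b i f g‖ ≤ n * sn n g} := by ext f; simp [A]
    rw [this]
    exact isClosed_iInter fun i => isClosed_iInter fun g =>
      isClosed_le (hl i g).norm continuous_const
  have hU : ⋃ n, A n = Set.univ := by
    refine Set.eq_univ_of_forall fun f => ?_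
    obtain ⟨N, C, -, hN⟩ := exists_uniform_sn_bound (fun i => (⟨b i f, hr i f⟩ : 𝓢(V, ℂ) →L[ℂ] ℂ))
      (h f)
    obtain ⟨n, hn⟩ := exists_nat_ge C
    refine Set.mem_iUnion.2 ⟨max n N, fun i g => (hN i g).trans ?_⟩
    have h1 : C ≤ ((max n N : ℕ) : ℝ) := hn.trans (by exact_mod_cast le_max_left n N)
    exact mul_le_mul h1 (sn_mono (le_max_right _ _) g) (apply_nonneg _ _) (by positivity)
  obtain ⟨n, f0, hf0⟩ := nonempty_interior_of_iUnion_of_closed hA hU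
  have hnhds : (fun f => f0 + f) ⁻¹' A n ∈ 𝓝 (0 : 𝓢(V, ℂ)) := by
    refine (continuous_const.add continuous_id).continuousAt.preimage_mem_nhds ?_
    simpa using mem_interior_iff_mem_nhds.1 hf0
  obtain ⟨N, ε, hε, hN⟩ := exists_sn_lt_subset hnhds
  have hsmall : ∀ f, sn N f < ε → ∀ i g, ‖b i f g‖ ≤ 2 * n * sn n g := fun f hf i g => by
    have h1 : ‖b i (f0 + f) g‖ ≤ n * sn n g := hN f hf i g
    have h2 : ‖b i f0 g‖ ≤ n * sn n g := interior_subset hf0 i g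
    have h3 : b i f g = b i (f0 + f) g - b i f0 g := by simp
    rw [h3]
    exact (norm_sub_le _ _).trans (by linarith)
  have hmain : ∀ i f g, ‖b i f g‖ ≤ 4 * n / ε * sn N f * sn n g := fun i f g => by
    -- The shift by `δ` keeps the scaling factor finite when `sn N f = 0`; it is removed by letting
    -- `δ` tend to zero.
    have hδ : ∀ δ > 0, ‖b i f g‖ ≤ 4 * n / ε * (sn N f + δ) * sn n g := fun δ hδ => by
      set r := sn N f + δ
      have hr : 0 < r := add_pos_of_nonneg_of_pos (apply_nonneg _ _) hδ
      have h1 : sn N (((ε / (2 * r) : ℝ) : ℂ) • f) < ε := by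
        rw [map_smul_eq_mul, Complex.norm_real, Real.norm_of_nonneg (by positivity)]
        have : ε / (2 * r) * sn N f ≤ ε / (2 * r) * r := by gcongr; simp [r, hδ.le]
        refine this.trans_lt ?_
        field_simp
        linarith
      have h2 := hsmall _ h1 i g
      rw [map_smul, LinearMap.smul_apply, norm_smul, Complex.norm_real,
        Real.norm_of_nonneg (by positivity), div_mul_eq_mul_div, div_le_iff₀ (by positivity)] at h2
      rw [div_mul_eq_mul_div, div_mul_eq_mul_div, le_div_iff₀ hε]
      linarith
    have hlim : Tendsto (fun δ : ℝ => 4 * n / ε * (sn N f + δ) * sn n g) (𝓝[>] 0)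
        (𝓝 (4 * n / ε * (sn N f + 0) * sn n g)) :=
      (Continuous.tendsto (by fun_prop) 0).mono_left nhdsWithin_le_nhds
    rw [add_zero] at hlim
    exact ge_of_tendsto hlim (eventually_mem_nhdsWithin.mono fun δ h => hδ δ h)
  refine ⟨max N n, 4 * n / ε + 1, by positivity, fun i f g => (hmain i f g).trans ?_⟩
  have h1 := sn_mono (le_max_left N n) f
  have h2 := sn_mono (le_max_right N n) g
  have h3 := apply_nonneg (sn N) f
  gcongr
  linarith

end Complete

/-! ### Continuity of Schwartz-valued families -/

section Continuity

variable {V : Type} [NormedAddCommGroup V] [NormedSpace ℝ V]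

/-- A family of Schwartz functions with jointly continuous derivatives and locally bounded
seminorms is continuous. -/
theorem continuous_schwartz_family [ProperSpace V] {W : Type} [TopologicalSpace W]
    {ψ : W → 𝓢(V, ℂ)}
    (h1 : ∀ m, Continuous fun p : W × V => iteratedFDeriv ℝ m (ψ p.1) p.2)
    (h2 : ∀ k m w₀, ∃ C, ∀ᶠ w in 𝓝 w₀, SchwartzMap.seminorm ℂ k m (ψ w) ≤ C) :
    Continuous ψ := by
  refine continuous_iff_continuousAt.2 fun w₀ => tendsto_of_seminorm fun k m => ?_
  refine tendsto_order.2 ⟨fun a ha => Eventually.of_forall fun w => ha.trans_le (apply_nonneg _ _),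
    fun ε' hε' => ?_⟩
  obtain ⟨ε, hε, hεε'⟩ := exists_between hε'
  obtain ⟨C, hC⟩ := h2 (k + 1) m w₀
  have hsub : ∀ w x, iteratedFDeriv ℝ m (ψ w - ψ w₀) x =
      iteratedFDeriv ℝ m (ψ w) x - iteratedFDeriv ℝ m (ψ w₀) x := fun w x => by
    have := iteratedFDeriv_sub_apply (x := x) (((ψ w).smooth m).contDiffAt)
      (((ψ w₀).smooth m).contDiffAt)
    rw [← this]; rfl
  have hC0 : SchwartzMap.seminorm ℂ (k + 1) m (ψ w₀) ≤ C := hC.self_of_nhds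
  have hCnn : 0 ≤ C := (apply_nonneg _ _).trans hC0
  -- Outside the ball of radius `R` the additional power of `‖x‖` bounds the difference by `2 * C /
  -- R`, which is below `ε`. Inside, compactness is used.
  let R : ℝ := 2 * C / ε + 1
  have hR : 0 < R := by positivity
  have hcomp : ∀ᶠ w in 𝓝 w₀, ∀ x ∈ Metric.closedBall (0 : V) R,
      ‖x‖ ^ k * ‖iteratedFDeriv ℝ m (ψ w) x - iteratedFDeriv ℝ m (ψ w₀) x‖ < ε := by
    refine (isCompact_closedBall 0 R).eventually_forall_of_forall_eventually fun x _ => ?_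
    have hcont : Continuous fun p : W × V =>
        ‖p.2‖ ^ k * ‖iteratedFDeriv ℝ m (ψ p.1) p.2 - iteratedFDeriv ℝ m (ψ w₀) p.2‖ :=
      (continuous_snd.norm.pow k).mul ((h1 m).sub
        (((ψ w₀).smooth m).continuous_iteratedFDeriv le_rfl |>.comp continuous_snd)).norm
    refine hcont.continuousAt.eventually (gt_mem_nhds ?_)
    simpa using hε
  filter_upwards [hC, hcomp] with w hw1 hw2
  refine lt_of_le_of_lt (SchwartzMap.seminorm_le_bound ℂ k m _ hε.le fun x => ?_) hεε'
  change ‖x‖ ^ k * ‖iteratedFDeriv ℝ m (⇑(ψ w - ψ w₀)) x‖ ≤ ε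
  by_cases hx : ‖x‖ ≤ R
  · have := hw2 x (mem_closedBall_zero_iff.2 hx)
    rw [← hsub] at this
    exact this.le
  · push Not at hx
    have h3 := SchwartzMap.le_seminorm ℂ (k + 1) m (ψ w - ψ w₀) x
    have h4 : SchwartzMap.seminorm ℂ (k + 1) m (ψ w - ψ w₀) ≤ 2 * C := by
      refine (map_sub_le_add _ _ _).trans ?_
      linarith
    have h5 : ‖x‖ * (‖x‖ ^ k * ‖iteratedFDeriv ℝ m (⇑(ψ w - ψ w₀)) x‖) ≤ 2 * C := by
      rw [← mul_assoc, ← pow_succ']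
      exact h3.trans h4
    set y := ‖x‖ ^ k * ‖iteratedFDeriv ℝ m (⇑(ψ w - ψ w₀)) x‖
    have hy : 0 ≤ y := by positivity
    have h6 : R * y ≤ 2 * C := (mul_le_mul_of_nonneg_right hx.le hy).trans h5
    by_contra hcon
    push Not at hcon
    have h7 : R * ε ≤ 2 * C := (mul_le_mul_of_nonneg_left hcon.le hR.le).trans h6
    have h8 : R * ε = 2 * C + ε := by simp only [R]; field_simp
    linarith

theorem iteratedFDeriv_slice {W : Type} [NormedAddCommGroup W] [NormedSpace ℝ W] {Φ : W × V → ℂ}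
    {m : ℕ} (hΦ : ContDiff ℝ m Φ) (w : W) (x : V) :
    iteratedFDeriv ℝ m (fun y => Φ (w, y)) x =
      (iteratedFDeriv ℝ m Φ (w, x)).compContinuousLinearMap
        fun _ => ContinuousLinearMap.inr ℝ W V := by
  have h1 : (fun y => Φ (w, y)) = (fun z => Φ ((w, 0) + z)) ∘ ContinuousLinearMap.inr ℝ W V := by
    funext y; simp
  have h2 : ContDiff ℝ m fun z => Φ ((w, 0) + z) := hΦ.comp (contDiff_const.add contDiff_id)
  rw [h1, ContinuousLinearMap.iteratedFDeriv_comp_right _ h2 x le_rfl, iteratedFDeriv_comp_add_left]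
  simp

theorem continuous_iteratedFDeriv_slice {W : Type} [NormedAddCommGroup W] [NormedSpace ℝ W]
    {Φ : W × V → ℂ} {m : ℕ} (hΦ : ContDiff ℝ m Φ) :
    Continuous fun p : W × V => iteratedFDeriv ℝ m (fun y => Φ (p.1, y)) p.2 := by
  simp_rw [iteratedFDeriv_slice hΦ]
  exact (ContinuousMultilinearMap.compContinuousLinearMapL (F := ℂ)
    (fun _ : Fin m => ContinuousLinearMap.inr ℝ W V)).continuous.comp
      (hΦ.continuous_iteratedFDeriv le_rfl)

end Continuity

/-! ### Characters and coherent states -/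

section Character

variable {V : Type} [NormedAddCommGroup V] [NormedSpace ℝ V] (B : V →L[ℝ] V →L[ℝ] ℝ)

/-- The character `x ↦ exp (i B(b, x))`. -/
noncomputable def chi (b x : V) : ℂ := Complex.exp (Complex.I * (B b x : ℂ))

theorem chi_hasTemperateGrowth (b : V) : (chi B b).HasTemperateGrowth :=
  hasTemperateGrowth_cexp_I.comp (B b).hasTemperateGrowth

theorem norm_chi (b x : V) : ‖chi B b x‖ = 1 := by
  simp [chi, Complex.norm_exp]

theorem chi_neg (b x : V) : chi B (-b) x = Complex.exp (-(Complex.I * (B b x : ℂ))) := by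
  simp [chi]

theorem contDiff_chi {m : ℕ∞} : ContDiff ℝ m fun p : V × V => chi B p.1 p.2 :=
  (contDiff_const.mul (Complex.ofRealCLM.contDiff.comp
    (B.isBoundedBilinearMap.contDiff))).cexp

theorem norm_iteratedFDeriv_cexp_I (m : ℕ) (t : ℝ) :
    ‖iteratedFDeriv ℝ m (fun t : ℝ => Complex.exp (Complex.I * (t : ℂ))) t‖ = 1 := by
  have h : ∀ m : ℕ, iteratedDeriv m (fun t : ℝ => Complex.exp (Complex.I * (t : ℂ))) =
      fun t : ℝ => Complex.I ^ m * Complex.exp (Complex.I * (t : ℂ)) := by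
    intro m
    induction m with
    | zero => simp
    | succ m ih =>
      rw [iteratedDeriv_succ, ih]
      funext t
      have h1 : HasDerivAt (fun t : ℝ => Complex.I * (t : ℂ)) Complex.I t := by
        simpa using (Complex.ofRealCLM.hasDerivAt (x := t)).const_mul Complex.I
      rw [(h1.cexp.const_mul (Complex.I ^ m)).deriv]
      ring
  rw [norm_iteratedFDeriv_eq_norm_iteratedDeriv, h]
  simp [Complex.norm_exp]

theorem norm_iteratedFDeriv_chi_le (m : ℕ) (b x : V) :
    ‖iteratedFDeriv ℝ m (chi B b) x‖ ≤ (‖B‖ * ‖b‖) ^ m := by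
  have h1 : chi B b = (fun t : ℝ => Complex.exp (Complex.I * (t : ℂ))) ∘ B b := rfl
  rw [h1, ContinuousLinearMap.iteratedFDeriv_comp_right (B b)
    (hasTemperateGrowth_cexp_I.1) x (i := m) (by exact_mod_cast le_top)]
  refine (ContinuousMultilinearMap.norm_compContinuousLinearMap_le _ _).trans ?_
  rw [norm_iteratedFDeriv_cexp_I, one_mul, Finset.prod_const, Finset.card_univ, Fintype.card_fin]
  gcongr
  exact B.le_opNorm b

end Character

section Coherent

variable {V : Type} [NormedAddCommGroup V] [NormedSpace ℝ V] (B : V →L[ℝ] V →L[ℝ] ℝ)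
  (g : 𝓢(V, ℂ))

/-- The coherent state `x ↦ exp (i B(b, x)) g(x - a)` with parameter `w = (a, b)`. -/
noncomputable def coh (w : V × V) : 𝓢(V, ℂ) :=
  SchwartzMap.smulLeftCLM ℂ (chi B w.2) (SchwartzMap.compSubConstCLM ℂ w.1 g)

theorem coh_apply (w : V × V) (x : V) : coh B g w x = chi B w.2 x * g (x - w.1) := by
  rw [coh, SchwartzMap.smulLeftCLM_apply_apply (chi_hasTemperateGrowth B w.2)]
  simp

/-- Each derivative of the character costs a factor `‖b‖`, and the weight `‖x‖ ^ k` is shifted to `x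
- a` at the cost of powers of `1 + ‖a‖`. Growth in the parameter is therefore polynomial. -/
theorem seminorm_coh_le (k m : ℕ) : ∃ C, 0 ≤ C ∧ ∀ w,
    SchwartzMap.seminorm ℂ k m (coh B g w) ≤ C * (1 + ‖w‖) ^ (k + m) := by
  refine ⟨2 ^ m * (1 + ‖B‖) ^ m * (2 ^ (max k m) * sn (max k m) g), by positivity, fun w =>
    SchwartzMap.seminorm_le_bound ℂ k m _ (by positivity) fun x => ?_⟩
  have hw1 : ‖w.1‖ ≤ ‖w‖ := norm_fst_le w
  have hw2 : ‖w.2‖ ≤ ‖w‖ := norm_snd_le w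
  have h1 : (coh B g w : V → ℂ) = fun x => chi B w.2 x * g (x - w.1) :=
    funext fun x => coh_apply B g w x
  have hsm : ContDiff ℝ m fun x => g (x - w.1) := (g.smooth m).comp (contDiff_id.sub contDiff_const)
  have h2 := norm_iteratedFDeriv_mul_le (𝕜 := ℝ) (n := m)
    ((chi_hasTemperateGrowth B w.2).1.of_le (by exact_mod_cast le_top)) hsm x le_rfl
  rw [h1]
  have hx : ‖x‖ ^ k ≤ (1 + ‖x - w.1‖) ^ k * (1 + ‖w‖) ^ k := by
    rw [← mul_pow]
    gcongr
    have : ‖x‖ ≤ ‖x - w.1‖ + ‖w.1‖ := by simpa using norm_add_le (x - w.1) w.1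
    nlinarith [norm_nonneg (x - w.1), norm_nonneg w]
  refine (mul_le_mul_of_nonneg_left h2 (by positivity)).trans ?_
  rw [Finset.mul_sum]
  have hterm : ∀ i ∈ Finset.range (m + 1), ‖x‖ ^ k * ((m.choose i : ℝ) *
      ‖iteratedFDeriv ℝ i (chi B w.2) x‖ * ‖iteratedFDeriv ℝ (m - i) (fun x => g (x - w.1)) x‖) ≤
      (m.choose i : ℝ) * ((1 + ‖B‖) ^ m * (2 ^ (max k m) * sn (max k m) g) *
        (1 + ‖w‖) ^ (k + m)) := fun i hi => by
    have hi' : i ≤ m := Nat.lt_succ_iff.1 (Finset.mem_range.1 hi)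
    have e1 : ‖iteratedFDeriv ℝ i (chi B w.2) x‖ ≤ (1 + ‖B‖) ^ m * (1 + ‖w‖) ^ m := by
      refine (norm_iteratedFDeriv_chi_le B i w.2 x).trans ?_
      rw [← mul_pow]
      have : ‖B‖ * ‖w.2‖ ≤ (1 + ‖B‖) * (1 + ‖w‖) := by
        gcongr
        · simp
        · linarith
      refine (pow_le_pow_left₀ (by positivity) this i).trans (pow_le_pow_right₀ ?_ hi')
      nlinarith [norm_nonneg B, norm_nonneg w]
    have e2 : (1 + ‖x - w.1‖) ^ k * ‖iteratedFDeriv ℝ (m - i) (fun x => g (x - w.1)) x‖ ≤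
        2 ^ (max k m) * sn (max k m) g := by
      rw [iteratedFDeriv_comp_sub]
      exact one_add_pow_mul_le_sn (le_max_left _ _) ((Nat.sub_le _ _).trans (le_max_right _ _)) g _
    calc _ ≤ ((1 + ‖x - w.1‖) ^ k * (1 + ‖w‖) ^ k) * ((m.choose i : ℝ) *
          ((1 + ‖B‖) ^ m * (1 + ‖w‖) ^ m) *
            ‖iteratedFDeriv ℝ (m - i) (fun x => g (x - w.1)) x‖) := by gcongr
      _ = (m.choose i : ℝ) * ((1 + ‖B‖) ^ m * ((1 + ‖x - w.1‖) ^ k *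
          ‖iteratedFDeriv ℝ (m - i) (fun x => g (x - w.1)) x‖) * (1 + ‖w‖) ^ (k + m)) := by ring
      _ ≤ _ := by gcongr
  refine (Finset.sum_le_sum hterm).trans (le_of_eq ?_)
  rw [← Finset.sum_mul]
  have := Nat.sum_range_choose m
  rw [← Nat.cast_sum, this]
  push_cast
  ring

theorem sn_coh_le (N : ℕ) : ∃ C, 0 < C ∧ ∀ w, sn N (coh B g w) ≤ C * (1 + ‖w‖) ^ (2 * N) := by
  choose C hC h using seminorm_coh_le B g
  refine ⟨1 + ∑ k ∈ Finset.range (N + 1), ∑ m ∈ Finset.range (N + 1), C k m,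
    add_pos_of_pos_of_nonneg one_pos (Finset.sum_nonneg fun k _ => Finset.sum_nonneg fun m _ =>
      hC k m), fun w => sn_le ?_ fun k m hk hm => ?_⟩
  · exact mul_nonneg (add_nonneg zero_le_one (Finset.sum_nonneg fun k _ => Finset.sum_nonneg
      fun m _ => hC k m)) (by positivity)
  refine (h k m w).trans (mul_le_mul ?_ ?_ (by positivity) ?_)
  · have h1 : C k m ≤ ∑ m ∈ Finset.range (N + 1), C k m :=
      Finset.single_le_sum (f := fun m => C k m) (fun m _ => hC k m)
        (Finset.mem_range.2 (Nat.lt_succ_iff.2 hm))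
    have h2 : ∑ m ∈ Finset.range (N + 1), C k m ≤
        ∑ k ∈ Finset.range (N + 1), ∑ m ∈ Finset.range (N + 1), C k m :=
      Finset.single_le_sum (f := fun k => ∑ m ∈ Finset.range (N + 1), C k m)
        (fun k _ => Finset.sum_nonneg fun m _ => hC k m)
        (Finset.mem_range.2 (Nat.lt_succ_iff.2 hk))
    linarith
  · exact pow_le_pow_right₀ (by linarith [norm_nonneg w]) (by omega)
  · exact add_nonneg zero_le_one (Finset.sum_nonneg fun k _ => Finset.sum_nonneg fun m _ =>
      hC k m)

theorem continuous_coh [ProperSpace V] : Continuous (coh B g) := by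
  refine continuous_schwartz_family (fun m => ?_) fun k m w₀ => ?_
  · have hΦ : ContDiff ℝ m fun p : (V × V) × V => chi B p.1.2 p.2 * g (p.2 - p.1.1) :=
      ((contDiff_chi B).comp ((contDiff_snd.comp contDiff_fst).prodMk contDiff_snd)).mul
        ((g.smooth m).comp (contDiff_snd.sub (contDiff_fst.comp contDiff_fst)))
    refine (continuous_iteratedFDeriv_slice hΦ).congr fun p => ?_
    congr 1
    funext y
    exact (coh_apply B g p.1 y).symm
  · obtain ⟨C, -, hC⟩ := seminorm_coh_le B g k m
    have hcont : Continuous fun w : V × V => C * (1 + ‖w‖) ^ (k + m) := by fun_prop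
    refine ⟨C * (1 + ‖w₀‖) ^ (k + m) + 1, ?_⟩
    filter_upwards [hcont.continuousAt.eventually (gt_mem_nhds (lt_add_one _))] with w hw
    exact (hC w).trans hw.le

end Coherent

/-! ### Coherent-state coefficients and their decay -/

section Stft

variable {V : Type} [NormedAddCommGroup V] [NormedSpace ℝ V]

theorem exists_sn_bound_of_seminorm {V' ι : Type} [NormedAddCommGroup V'] [NormedSpace ℝ V']
    {A : ι → 𝓢(V, ℂ) → 𝓢(V', ℂ)} {r : ι → ℝ} (hr : ∀ i, 0 < r i)
    (h : ∀ k m, ∃ M : ℕ, ∃ C : ℝ, 0 ≤ C ∧ ∀ i f,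
      r i * SchwartzMap.seminorm ℂ k m (A i f) ≤ C * sn M f) (N : ℕ) :
    ∃ M : ℕ, ∃ C : ℝ, 0 < C ∧ ∀ i f, r i * sn N (A i f) ≤ C * sn M f := by
  choose M C hC h using h
  let M' := (Finset.Iic (N, N)).sup fun p : ℕ × ℕ => M p.1 p.2
  let C' := 1 + ∑ p ∈ Finset.Iic (N, N), C p.1 p.2
  have hC' : 0 < C' := add_pos_of_pos_of_nonneg one_pos (Finset.sum_nonneg fun p _ => hC _ _)
  refine ⟨M', C', hC', fun i f => ?_⟩
  rw [← le_div_iff₀' (hr i)]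
  refine sn_le (div_nonneg (mul_nonneg hC'.le (apply_nonneg _ _)) (hr i).le) fun k m hk hm => ?_
  rw [le_div_iff₀' (hr i)]
  have hmem : (k, m) ∈ Finset.Iic (N, N) := Finset.mem_Iic.2 (Prod.mk_le_mk.2 ⟨hk, hm⟩)
  have h1 : C k m ≤ C' := by
    have := Finset.single_le_sum (f := fun p : ℕ × ℕ => C p.1 p.2) (fun p _ => hC _ _) hmem
    simp only [C']; linarith
  have h2 : M k m ≤ M' := Finset.le_sup (f := fun p : ℕ × ℕ => M p.1 p.2) hmem
  exact (h k m i f).trans (mul_le_mul h1 (sn_mono h2 f) (apply_nonneg _ _) hC'.le)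

variable (g : 𝓢(V, ℂ))

/-- The function `x ↦ g(x - a) f(x)`. -/
noncomputable def localize (a : V) (f : 𝓢(V, ℂ)) : 𝓢(V, ℂ) :=
  SchwartzMap.smulLeftCLM ℂ (SchwartzMap.compSubConstCLM ℂ a g) f

theorem localize_apply (a : V) (f : 𝓢(V, ℂ)) (x : V) :
    localize g a f x = g (x - a) * f x := by
  rw [localize, SchwartzMap.smulLeftCLM_apply_apply (SchwartzMap.hasTemperateGrowth _)]
  simp

/-- The inequality `1 + ‖a‖ ≤ (1 + ‖x - a‖) * (1 + ‖x‖)` trades decay in `a` for weights that `g`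
and `f` absorb. -/
theorem seminorm_localize_le (N k m : ℕ) : ∃ M : ℕ, ∃ C : ℝ, 0 ≤ C ∧ ∀ (a : V) (f : 𝓢(V, ℂ)),
    (1 + ‖a‖) ^ N * SchwartzMap.seminorm ℂ k m (localize g a f) ≤ C * sn M f := by
  let M := max (k + N) m
  refine ⟨M, 2 ^ m * (2 ^ M * sn M g) * 2 ^ M, by positivity, fun a f => ?_⟩
  have ha : 0 < (1 + ‖a‖) ^ N := by positivity
  rw [← le_div_iff₀' ha]
  refine SchwartzMap.seminorm_le_bound ℂ k m _ (by positivity) fun x => ?_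
  rw [le_div_iff₀' ha]
  have h1 : (localize g a f : V → ℂ) = fun x => g (x - a) * f x :=
    funext fun x => localize_apply g a f x
  have hsm : ContDiff ℝ m fun x => g (x - a) := (g.smooth m).comp (contDiff_id.sub contDiff_const)
  have h2 := norm_iteratedFDeriv_mul_le (𝕜 := ℝ) (n := m) hsm (f.smooth m) x le_rfl
  rw [h1]
  have hx : (1 + ‖a‖) ^ N * ‖x‖ ^ k ≤ (1 + ‖x - a‖) ^ N * (1 + ‖x‖) ^ (k + N) := by
    have e1 : 1 + ‖a‖ ≤ (1 + ‖x - a‖) * (1 + ‖x‖) := by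
      have : ‖a‖ ≤ ‖x‖ + ‖x - a‖ := by simpa using norm_sub_le x (x - a)
      nlinarith [norm_nonneg (x - a), norm_nonneg x]
    calc (1 + ‖a‖) ^ N * ‖x‖ ^ k ≤ ((1 + ‖x - a‖) * (1 + ‖x‖)) ^ N * (1 + ‖x‖) ^ k := by
          gcongr
          simp
      _ = _ := by rw [mul_pow, pow_add]; ring
  refine (mul_le_mul_of_nonneg_left (mul_le_mul_of_nonneg_left h2 (by positivity)) ha.le).trans ?_
  rw [Finset.mul_sum, Finset.mul_sum]
  have hterm : ∀ i ∈ Finset.range (m + 1), (1 + ‖a‖) ^ N * (‖x‖ ^ k * ((m.choose i : ℝ) *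
      ‖iteratedFDeriv ℝ i (fun x => g (x - a)) x‖ * ‖iteratedFDeriv ℝ (m - i) f x‖)) ≤
      (m.choose i : ℝ) * ((2 ^ M * sn M g) * (2 ^ M * sn M f)) := fun i hi => by
    have hi' : i ≤ m := Nat.lt_succ_iff.1 (Finset.mem_range.1 hi)
    have e1 : (1 + ‖x - a‖) ^ N * ‖iteratedFDeriv ℝ i (fun x => g (x - a)) x‖ ≤
        2 ^ M * sn M g := by
      rw [iteratedFDeriv_comp_sub]
      exact one_add_pow_mul_le_sn ((Nat.le_add_left _ _).trans (le_max_left _ _))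
        (hi'.trans (le_max_right _ _)) g _
    have e2 : (1 + ‖x‖) ^ (k + N) * ‖iteratedFDeriv ℝ (m - i) f x‖ ≤ 2 ^ M * sn M f :=
      one_add_pow_mul_le_sn (le_max_left _ _) ((Nat.sub_le _ _).trans (le_max_right _ _)) f _
    calc _ = ((1 + ‖a‖) ^ N * ‖x‖ ^ k) * ((m.choose i : ℝ) *
      ‖iteratedFDeriv ℝ i (fun x => g (x - a)) x‖ * ‖iteratedFDeriv ℝ (m - i) f x‖) := by ring
      _ ≤ ((1 + ‖x - a‖) ^ N * (1 + ‖x‖) ^ (k + N)) * ((m.choose i : ℝ) *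
      ‖iteratedFDeriv ℝ i (fun x => g (x - a)) x‖ * ‖iteratedFDeriv ℝ (m - i) f x‖) := by gcongr
      _ = (m.choose i : ℝ) * (((1 + ‖x - a‖) ^ N *
          ‖iteratedFDeriv ℝ i (fun x => g (x - a)) x‖) *
            ((1 + ‖x‖) ^ (k + N) * ‖iteratedFDeriv ℝ (m - i) f x‖)) := by ring
      _ ≤ _ := by gcongr
  refine (Finset.sum_le_sum hterm).trans (le_of_eq ?_)
  rw [← Finset.sum_mul]
  have := Nat.sum_range_choose m
  rw [← Nat.cast_sum, this]
  push_cast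
  ring

variable [MeasurableSpace V] [BorelSpace V] [SecondCountableTopology V]

/-- `𝓕` is the Fourier transform `(𝓕 f)(y) = ∫ exp (-i B(y, x)) f(x) dμ(x)` on the Schwartz space,
with the inversion formula `f(x) = ∫ exp (i B(y, x)) (𝓕 f)(y) dμ(y)`. -/
structure IsFourier (μ : Measure V) (B : V →L[ℝ] V →L[ℝ] ℝ) (F : 𝓢(V, ℂ) →L[ℂ] 𝓢(V, ℂ)) :
    Prop where
  apply : ∀ f y, F f y = ∫ x, chi B (-y) x * f x ∂μ
  inv : ∀ f x, f x = ∫ y, chi B y x * F f y ∂μ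

variable (μ : Measure V) [μ.HasTemperateGrowth] (B : V →L[ℝ] V →L[ℝ] ℝ)

/-- The coefficient `f ↦ ∫ f(x) exp (-i B(b, x)) g(x - a) dμ(x)`, for `w = (a, b)`. -/
noncomputable def stft (w : V × V) : 𝓢(V, ℂ) →L[ℂ] ℂ := regular μ (coh B g (w.1, -w.2))

theorem stft_apply (w : V × V) (f : 𝓢(V, ℂ)) :
    stft g μ B w f = ∫ x, coh B g (w.1, -w.2) x * f x ∂μ :=
  regular_apply μ (SchwartzMap.hasTemperateGrowth _) f

theorem regular_symm (f h : 𝓢(V, ℂ)) : regular μ f h = regular μ h f := by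
  rw [regular_apply μ f.hasTemperateGrowth, regular_apply μ h.hasTemperateGrowth]
  simp_rw [mul_comm]

theorem continuous_stft [ProperSpace V] (f : 𝓢(V, ℂ)) :
    Continuous fun w => stft g μ B w f := by
  have h : (fun w => stft g μ B w f) = fun w : V × V => regular μ f (coh B g (w.1, -w.2)) :=
    funext fun w => regular_symm μ _ _
  rw [h]
  exact (regular μ f).continuous.comp ((continuous_coh B g).comp
    (continuous_fst.prodMk continuous_snd.neg))

variable {g μ B} {F : 𝓢(V, ℂ) →L[ℂ] 𝓢(V, ℂ)}

theorem IsFourier.stft_eq (hF : IsFourier μ B F) (w : V × V) (f : 𝓢(V, ℂ)) :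
    stft g μ B w f = F (localize g w.1 f) w.2 := by
  rw [stft_apply, hF.apply]
  refine integral_congr_ae (Eventually.of_forall fun x => ?_)
  simp only [coh_apply, localize_apply]
  ring

/-- Decay in the position `a` comes from the localisation, decay in the frequency `b` from the
continuity of the Fourier transform on the Schwartz space. The constant depends on `f` through a
seminorm only, uniformly in the parameter. -/
theorem IsFourier.stft_decay (hF : IsFourier μ B F) (g : 𝓢(V, ℂ)) (N : ℕ) :
    ∃ M : ℕ, ∃ C : ℝ, 0 < C ∧ ∀ w f, (1 + ‖w‖) ^ N * ‖stft g μ B w f‖ ≤ C * sn M f := by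
  obtain ⟨M, C, hC, h⟩ := exists_sn_le_sn F N
  obtain ⟨M', C', hC', h'⟩ := exists_sn_bound_of_seminorm (A := localize g)
    (r := fun a => (1 + ‖a‖) ^ N) (fun a => by positivity) (seminorm_localize_le g N) M
  refine ⟨M', 2 ^ N * C * C', by positivity, fun w f => ?_⟩
  rw [hF.stft_eq]
  have h1 : 1 + ‖w‖ ≤ (1 + ‖w.1‖) * (1 + ‖w.2‖) := by
    rw [Prod.norm_def]
    rcases max_cases ‖w.1‖ ‖w.2‖ with ⟨h, _⟩ | ⟨h, _⟩ <;> rw [h] <;>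
      nlinarith [norm_nonneg w.1, norm_nonneg w.2]
  have h2 : (1 + ‖w.2‖) ^ N * ‖F (localize g w.1 f) w.2‖ ≤ 2 ^ N * sn N (F (localize g w.1 f)) := by
    simpa using one_add_pow_mul_le_sn (le_refl N) (Nat.zero_le N) (F (localize g w.1 f)) w.2
  calc (1 + ‖w‖) ^ N * ‖F (localize g w.1 f) w.2‖
      ≤ ((1 + ‖w.1‖) * (1 + ‖w.2‖)) ^ N * ‖F (localize g w.1 f) w.2‖ := by gcongr
    _ = (1 + ‖w.1‖) ^ N * ((1 + ‖w.2‖) ^ N * ‖F (localize g w.1 f) w.2‖) := by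
        rw [mul_pow]; ring
    _ ≤ (1 + ‖w.1‖) ^ N * (2 ^ N * (C * sn M (localize g w.1 f))) := by
        refine mul_le_mul_of_nonneg_left (h2.trans ?_) (by positivity)
        exact mul_le_mul_of_nonneg_left (h _) (by positivity)
    _ = 2 ^ N * C * ((1 + ‖w.1‖) ^ N * sn M (localize g w.1 f)) := by ring
    _ ≤ 2 ^ N * C * (C' * sn M' f) :=
        mul_le_mul_of_nonneg_left (h' _ _) (by positivity)
    _ = _ := by ring

end Stft

/-! ### Superpositions with rapidly decreasing coefficients -/

section Weights

variable {W : Type} [NormedAddCommGroup W] [MeasurableSpace W] (ν : Measure W)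
  [ν.HasTemperateGrowth]

theorem integrable_of_decay [OpensMeasurableSpace W] [SecondCountableTopology W] {F : Type} [NormedAddCommGroup F] {h : W → F}
    (hc : Continuous h) {C : ℝ} (hb : ∀ w, (1 + ‖w‖) ^ ν.integrablePower * ‖h w‖ ≤ C) :
    Integrable h ν := by
  refine ((Measure.integrable_pow_neg_integrablePower ν).const_mul C).mono'
    hc.aestronglyMeasurable (Eventually.of_forall fun w => ?_)
  have h1 : 0 < (1 + ‖w‖) ^ ν.integrablePower := by positivity
  rw [Real.rpow_neg (by positivity), Real.rpow_natCast, ← div_eq_mul_inv, le_div_iff₀ h1, mul_comm]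
  exact hb w

theorem exists_integral_le_of_decay : ∃ D : ℝ, 0 < D ∧ ∀ (h : W → ℝ) (C : ℝ), 0 ≤ C →
    (∀ w, 0 ≤ h w) → (∀ w, (1 + ‖w‖) ^ ν.integrablePower * h w ≤ C) → ∫ w, h w ∂ν ≤ C * D := by
  refine ⟨1 + ∫ w, (1 + ‖w‖) ^ (-(ν.integrablePower : ℝ)) ∂ν,
    add_pos_of_pos_of_nonneg one_pos (integral_nonneg fun w => by positivity), fun h C hC h0 hb => ?_⟩
  have h1 : ∫ w, h w ∂ν ≤ ∫ w, C * (1 + ‖w‖) ^ (-(ν.integrablePower : ℝ)) ∂ν := by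
    refine integral_mono_of_nonneg (Eventually.of_forall h0)
      ((Measure.integrable_pow_neg_integrablePower ν).const_mul C) (Eventually.of_forall fun w => ?_)
    have h1 : 0 < (1 + ‖w‖) ^ ν.integrablePower := by positivity
    simp only
    rw [Real.rpow_neg (by positivity), Real.rpow_natCast, ← div_eq_mul_inv, le_div_iff₀ h1,
      mul_comm]
    exact hb w
  refine h1.trans ?_
  rw [integral_const_mul]
  gcongr
  simp

/-- Superposition `∫ c(w) Ψ(w) dν(w)` of a family of Schwartz functions of polynomial growth with
rapidly decreasing coefficients. -/
theorem exists_superposition [OpensMeasurableSpace W] [SecondCountableTopology W] {V : Type}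
    [NormedAddCommGroup V] [NormedSpace ℝ V] {Ψ : W → 𝓢(V, ℂ)} (hc : Continuous Ψ)
    {A : ℕ → ℝ} {L : ℕ → ℕ} (hA : ∀ N, 0 ≤ A N)
    (hΨ : ∀ N w, sn N (Ψ w) ≤ A N * (1 + ‖w‖) ^ L N) :
    ∃ D : ℝ, 0 < D ∧ ∀ c : W → ℂ, Continuous c → (∀ K, ∃ C, ∀ w, (1 + ‖w‖) ^ K * ‖c w‖ ≤ C) →
      ∃ I : 𝓢(V, ℂ), (∀ x, Integrable (fun w => c w * Ψ w x) ν ∧ I x = ∫ w, c w * Ψ w x ∂ν) ∧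
        (∀ u : 𝓢(V, ℂ) →L[ℂ] ℂ, u I = ∫ w, c w * u (Ψ w) ∂ν) ∧
        ∀ N C, (∀ w, (1 + ‖w‖) ^ (ν.integrablePower + L N) * ‖c w‖ ≤ C) →
          sn N I ≤ A N * C * D := by
  obtain ⟨D, hD, hD'⟩ := exists_integral_le_of_decay ν
  refine ⟨D, hD, fun c hcc hdec => ?_⟩
  have hψ : Continuous fun w => c w • Ψ w := hcc.smul hc
  have hbd : ∀ N k m C, k ≤ N → m ≤ N →
      (∀ w, (1 + ‖w‖) ^ (ν.integrablePower + L N) * ‖c w‖ ≤ C) →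
      ∀ w, (1 + ‖w‖) ^ ν.integrablePower * SchwartzMap.seminorm ℂ k m (c w • Ψ w) ≤ A N * C := by
    intro N k m C hk hm h w
    rw [map_smul_eq_mul]
    calc _ ≤ (1 + ‖w‖) ^ ν.integrablePower * (‖c w‖ * (A N * (1 + ‖w‖) ^ L N)) := by
          gcongr
          exact (seminorm_le_sn hk hm _).trans (hΨ N w)
      _ = A N * ((1 + ‖w‖) ^ (ν.integrablePower + L N) * ‖c w‖) := by rw [pow_add]; ring
      _ ≤ _ := mul_le_mul_of_nonneg_left (h w) (hA N)
  have hint : ∀ k m, Integrable (fun w => SchwartzMap.seminorm ℂ k m (c w • Ψ w)) ν := fun k m => by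
    obtain ⟨C, hC⟩ := hdec (ν.integrablePower + L (max k m))
    refine integrable_of_decay ν ((continuous_seminorm k m).comp hψ) (C := A (max k m) * C) fun w => ?_
    rw [Real.norm_of_nonneg (apply_nonneg _ _)]
    exact hbd _ k m C (le_max_left _ _) (le_max_right _ _) hC w
  obtain ⟨I, h1, h2, h3⟩ := exists_schwartz_integral ν _ hψ hint
  refine ⟨I, fun x => ⟨?_, h1 x⟩, fun u => ?_, fun N C h => ?_⟩
  · exact integrable_of_seminorm hψ hint (L := fun f : 𝓢(V, ℂ) => f x) (k := 0) (m := 0)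
      (continuous_eval x) fun f => SchwartzMap.norm_le_seminorm ℂ f x
  · rw [h3]
    refine integral_congr_ae (Eventually.of_forall fun w => ?_)
    simp
  · have hC : 0 ≤ C := le_trans (by positivity) (h 0)
    refine sn_le (by have := hA N; positivity) fun k m hk hm => (h2 k m).trans ?_
    exact hD' _ _ (mul_nonneg (hA N) hC) (fun w => apply_nonneg _ _) (hbd N k m C hk hm h)

/-- Superposition `F ↦ ∫ c(w, F) Ψ(w) dν(w)` with coefficients depending on a Schwartz function. -/
theorem exists_superposition_clm [OpensMeasurableSpace W] [SecondCountableTopology W] {V V' : Type}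
    [NormedAddCommGroup V] [NormedSpace ℝ V] [NormedAddCommGroup V'] [NormedSpace ℝ V']
    {Ψ : W → 𝓢(V, ℂ)} (hc : Continuous Ψ)
    {A : ℕ → ℝ} {L : ℕ → ℕ} (hA : ∀ N, 0 ≤ A N)
    (hΨ : ∀ N w, sn N (Ψ w) ≤ A N * (1 + ‖w‖) ^ L N) (c : W → 𝓢(V', ℂ) →L[ℂ] ℂ)
    (hcont : ∀ f, Continuous fun w => c w f) (hdec : ∀ K, ∃ M : ℕ, ∃ C : ℝ, 0 < C ∧
      ∀ w f, (1 + ‖w‖) ^ K * ‖c w f‖ ≤ C * sn M f) :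
    ∃ R : 𝓢(V', ℂ) →L[ℂ] 𝓢(V, ℂ), ∀ f (u : 𝓢(V, ℂ) →L[ℂ] ℂ),
      u (R f) = ∫ w, c w f * u (Ψ w) ∂ν := by
  obtain ⟨D, hD, h⟩ := exists_superposition ν hc hA hΨ
  have hdec' : ∀ f K, ∃ C, ∀ w, (1 + ‖w‖) ^ K * ‖c w f‖ ≤ C := fun f K => by
    obtain ⟨M, C, -, h⟩ := hdec K
    exact ⟨_, fun w => h w f⟩
  choose I h1 h2 h3 using fun f => h (fun w => c w f) (hcont f) (hdec' f)
  let R : 𝓢(V', ℂ) →ₗ[ℂ] 𝓢(V, ℂ) :=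
    { toFun := I
      map_add' := fun f f' => by
        ext x
        change I (f + f') x = I f x + I f' x
        rw [(h1 _ x).2, (h1 _ x).2, (h1 _ x).2, ← integral_add (h1 f x).1 (h1 f' x).1]
        simp [add_mul]
      map_smul' := fun a f => by
        ext x
        change I (a • f) x = a * I f x
        rw [(h1 _ x).2, (h1 _ x).2, ← integral_const_mul]
        simp [mul_assoc] }
  refine ⟨⟨R, continuous_of_sn_le R fun N => ?_⟩, fun f u => h2 f u⟩
  obtain ⟨M, C, hC, h⟩ := hdec (ν.integrablePower + L N)
  refine ⟨M, A N * C * D, by have := hA N; positivity, fun f => ?_⟩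
  refine (h3 f N _ fun w => h w f).trans (le_of_eq (by ring))

end Weights

/-! ### The reconstruction formula -/

section Reconstruction

variable {V : Type} [NormedAddCommGroup V] [NormedSpace ℝ V] [MeasurableSpace V] [BorelSpace V]
  [FiniteDimensional ℝ V] {μ : Measure V} [μ.IsAddHaarMeasure] {B : V →L[ℝ] V →L[ℝ] ℝ}
  {F : 𝓢(V, ℂ) →L[ℂ] 𝓢(V, ℂ)} {g : 𝓢(V, ℂ)}

instance instHasTemperateGrowthProd {V' : Type} [NormedAddCommGroup V'] [NormedSpace ℝ V']
    [MeasurableSpace V'] [BorelSpace V'] [FiniteDimensional ℝ V'] {μ' : Measure V'}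
    [μ'.IsAddHaarMeasure] : (μ.prod μ').HasTemperateGrowth :=
  have : SFinite μ := inferInstance
  have := FiniteDimensional.proper ℝ V
  have := FiniteDimensional.proper ℝ V'
  have : (μ.prod μ').IsAddHaarMeasure := Measure.prod.instIsAddHaarMeasure μ μ'
  inferInstance

omit [MeasurableSpace V] [BorelSpace V] [FiniteDimensional ℝ V] in
theorem norm_coh_apply_le (w : V × V) (x : V) : ‖coh B g w x‖ ≤ sn 0 g := by
  rw [coh_apply, norm_mul, norm_chi, one_mul]
  exact (SchwartzMap.norm_le_seminorm ℂ g _).trans (seminorm_le_sn le_rfl le_rfl g)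

/-- The integral over frequencies is Fourier inversion for the localised function and leaves
$f(x)g(x-a)^2$. The integral over `a` is then the normalisation of the window, which is bilinear,
without conjugation. -/
theorem IsFourier.reconstruct (hF : IsFourier μ B F) (hg : ∫ x, g x * g x ∂μ = 1) (f : 𝓢(V, ℂ))
    (x : V) : ∫ w, stft g μ B w f * coh B g w x ∂(μ.prod μ) = f x := by
  have := FiniteDimensional.proper ℝ V
  have hint : Integrable (fun w => stft g μ B w f * coh B g w x) (μ.prod μ) := by
    obtain ⟨M, C, hC, h⟩ := hF.stft_decay g (μ.prod μ).integrablePower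
    refine integrable_of_decay _ ((continuous_stft g μ B f).mul ?_) (C := C * sn M f * sn 0 g)
      fun w => ?_
    · simp_rw [coh_apply]
      exact ((contDiff_chi B (m := 0)).continuous.comp (continuous_snd.prodMk continuous_const)).mul
        (g.continuous.comp (continuous_const.sub continuous_fst))
    · rw [norm_mul, ← mul_assoc]
      exact mul_le_mul (h w f) (norm_coh_apply_le w x) (norm_nonneg _) (by positivity)
  rw [integral_prod _ hint]
  have h1 : ∀ a, ∫ b, stft g μ B (a, b) f * coh B g (a, b) x ∂μ = f x * (g (x - a) * g (x - a)) :=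
    fun a => by
      have h2 : ∀ b, stft g μ B (a, b) f * coh B g (a, b) x =
          g (x - a) * (chi B b x * F (localize g a f) b) := fun b => by
        rw [hF.stft_eq, coh_apply]; ring
      simp_rw [h2]
      rw [integral_const_mul, ← hF.inv, localize_apply]
      ring
  simp_rw [h1]
  rw [integral_const_mul, integral_sub_left_eq_self (fun a => g a * g a) μ x, hg, mul_one]

/-- Rapid decay of the coefficients against polynomial growth of the states makes the reconstruction
converge in the Schwartz space, so `u` may be applied to each state. -/
theorem IsFourier.apply_eq_integral (hF : IsFourier μ B F) (hg : ∫ x, g x * g x ∂μ = 1)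
    (u : 𝓢(V, ℂ) →L[ℂ] ℂ) (f : 𝓢(V, ℂ)) :
    u f = ∫ w, stft g μ B w f * u (coh B g w) ∂(μ.prod μ) := by
  have := FiniteDimensional.proper ℝ V
  choose A hA hA' using sn_coh_le B g
  obtain ⟨D, -, hD⟩ := exists_superposition (μ.prod μ) (continuous_coh B g) (fun N => (hA N).le) hA'
  obtain ⟨I, h1, h2, -⟩ := hD (fun w => stft g μ B w f) (continuous_stft g μ B f) fun K => by
    obtain ⟨M, C, -, h⟩ := hF.stft_decay g K
    exact ⟨_, fun w => h w f⟩
  have : I = f := by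
    ext x
    rw [(h1 x).2, hF.reconstruct hg]
  rw [← this, h2, this]

end Reconstruction

/-! ### A kernel theorem through coherent states -/

section Bilinear

variable {V : Type} [NormedAddCommGroup V] [NormedSpace ℝ V]

theorem continuous_bilin_of_bound {b : 𝓢(V, ℂ) →ₗ[ℂ] 𝓢(V, ℂ) →ₗ[ℂ] ℂ} {N : ℕ} {C : ℝ}
    (hb : ∀ f h, ‖b f h‖ ≤ C * sn N f * sn N h) :
    Continuous fun p : 𝓢(V, ℂ) × 𝓢(V, ℂ) => b p.1 p.2 := by
  refine continuous_iff_continuousAt.2 fun p => tendsto_iff_norm_sub_tendsto_zero.2 ?_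
  have h1 : ∀ q : 𝓢(V, ℂ) × 𝓢(V, ℂ), ‖b q.1 q.2 - b p.1 p.2‖ ≤
      C * sn N (q.1 - p.1) * sn N q.2 + C * sn N p.1 * sn N (q.2 - p.2) := fun q => by
    have : b q.1 q.2 - b p.1 p.2 = b (q.1 - p.1) q.2 + b p.1 (q.2 - p.2) := by simp
    rw [this]
    exact (norm_add_le _ _).trans (add_le_add (hb _ _) (hb _ _))
  refine squeeze_zero (fun _ => norm_nonneg _) h1 ?_
  have hc : Continuous fun q : 𝓢(V, ℂ) × 𝓢(V, ℂ) =>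
      C * sn N (q.1 - p.1) * sn N q.2 + C * sn N p.1 * sn N (q.2 - p.2) :=
    ((continuous_const.mul ((continuous_sn N).comp (continuous_fst.sub continuous_const))).mul
      ((continuous_sn N).comp continuous_snd)).add
      (continuous_const.mul ((continuous_sn N).comp (continuous_snd.sub continuous_const)))
  simpa using hc.tendsto p

end Bilinear

section Kernel

variable {V : Type} [NormedAddCommGroup V] [NormedSpace ℝ V]

/-- The form `B(b₁, x₁) + B(b₂, x₂)` on `V × V`. -/
noncomputable def prodForm (B : V →L[ℝ] V →L[ℝ] ℝ) : (V × V) →L[ℝ] (V × V) →L[ℝ] ℝ :=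
  B.bilinearComp (ContinuousLinearMap.fst ℝ V V) (ContinuousLinearMap.fst ℝ V V) +
    B.bilinearComp (ContinuousLinearMap.snd ℝ V V) (ContinuousLinearMap.snd ℝ V V)

theorem prodForm_apply (B : V →L[ℝ] V →L[ℝ] ℝ) (b x : V × V) :
    prodForm B b x = B b.1 x.1 + B b.2 x.2 := rfl

theorem chi_prodForm (B : V →L[ℝ] V →L[ℝ] ℝ) (b x : V × V) :
    chi (prodForm B) b x = chi B b.1 x.1 * chi B b.2 x.2 := by
  rw [chi, chi, chi, ← Complex.exp_add, prodForm_apply]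
  push_cast
  ring_nf

/-- Here `w.1` holds the two positions and `w.2` the two frequencies; the factors regroup one
position with one frequency. This is why values on tensor products determine everything on the
product. -/
theorem coh_prodForm (B : V →L[ℝ] V →L[ℝ] ℝ) (g : 𝓢(V, ℂ)) (w : (V × V) × (V × V)) :
    coh (prodForm B) (tensor g g) w =
      tensor (coh B g (w.1.1, w.2.1)) (coh B g (w.1.2, w.2.2)) := by
  ext x
  simp only [coh_apply, chi_prodForm, tensor_apply, Prod.fst_sub, Prod.snd_sub]
  ring

variable [MeasurableSpace V] [BorelSpace V] [FiniteDimensional ℝ V] {μ : Measure V}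
  [μ.IsAddHaarMeasure] {B : V →L[ℝ] V →L[ℝ] ℝ} {F2 : 𝓢(V × V, ℂ) →L[ℂ] 𝓢(V × V, ℂ)}
  {g : 𝓢(V, ℂ)}

theorem regular_tensor (f h k l : 𝓢(V, ℂ)) :
    regular (μ.prod μ) (tensor f h) (tensor k l) = regular μ f k * regular μ h l := by
  have := FiniteDimensional.proper ℝ V
  rw [regular_apply _ (SchwartzMap.hasTemperateGrowth _),
    regular_apply _ (SchwartzMap.hasTemperateGrowth _),
    regular_apply _ (SchwartzMap.hasTemperateGrowth _), ← integral_prod_mul]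
  simp only [tensor_apply]
  refine integral_congr_ae (Eventually.of_forall fun x => ?_)
  ring

theorem stft_tensor (w : (V × V) × (V × V)) (f h : 𝓢(V, ℂ)) :
    stft (tensor g g) (μ.prod μ) (prodForm B) w (tensor f h) =
      stft g μ B (w.1.1, w.2.1) f * stft g μ B (w.1.2, w.2.2) h := by
  rw [stft, coh_prodForm, regular_tensor]
  rfl

theorem integral_tensor_sq (hg : ∫ x, g x * g x ∂μ = 1) :
    ∫ x, tensor g g x * tensor g g x ∂(μ.prod μ) = 1 := by
  have h := regular_tensor (μ := μ) g g g g
  rw [regular_apply _ (SchwartzMap.hasTemperateGrowth _),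
    regular_apply _ (SchwartzMap.hasTemperateGrowth _), hg, one_mul] at h
  exact h

instance instIsAddHaarMeasureProd : (μ.prod μ).IsAddHaarMeasure :=
  have := FiniteDimensional.proper ℝ V
  Measure.prod.instIsAddHaarMeasure μ μ

/-- A tempered distribution on `V × V` is determined by its values on tensor products. -/
theorem IsFourier.ext_tensor (hF : IsFourier (μ.prod μ) (prodForm B) F2)
    (hg : ∫ x, g x * g x ∂μ = 1) {u v : 𝓢(V × V, ℂ) →L[ℂ] ℂ}
    (h : ∀ f k, u (tensor f k) = v (tensor f k)) : u = v := by
  ext f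
  rw [hF.apply_eq_integral (integral_tensor_sq hg) u, hF.apply_eq_integral (integral_tensor_sq hg) v]
  simp_rw [coh_prodForm, h]

-- Passes from (positions, frequencies) to (first state, second state): a composite of associators
-- and one swap.
omit [BorelSpace V] in
theorem measurePreserving_prodProdProdComm :
    MeasurePreserving (fun w : (V × V) × (V × V) => ((w.1.1, w.2.1), (w.1.2, w.2.2)))
      ((μ.prod μ).prod (μ.prod μ)) ((μ.prod μ).prod (μ.prod μ)) := by
  have := FiniteDimensional.proper ℝ V
  have e1 := measurePreserving_prodAssoc μ μ (μ.prod μ)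
  have e2 := (MeasurePreserving.id μ).prod (measurePreserving_prodAssoc μ μ μ).symm
  have e3 := (MeasurePreserving.id μ).prod
    ((Measure.measurePreserving_swap (μ := μ) (ν := μ)).prod (MeasurePreserving.id μ))
  have e4 := (MeasurePreserving.id μ).prod (measurePreserving_prodAssoc μ μ μ)
  have e5 := (measurePreserving_prodAssoc μ μ (μ.prod μ)).symm
  exact e5.comp (e4.comp (e3.comp (e2.comp e1)))

/-- Continuous extension from tensor products of a family of bilinear forms. -/
theorem IsFourier.exists_kernel_extension {F1 : 𝓢(V, ℂ) →L[ℂ] 𝓢(V, ℂ)} (hF1 : IsFourier μ B F1)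
    (hF : IsFourier (μ.prod μ) (prodForm B) F2) (hg : ∫ x, g x * g x ∂μ = 1)
    {W : Type} [NormedAddCommGroup W] (b : W → 𝓢(V, ℂ) →ₗ[ℂ] 𝓢(V, ℂ) →ₗ[ℂ] ℂ)
    (hcont : ∀ f h, Continuous fun w => b w f h)
    (hb : ∀ K, ∃ N : ℕ, ∃ C : ℝ, 0 < C ∧
      ∀ w f h, (1 + ‖w‖) ^ K * ‖b w f h‖ ≤ C * sn N f * sn N h) :
    ∃ c : W → 𝓢(V × V, ℂ) →L[ℂ] ℂ, (∀ w f, c w f =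
        ∫ z : (V × V) × (V × V), stft (tensor g g) (μ.prod μ) (prodForm B) z f *
          b w (coh B g (z.1.1, z.2.1)) (coh B g (z.1.2, z.2.2)) ∂((μ.prod μ).prod (μ.prod μ))) ∧
      (∀ w f h, c w (tensor f h) = b w f h) ∧
      (∀ f, Continuous fun w => c w f) ∧
      ∀ K, ∃ M : ℕ, ∃ C : ℝ, 0 < C ∧ ∀ w f, (1 + ‖w‖) ^ K * ‖c w f‖ ≤ C * sn M f := by
  have := FiniteDimensional.proper ℝ V
  let ν : Measure ((V × V) × (V × V)) := (μ.prod μ).prod (μ.prod μ)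
  -- The extension is forced: expand a function on `V × V` in tensor coherent states and evaluate `b
  -- w` on each of them.
  let β : W → (V × V) × (V × V) → ℂ := fun w z =>
    b w (coh B g (z.1.1, z.2.1)) (coh B g (z.1.2, z.2.2))
  let s : (V × V) × (V × V) → 𝓢(V × V, ℂ) →L[ℂ] ℂ := stft (tensor g g) (μ.prod μ) (prodForm B)
  obtain ⟨D, hD, hD'⟩ := exists_integral_le_of_decay ν
  have hpoint : ∀ K, ∃ M : ℕ, ∃ C : ℝ, 0 < C ∧ ∀ w z f, (1 + ‖w‖) ^ K *
      ((1 + ‖z‖) ^ ν.integrablePower * ‖s z f * β w z‖) ≤ C * sn M f := fun K => by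
    obtain ⟨N, C, hC, h⟩ := hb K
    obtain ⟨A, hA, hA'⟩ := sn_coh_le B g N
    -- Each of the two states contributes growth of order `2 * N` to `β w z`, whence the surplus `2
    -- * N + 2 * N`.
    obtain ⟨M, C', hC', h'⟩ := hF.stft_decay (tensor g g) (ν.integrablePower + (2 * N + 2 * N))
    refine ⟨M, C * A * A * C', by positivity, fun w z f => ?_⟩
    have h1 : ‖((z.1.1, z.2.1) : V × V)‖ ≤ ‖z‖ :=
      max_le ((norm_fst_le z.1).trans (norm_fst_le z)) ((norm_fst_le z.2).trans (norm_snd_le z))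
    have h2 : ‖((z.1.2, z.2.2) : V × V)‖ ≤ ‖z‖ :=
      max_le ((norm_snd_le z.1).trans (norm_fst_le z)) ((norm_snd_le z.2).trans (norm_snd_le z))
    have h3 : (1 + ‖w‖) ^ K * ‖β w z‖ ≤ C * (A * (1 + ‖z‖) ^ (2 * N)) * (A * (1 + ‖z‖) ^ (2 * N)) := by
      refine (h w _ _).trans ?_
      gcongr
      · exact (hA' _).trans (by gcongr)
      · exact (hA' _).trans (by gcongr)
    calc _ = (1 + ‖z‖) ^ ν.integrablePower * ‖s z f‖ * ((1 + ‖w‖) ^ K * ‖β w z‖) := by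
          rw [norm_mul]; ring
      _ ≤ (1 + ‖z‖) ^ ν.integrablePower * ‖s z f‖ *
          (C * (A * (1 + ‖z‖) ^ (2 * N)) * (A * (1 + ‖z‖) ^ (2 * N))) := by gcongr
      _ = C * A * A * ((1 + ‖z‖) ^ (ν.integrablePower + (2 * N + 2 * N)) * ‖s z f‖) := by
          rw [pow_add, pow_add]; ring
      _ ≤ C * A * A * (C' * sn M f) := mul_le_mul_of_nonneg_left (h' z f) (by positivity)
      _ = _ := by ring
  have hβc : ∀ w, Continuous (β w) := fun w => by
    obtain ⟨N, C, hC, h⟩ := hb 0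
    have hbw : ∀ f k, ‖b w f k‖ ≤ C * sn N f * sn N k := fun f k => by simpa using h w f k
    exact (continuous_bilin_of_bound hbw).comp
      (((continuous_coh B g).comp (by fun_prop)).prodMk ((continuous_coh B g).comp (by fun_prop)))
  have hint : ∀ w f, Integrable (fun z => s z f * β w z) ν := fun w f => by
    obtain ⟨M, C, hC, h⟩ := hpoint 0
    exact integrable_of_decay ν ((continuous_stft _ _ _ f).mul (hβc w)) (C := C * sn M f)
      fun z => by simpa using h w z f
  have hbound : ∀ K, ∃ M : ℕ, ∃ C : ℝ, 0 < C ∧ ∀ w f,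
      (1 + ‖w‖) ^ K * ‖∫ z, s z f * β w z ∂ν‖ ≤ C * sn M f := fun K => by
    obtain ⟨M, C, hC, h⟩ := hpoint K
    refine ⟨M, C * D, by positivity, fun w f => ?_⟩
    refine (mul_le_mul_of_nonneg_left (norm_integral_le_integral_norm _) (by positivity)).trans ?_
    rw [← integral_const_mul]
    refine (hD' _ (C * sn M f) (by positivity) (fun z => by positivity) fun z => ?_).trans
      (le_of_eq (by ring))
    refine le_trans (le_of_eq ?_) (h w z f)
    ring
  let c : W → 𝓢(V × V, ℂ) →ₗ[ℂ] ℂ := fun w =>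
    { toFun := fun f => ∫ z, s z f * β w z ∂ν
      map_add' := fun f f' => by
        rw [← integral_add (hint w f) (hint w f')]
        simp [add_mul]
      map_smul' := fun a f => by
        rw [RingHom.id_apply, smul_eq_mul, ← integral_const_mul]
        simp [mul_assoc] }
  have hc : ∀ w, Continuous (c w) := fun w => by
    obtain ⟨M, C, hC, h⟩ := hbound 0
    exact continuous_of_norm_le_sn (c w) hC.le fun f => by
      have := h w f
      rwa [pow_zero, one_mul] at this
  refine ⟨fun w => ⟨c w, hc w⟩, fun w f => rfl, fun w f h => ?_, fun f => ?_, hbound⟩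
  · change ∫ z, s z (tensor f h) * β w z ∂ν = b w f h
    obtain ⟨N, C, hC, hN⟩ := hb 0
    have hbw : ∀ f k, ‖b w f k‖ ≤ C * sn N f * sn N k := fun f k => by simpa using hN w f k
    have hbc := continuous_bilin_of_bound hbw
    let G : (V × V) × (V × V) → ℂ := fun p =>
      (stft g μ B p.1 f * stft g μ B p.2 h) * b w (coh B g p.1) (coh B g p.2)
    have hGc : Continuous G := (((continuous_stft g μ B f).comp continuous_fst).mul
      ((continuous_stft g μ B h).comp continuous_snd)).mul
      (hbc.comp (((continuous_coh B g).comp continuous_fst).prodMk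
        ((continuous_coh B g).comp continuous_snd)))
    have hG : ∀ z, s z (tensor f h) * β w z = G ((z.1.1, z.2.1), (z.1.2, z.2.2)) := fun z => by
      simp only [s, stft_tensor, β, G]
    have hmp := measurePreserving_prodProdProdComm (μ := μ)
    have hi := hint w (tensor f h)
    simp_rw [hG] at hi ⊢
    have hGi : Integrable G ν :=
      (hmp.integrable_comp hGc.aestronglyMeasurable).1 hi
    have e1 : ∫ z : (V × V) × (V × V), G ((z.1.1, z.2.1), (z.1.2, z.2.2)) ∂ν = ∫ p, G p ∂ν := by
      have := integral_map (μ := ν) hmp.measurable.aemeasurable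
        (f := G) hGc.aestronglyMeasurable
      rw [hmp.map_eq] at this
      exact this.symm
    -- After regrouping, the inner integral reconstructs `h` and the outer one reconstructs `f`.
    rw [e1, integral_prod _ hGi]
    let bl : 𝓢(V, ℂ) →L[ℂ] ℂ := ⟨(b w).flip h,
      hbc.comp (continuous_id.prodMk continuous_const)⟩
    have e2 : ∀ p, ∫ q, G (p, q) ∂(μ.prod μ) = stft g μ B p f * b w (coh B g p) h := fun p => by
      let br : 𝓢(V, ℂ) →L[ℂ] ℂ := ⟨b w (coh B g p), hbc.comp (continuous_const.prodMk continuous_id)⟩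
      have := hF1.apply_eq_integral hg br h
      change b w (coh B g p) h = _ at this
      rw [this, ← integral_const_mul]
      refine integral_congr_ae (Eventually.of_forall fun q => ?_)
      simp only [G, mul_assoc]
      rfl
    simp_rw [e2]
    exact (hF1.apply_eq_integral hg bl f).symm
  · obtain ⟨M, C, hC, h⟩ := hpoint 0
    have hlim : Continuous fun w => ∫ z, s z f * β w z ∂ν := by
      refine continuous_of_dominated (F := fun w z => s z f * β w z)
        (bound := fun z => C * sn M f * (1 + ‖z‖) ^ (-(ν.integrablePower : ℝ)))
        (fun w => (hint w f).aestronglyMeasurable) (fun w => Eventually.of_forall fun z => ?_)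
        ((Measure.integrable_pow_neg_integrablePower ν).const_mul _)
        (Eventually.of_forall fun z => continuous_const.mul (hcont _ _))
      have h1 : 0 < (1 + ‖z‖) ^ ν.integrablePower := by positivity
      rw [Real.rpow_neg (by positivity), Real.rpow_natCast, ← div_eq_mul_inv, le_div_iff₀ h1,
        mul_comm]
      simpa using h w z f
    exact hlim

/-- The kernel extension of a family indexed by one point, where the weight in the parameter is
trivial. -/
theorem IsFourier.bilin_eq_integral {F1 : 𝓢(V, ℂ) →L[ℂ] 𝓢(V, ℂ)} (hF1 : IsFourier μ B F1)
    (hF : IsFourier (μ.prod μ) (prodForm B) F2) (hg : ∫ x, g x * g x ∂μ = 1)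
    {b : 𝓢(V, ℂ) →ₗ[ℂ] 𝓢(V, ℂ) →ₗ[ℂ] ℂ} {N : ℕ} {C : ℝ} (hC : 0 < C)
    (hb : ∀ f h, ‖b f h‖ ≤ C * sn N f * sn N h) (f h : 𝓢(V, ℂ)) :
    b f h = ∫ z : (V × V) × (V × V), stft (tensor g g) (μ.prod μ) (prodForm B) z (tensor f h) *
      b (coh B g (z.1.1, z.2.1)) (coh B g (z.1.2, z.2.2)) ∂((μ.prod μ).prod (μ.prod μ)) := by
  obtain ⟨c, h1, h2, -⟩ := hF1.exists_kernel_extension hF hg (fun _ : PUnit => b)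
    (fun _ _ => continuous_const) fun K => ⟨N, C, hC, fun w f h => by
      rw [Subsingleton.elim w 0, norm_zero, add_zero, one_pow, one_mul]
      exact hb f h⟩
  rw [← h1 PUnit.unit, h2]

end Kernel

/-! ### Existence of a normalised window -/

section Window

theorem exists_window {V : Type} [NormedAddCommGroup V] [NormedSpace ℝ V] [MeasurableSpace V]
    [BorelSpace V] [FiniteDimensional ℝ V] (μ : Measure V) [μ.IsAddHaarMeasure] :
    ∃ g : 𝓢(V, ℂ), ∫ x, g x * g x ∂μ = 1 := by
  obtain ⟨f, hf1, hf2, hf3⟩ : ∃ f : V → ℝ, HasCompactSupport f ∧ ContDiff ℝ (⊤ : ℕ∞) f ∧ f 0 = 1 := by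
    let b : ContDiffBump (0 : V) := ⟨1, 2, one_pos, one_lt_two⟩
    exact ⟨b, b.hasCompactSupport, b.contDiff, b.one_of_mem_closedBall (by simp [b])⟩
  have hcont : Continuous f := hf2.continuous
  have hpos : 0 < ∫ x, f x * f x ∂μ := by
    refine (hcont.mul hcont).integral_pos_of_hasCompactSupport_nonneg_nonzero (x := 0)
      (hf1.mul_left) (fun x => mul_self_nonneg _) (by simp [hf3])
  let h : 𝓢(V, ℂ) := HasCompactSupport.toSchwartzMap (f := fun x => (f x : ℂ))
    (hf1.comp_left Complex.ofReal_zero) (Complex.ofRealCLM.contDiff.comp hf2)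
  set c := ∫ x, f x * f x ∂μ
  refine ⟨((Real.sqrt c)⁻¹ : ℂ) • h, ?_⟩
  have h1 : ∀ x, (((Real.sqrt c)⁻¹ : ℂ) • h) x * (((Real.sqrt c)⁻¹ : ℂ) • h) x =
      ((c⁻¹ * (f x * f x) : ℝ) : ℂ) := fun x => by
    change (((Real.sqrt c)⁻¹ : ℂ) * (f x : ℂ)) * (((Real.sqrt c)⁻¹ : ℂ) * (f x : ℂ)) = _
    have : ((Real.sqrt c : ℂ)) * (Real.sqrt c : ℂ) = (c : ℂ) := by
      rw [← Complex.ofReal_mul, Real.mul_self_sqrt hpos.le]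
    rw [Complex.ofReal_mul, Complex.ofReal_inv, ← this, Complex.ofReal_mul, mul_inv]
    ring
  simp_rw [h1]
  rw [integral_complex_ofReal, integral_const_mul, inv_mul_cancel₀ hpos.ne', Complex.ofReal_one]

end Window

/-! ### Fourier inversion for a bilinear form -/

section FourierModel

/-- Two identifications of `V` with a Euclidean space in which `B` becomes the inner product. -/
structure FourierModel (V : Type) [NormedAddCommGroup V] [NormedSpace ℝ V] [MeasureSpace V]
    (B : V →L[ℝ] V →L[ℝ] ℝ) (E : Type) [NormedAddCommGroup E] [InnerProductSpace ℝ E]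
    [FiniteDimensional ℝ E] [MeasurableSpace E] [BorelSpace E] (m : ℕ) where
  s : V ≃L[ℝ] E
  t : V ≃L[ℝ] E
  measurePreserving_s : MeasurePreserving s
  measurePreserving_t : MeasurePreserving t
  form_eq : ∀ y x, B y x = inner ℝ (s x) (t y)
  finrank_eq : Module.finrank ℝ E = 2 * m

variable {V : Type} [NormedAddCommGroup V] [NormedSpace ℝ V] [MeasureSpace V]
    {B : V →L[ℝ] V →L[ℝ] ℝ} {E : Type} [NormedAddCommGroup E] [InnerProductSpace ℝ E]
    [FiniteDimensional ℝ E] [MeasurableSpace E] [BorelSpace E] {m : ℕ}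

/-- The dilated identification, which turns the phase `2π ⟪·, ·⟫` into `B`. -/
noncomputable def FourierModel.r (M : FourierModel V B E m) : V ≃L[ℝ] E :=
  M.t.trans (ContinuousLinearEquiv.smulLeft (Units.mk0 ((2 * Real.pi)⁻¹ : ℝ) (by positivity)))

theorem FourierModel.r_apply (M : FourierModel V B E m) (y : V) :
    M.r y = (2 * Real.pi)⁻¹ • M.t y := rfl

/-- The Fourier transform on `𝓢(V)` attached to `B`. -/
noncomputable def FourierModel.fourier (M : FourierModel V B E m) : 𝓢(V, ℂ) →L[ℂ] 𝓢(V, ℂ) :=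
  (((((2 * Real.pi) ^ m)⁻¹ : ℝ) : ℂ) • SchwartzMap.compCLMOfContinuousLinearEquiv ℂ M.r) ∘L
    SchwartzMap.fourierTransformCLM ℂ ∘L SchwartzMap.compCLMOfContinuousLinearEquiv ℂ M.s.symm

theorem FourierModel.fourier_apply (M : FourierModel V B E m) (f : 𝓢(V, ℂ)) (y : V) :
    M.fourier f y = ((((2 * Real.pi) ^ m)⁻¹ : ℝ) : ℂ) *
      FourierTransform.fourier (SchwartzMap.compCLMOfContinuousLinearEquiv ℂ M.s.symm f) (M.r y) :=
  rfl

theorem FourierModel.isFourier [BorelSpace V] [SecondCountableTopology V]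
    (M : FourierModel V B E m) :
    IsFourier (ENNReal.ofReal (((2 * Real.pi) ^ m)⁻¹) • (volume : Measure V)) B M.fourier := by
  have hpi : (0 : ℝ) ≤ ((2 * Real.pi) ^ m)⁻¹ := by positivity
  refine ⟨fun f y => ?_, fun f x => ?_⟩
  · rw [integral_smul_measure, ENNReal.toReal_ofReal hpi, M.fourier_apply, Complex.real_smul]
    congr 1
    rw [SchwartzMap.fourier_coe, Real.fourier_eq',
      ← M.measurePreserving_s.integral_comp M.s.toHomeomorph.measurableEmbedding]
    refine integral_congr_ae (Eventually.of_forall fun x => ?_)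
    simp only [SchwartzMap.compCLMOfContinuousLinearEquiv_apply, Function.comp_apply,
      ContinuousLinearEquiv.symm_apply_apply, smul_eq_mul, chi_neg, M.form_eq, M.r_apply,
      inner_smul_right]
    congr 2
    have : (Real.pi : ℂ) ≠ 0 := by exact_mod_cast Real.pi_ne_zero
    push_cast
    field_simp
  · rw [integral_smul_measure, ENNReal.toReal_ofReal hpi]
    set φ : 𝓢(E, ℂ) := SchwartzMap.compCLMOfContinuousLinearEquiv ℂ M.s.symm f with hφ
    have h1 : f x = FourierTransformInv.fourierInv (FourierTransform.fourier φ) (M.s x) := by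
      rw [FourierTransform.fourierInv_fourier_eq, hφ]
      simp
    let h : E → ℂ := fun v => Complex.exp (((2 * Real.pi * inner ℝ v (M.s x) : ℝ) : ℂ) * Complex.I) *
      FourierTransform.fourier φ v
    have h2 : f x = ∫ v, h v := by
      rw [h1, SchwartzMap.fourierInv_coe, Real.fourierInv_eq']
      rfl
    have h3 := Measure.integral_comp_smul (volume : Measure E) h (2 * Real.pi)⁻¹
    rw [M.finrank_eq, ← M.measurePreserving_t.integral_comp
      M.t.toHomeomorph.measurableEmbedding] at h3
    -- The dilation has Jacobian $(2\pi)^{2m}$. One factor $(2\pi)^m$ goes to the measure, the other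
    -- to the normalisation of the transform.
    have h4 : ∫ v, h v = ((2 * Real.pi) ^ (2 * m))⁻¹ •
        ∫ y, h ((2 * Real.pi)⁻¹ • M.t y) := by
      rw [h3, inv_pow, inv_inv, abs_of_pos (by positivity), smul_smul,
        inv_mul_cancel₀ (by positivity), one_smul]
    rw [h2, h4, Complex.real_smul, Complex.real_smul, two_mul m, pow_add, mul_inv]
    push_cast
    rw [mul_assoc]
    congr 1
    rw [← integral_const_mul]
    refine integral_congr_ae (Eventually.of_forall fun y => ?_)
    simp only [h, M.fourier_apply, chi, M.form_eq, M.r_apply, ← hφ, inner_smul_left]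
    push_cast
    have h5 : Complex.exp (2 * (Real.pi : ℂ) * ((starRingEnd ℝ) (2 * Real.pi)⁻¹ *
        inner ℝ (M.t y) (M.s x) : ℝ) * Complex.I) =
        Complex.exp (Complex.I * (inner ℝ (M.s x) (M.t y) : ℝ)) := by
      congr 1
      rw [real_inner_comm]
      have : (Real.pi : ℂ) ≠ 0 := by exact_mod_cast Real.pi_ne_zero
      simp only [conj_trivial]
      push_cast
      field_simp
    push_cast at h5
    rw [h5]
    ring

/-- The product of two copies of a model. -/
noncomputable def FourierModel.prod [SFinite (volume : Measure V)]
    (M : FourierModel V B E m) :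
    FourierModel (V × V) (prodForm B) (WithLp 2 (E × E)) (2 * m) where
  s := (M.s.prodCongr M.s).trans (WithLp.prodContinuousLinearEquiv 2 ℝ E E).symm
  t := (M.t.prodCongr M.t).trans (WithLp.prodContinuousLinearEquiv 2 ℝ E E).symm
  measurePreserving_s := (WithLp.volume_preserving_toLp E E).comp
    (M.measurePreserving_s.prod M.measurePreserving_s)
  measurePreserving_t := (WithLp.volume_preserving_toLp E E).comp
    (M.measurePreserving_t.prod M.measurePreserving_t)
  form_eq y x := by
    rw [prodForm_apply, M.form_eq, M.form_eq]
    rfl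
  finrank_eq := by
    rw [(WithLp.linearEquiv 2 ℝ (E × E)).finrank_eq, Module.finrank_prod, M.finrank_eq]
    ring

end FourierModel

/-! ### The symplectic Fourier transform on phase space and its square -/

section Phase

/-- The symplectic form as a continuous bilinear map. -/
noncomputable def sigmaL (n : ℕ) : Phase n →L[ℝ] Phase n →L[ℝ] ℝ :=
  (innerSL ℝ).bilinearComp (ContinuousLinearMap.snd ℝ _ _) (ContinuousLinearMap.fst ℝ _ _) -
    (innerSL ℝ).bilinearComp (ContinuousLinearMap.fst ℝ _ _) (ContinuousLinearMap.snd ℝ _ _)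

theorem sigmaL_apply {n : ℕ} (X Y : Phase n) : sigmaL n X Y = sigma X Y := by
  simp [sigmaL, sigma, real_inner_comm]

theorem chi_sigmaL {n : ℕ} (X : Phase n) : chi (sigmaL n) X = expFun X := by
  funext Y
  rw [chi, expFun, sigmaL_apply]

/-- The Euclidean model of the symplectic Fourier transform. -/
noncomputable def phaseModel (n : ℕ) : FourierModel (Phase n) (sigmaL n) (EPhase n) n where
  s := (WithLp.prodContinuousLinearEquiv 2 ℝ _ _).symm
  t := ((ContinuousLinearEquiv.prodComm ℝ _ _).trans
    ((ContinuousLinearEquiv.refl ℝ _).prodCongr (ContinuousLinearEquiv.neg ℝ))).trans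
    (WithLp.prodContinuousLinearEquiv 2 ℝ _ _).symm
  measurePreserving_s := WithLp.volume_preserving_toLp _ _
  measurePreserving_t := (WithLp.volume_preserving_toLp _ _).comp
    (((MeasurePreserving.id _).prod (Measure.measurePreserving_neg _)).comp
      Measure.measurePreserving_swap)
  form_eq Y X := by
    rw [sigmaL_apply, sigma]
    change _ = inner ℝ (WithLp.toLp 2 X) (WithLp.toLp 2 (Y.2, -Y.1))
    rw [WithLp.prod_inner_apply]
    simp [real_inner_comm, sub_eq_add_neg]
  finrank_eq := by
    rw [(WithLp.linearEquiv 2 ℝ (Phase n)).finrank_eq, Module.finrank_prod,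
      finrank_euclideanSpace_fin]
    ring

theorem isFourier_phase (n : ℕ) : IsFourier (haar n) (sigmaL n) (phaseModel n).fourier :=
  (phaseModel n).isFourier

theorem haar_prod_haar (n : ℕ) : (haar n).prod (haar n) =
    ENNReal.ofReal (((2 * Real.pi) ^ (2 * n))⁻¹) • (volume : Measure (Phase n × Phase n)) := by
  rw [haar, Measure.prod_smul_left, Measure.prod_smul_right, smul_smul,
    ← ENNReal.ofReal_mul (by positivity), two_mul n, pow_add, mul_inv]
  rfl

theorem isFourier_phase_prod (n : ℕ) : IsFourier ((haar n).prod (haar n)) (prodForm (sigmaL n))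
    (phaseModel n).prod.fourier := by
  rw [haar_prod_haar]
  exact (phaseModel n).prod.isFourier

theorem fourier_phase_eq {n : ℕ} (f : Sch n) : (phaseModel n).fourier f = symplecticFourier f := by
  ext Y
  rw [(isFourier_phase n).apply, symplecticFourier_apply]
  simp_rw [chi_neg, sigmaL_apply]

end Phase

/-! ### Weakly bounded families are bounded -/

section Bounded

/-- Banach–Steinhaus on the dual of `B`, through the isometric embedding into the bidual. -/
theorem exists_norm_bound_of_weak {B ι : Type} [NormedAddCommGroup B] [NormedSpace ℂ B] (x : ι → B)
    (h : ∀ u : B →L[ℂ] ℂ, ∃ C, ∀ i, ‖u (x i)‖ ≤ C) : ∃ C, ∀ i, ‖x i‖ ≤ C := by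
  obtain ⟨C, hC⟩ := banach_steinhaus (g := fun i => NormedSpace.inclusionInDoubleDual ℂ B (x i)) h
  refine ⟨C, fun i => ?_⟩
  exact ((NormedSpace.inclusionInDoubleDualLi ℂ (E := B)).norm_map (x i)).symm.le.trans (hC i)

variable {V : Type} [NormedAddCommGroup V] [NormedSpace ℝ V]

theorem exists_norm_bound_of_weak_map {B ι : Type} [NormedAddCommGroup B] [NormedSpace ℂ B]
    (J : 𝓢(V, ℂ) →L[ℂ] B) (ψ : ι → 𝓢(V, ℂ))
    (h : ∀ u : 𝓢(V, ℂ) →L[ℂ] ℂ, ∃ C, ∀ i, ‖u (ψ i)‖ ≤ C) : ∃ C, ∀ i, ‖J (ψ i)‖ ≤ C :=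
  exists_norm_bound_of_weak (fun i => J (ψ i)) fun u => h (u ∘L J)

/-- A weakly bounded family of Schwartz functions is bounded. -/
theorem exists_sn_bound_of_weak {ι : Type} (ψ : ι → 𝓢(V, ℂ))
    (h : ∀ u : 𝓢(V, ℂ) →L[ℂ] ℂ, ∃ C, ∀ i, ‖u (ψ i)‖ ≤ C) (N : ℕ) :
    ∃ C, ∀ i, sn N (ψ i) ≤ C := by
  have h1 : ∀ k m, ∃ C, ∀ i, SchwartzMap.seminorm ℂ k m (ψ i) ≤ C := fun k m => by
    obtain ⟨C, hC⟩ := exists_norm_bound_of_weak_map (B := BoundedContinuousFunction V (V [×m]→L[ℝ] ℂ)) (jetCLM V k m) ψ h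
    exact ⟨C, fun i => (seminorm_le_norm_jetCLM k m _).trans (hC i)⟩
  choose C hC using h1
  refine ⟨∑ p ∈ Finset.Iic (N, N), |C p.1 p.2|, fun i => sn_le (by positivity) fun k m hk hm => ?_⟩
  exact ((hC k m i).trans (le_abs_self _)).trans (Finset.single_le_sum
    (f := fun p : ℕ × ℕ => |C p.1 p.2|) (fun _ _ => abs_nonneg _)
    (Finset.mem_Iic.2 (Prod.mk_le_mk.2 ⟨hk, hm⟩) : (k, m) ∈ Finset.Iic (N, N)))

end Bounded

/-! ### From quadrilinear forms to operators -/

section Operator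

variable {V : Type} [NormedAddCommGroup V] [NormedSpace ℝ V] [MeasurableSpace V] [BorelSpace V]
  [FiniteDimensional ℝ V] {μ : Measure V} [μ.IsAddHaarMeasure] {B : V →L[ℝ] V →L[ℝ] ℝ}
  {g : 𝓢(V, ℂ)}

/-- A quadrilinear form whose values on coherent states decay rapidly is given by an operator. -/
theorem IsFourier.exists_operator {F1 : 𝓢(V, ℂ) →L[ℂ] 𝓢(V, ℂ)}
    {F2 : 𝓢(V × V, ℂ) →L[ℂ] 𝓢(V × V, ℂ)} (hF1 : IsFourier μ B F1)
    (hF2 : IsFourier (μ.prod μ) (prodForm B) F2) (hg : ∫ x, g x * g x ∂μ = 1)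
    (q q' : 𝓢(V, ℂ) → 𝓢(V, ℂ) → 𝓢(V, ℂ) →ₗ[ℂ] 𝓢(V, ℂ) →ₗ[ℂ] ℂ)
    (hq' : ∀ f₁ f₂ g₁ g₂, q' f₁ f₂ g₁ g₂ = q g₁ g₂ f₁ f₂)
    (hcont : ∀ f₁ f₂, Continuous fun p : 𝓢(V, ℂ) × 𝓢(V, ℂ) => q p.1 p.2 f₁ f₂)
    (hdec : ∀ m, ∃ N : ℕ, ∃ C : ℝ, 0 < C ∧ ∀ (w : (V × V) × (V × V)) (f₁ f₂ : 𝓢(V, ℂ)),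
      (1 + ‖w‖) ^ m * ‖q (coh B g (w.1.1, w.2.1)) (coh B g (w.1.2, w.2.2)) f₁ f₂‖ ≤
        C * sn N f₁ * sn N f₂) :
    ∃ R : 𝓢(V × V, ℂ) →L[ℂ] 𝓢(V × V, ℂ), ∀ f₁ f₂ g₁ g₂,
      regular (μ.prod μ) (R (tensor f₁ f₂)) (tensor g₁ g₂) = q g₁ g₂ f₁ f₂ := by
  have := FiniteDimensional.proper ℝ V
  have hcoh : Continuous (coh B g) := continuous_coh _ g
  have h₁ : Continuous fun w : (V × V) × (V × V) => (w.1.1, w.2.1) := by fun_prop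
  have h₂ : Continuous fun w : (V × V) × (V × V) => (w.1.2, w.2.2) := by fun_prop
  -- For each pair of coherent states in the slots `g₁, g₂`, the form in `f₁, f₂` becomes a
  -- functional on the product space, still rapidly decreasing in `w`.
  obtain ⟨c, -, hc2, hc3, hc4⟩ := hF1.exists_kernel_extension hF2 hg
    (fun w : (V × V) × (V × V) => q (coh B g (w.1.1, w.2.1)) (coh B g (w.1.2, w.2.2)))
    (fun f₁ f₂ => (hcont f₁ f₂).comp ((hcoh.comp h₁).prodMk (hcoh.comp h₂))) hdec
  choose A hA0 hA' using sn_coh_le (prodForm B) (tensor g g)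
  obtain ⟨R, hR⟩ := exists_superposition_clm ((μ.prod μ).prod (μ.prod μ))
    -- The reversed frequency makes the pairing of the state with a function equal to the
    -- coefficient `stft` at `w`.
    (Ψ := fun w => coh (prodForm B) (tensor g g) (w.1, -w.2))
    ((continuous_coh _ _).comp (continuous_fst.prodMk continuous_snd.neg))
    (A := A) (L := fun N => 2 * N) (fun N => (hA0 N).le)
    (fun N w => by
      have := hA' N (w.1, -w.2)
      rwa [show ‖(w.1, -w.2)‖ = ‖w‖ by simp [Prod.norm_def]] at this) c hc3 hc4
  refine ⟨R, fun f₁ f₂ g₁ g₂ => ?_⟩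
  -- With `f₁, f₂` fixed, the form in `g₁, g₂` is expanded in coherent states. The expansion needs a
  -- joint bound, which separate continuity supplies.
  obtain ⟨N, C, hC, hb⟩ := exists_uniform_sn_bound_bilin (fun _ : Unit => q' f₁ f₂)
    (fun _ g₂ => by
      simp only [hq']
      exact (hcont f₁ f₂).comp (continuous_id.prodMk continuous_const))
    (fun _ g₁ => by
      simp only [hq']
      exact (hcont f₁ f₂).comp (continuous_const.prodMk continuous_id))
    fun f g => ⟨_, fun _ => le_rfl⟩
  rw [regular_symm, hR, ← hq', hF1.bilin_eq_integral hF2 hg hC (hb ()) g₁ g₂]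
  refine integral_congr_ae (Eventually.of_forall fun w => ?_)
  have e : regular (μ.prod μ) (tensor g₁ g₂) (coh (prodForm B) (tensor g g) (w.1, -w.2)) =
      stft (tensor g g) (μ.prod μ) (prodForm B) w (tensor g₁ g₂) := by
    rw [regular_symm, stft]
  simp only [hc2, e, hq']
  rw [mul_comm]

end Operator

/-! ### Decay of the quadrilinear form and construction of R -/

section Algebra

variable {n : ℕ}

theorem pairing_comm (f g : Sch n) : pairing f g = pairing g f := by
  simp only [pairing, mul_comm]

/-- The pairing as a bilinear form. -/
noncomputable def pairingL (n : ℕ) : Sch n →ₗ[ℂ] Sch n →ₗ[ℂ] ℂ :=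
  LinearMap.mk₂ ℂ pairing
    (fun f f' g => by
      simp only [pairing_comm _ g, ← toDist_apply, map_add])
    (fun a f g => by
      simp only [pairing_comm _ g, ← toDist_apply, map_smul])
    (fun f g g' => by simp only [← toDist_apply, map_add])
    (fun a f g => by simp only [← toDist_apply, map_smul])

theorem continuous_pairing_right (f : Sch n) : Continuous fun g => pairing f g :=
  (toDist f).continuous.congr fun g => toDist_apply f g

theorem exists_pairing_bound (n : ℕ) : ∃ N : ℕ, ∃ C : ℝ, 0 < C ∧ ∀ f g : Sch n,
    ‖pairingL n f g‖ ≤ C * sn N f * sn N g := by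
  obtain ⟨N, C, hC, h⟩ := exists_uniform_sn_bound_bilin (fun _ : Unit => pairingL n)
    (fun _ g => (continuous_pairing_right g).congr fun f => pairing_comm g f)
    (fun _ f => continuous_pairing_right f) fun f g => ⟨_, fun _ => le_rfl⟩
  exact ⟨N, C, hC, h ()⟩

theorem continuous_pairing : Continuous fun p : Sch n × Sch n => pairing p.1 p.2 := by
  obtain ⟨N, C, -, h⟩ := exists_pairing_bound n
  exact continuous_bilin_of_bound h

variable {P : Sch n →ₗ[ℂ] Sch n →ₗ[ℂ] Sch n}

/-- Both sides are the trace $\int f\#g\#h$: the identity $\int f\#g=\int fg$ converts pairings into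
traces, where associativity applies. -/
theorem HypothesisA.pairing_mul_left (hA : HypothesisA P) (f g h : Sch n) :
    pairing (P f g) h = pairing f (P g h) := by
  rw [pairing, pairing, ← hA.integral_mul, ← hA.integral_mul, hA.assoc]

theorem HypothesisA.pairing_cyclic (hA : HypothesisA P) (f g h : Sch n) :
    pairing (P f g) h = pairing (P g h) f := by
  rw [hA.pairing_mul_left, pairing_comm]

theorem HypothesisB.pairing_sandwich {hA : HypothesisA P} (hB : HypothesisB hA) (f g h : Sch n)
    (u : Dist n) : pairing (hB.sandwich f u g) h = u (P (P g h) f) := by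
  rw [← toDist_apply, hB.toDist_sandwich, hA.distMul_apply, hA.mulDist_apply]

variable (g : Sch n)

theorem pairing_coh (p : Phase n × Phase n) (f : Sch n) :
    pairing (coh (sigmaL n) g p) f = stft g (haar n) (sigmaL n) (p.1, -p.2) f := by
  rw [← toDist_apply, stft, neg_neg]
  rfl

theorem pairing_coh_decay (N : ℕ) : ∃ M : ℕ, ∃ C : ℝ, 0 < C ∧ ∀ (p : Phase n × Phase n) (f : Sch n),
    (1 + ‖p‖) ^ N * ‖pairing (coh (sigmaL n) g p) f‖ ≤ C * sn M f := by
  obtain ⟨M, C, hC, h⟩ := (isFourier_phase n).stft_decay g N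
  refine ⟨M, C, hC, fun p f => ?_⟩
  rw [pairing_coh]
  have := h (p.1, -p.2) f
  rwa [show ‖(p.1, -p.2)‖ = ‖p‖ by simp [Prod.norm_def]] at this

/-- The form `(f₁, f₂) ↦ ⟨g₁ # f₁, g₂ # f₂⟩`. -/
noncomputable def quadForm (P : Sch n →ₗ[ℂ] Sch n →ₗ[ℂ] Sch n) (g₁ g₂ : Sch n) :
    Sch n →ₗ[ℂ] Sch n →ₗ[ℂ] ℂ :=
  (pairingL n).compl₁₂ (P g₁) (P g₂)

theorem quadForm_apply (g₁ g₂ f₁ f₂ : Sch n) :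
    quadForm P g₁ g₂ f₁ f₂ = pairing (P g₁ f₁) (P g₂ f₂) := rfl

/-- Moving `f₁` across the pairing places `g₂` between two Schwartz functions, the position in which
(B) can be used by duality. -/
theorem HypothesisA.quadForm_eq (hA : HypothesisA P) (g₁ g₂ f₁ f₂ : Sch n) :
    quadForm P g₁ g₂ f₁ f₂ = pairing g₁ (P (P f₁ g₂) f₂) := by
  rw [quadForm_apply, hA.pairing_mul_left, hA.assoc]

/-- Testing $f_1\#c_q\#f_2$, with $c_q$ a coherent state, against $u\in\mathcal S'$ gives $\langle
f_2\#u\#f_1,c_q\rangle$. By (B) this is a coefficient of a Schwartz function, hence rapidly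
decreasing in $q$. The weighted family is thus weakly bounded, so bounded, and pairing with a second
state adds decay in its parameter. -/
theorem HypothesisB.exists_quadForm_coh_bound {hA : HypothesisA P} (hB : HypothesisB hA)
    (m : ℕ) (f₁ f₂ : Sch n) : ∃ C, ∀ w : (Phase n × Phase n) × (Phase n × Phase n),
      ‖(((1 + ‖w.1‖) ^ m * (1 + ‖w.2‖) ^ m : ℝ) : ℂ) *
        quadForm P (coh (sigmaL n) g w.1) (coh (sigmaL n) g w.2) f₁ f₂‖ ≤ C := by
  obtain ⟨M, C, hC, h⟩ := pairing_coh_decay g m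
  obtain ⟨D, hD⟩ := exists_sn_bound_of_weak (fun q : Phase n × Phase n =>
    (((1 + ‖q‖) ^ m : ℝ) : ℂ) • P (P f₁ (coh (sigmaL n) g q)) f₂) (fun u => by
      refine ⟨C * sn M (hB.sandwich f₂ u f₁), fun q => ?_⟩
      rw [map_smul, ← hB.pairing_sandwich, norm_smul, Complex.norm_real,
        Real.norm_of_nonneg (by positivity), pairing_comm]
      exact h q _) M
  refine ⟨C * D, fun w => ?_⟩
  have h1 := hD w.2
  rw [map_smul_eq_mul, Complex.norm_real, Real.norm_of_nonneg (by positivity)] at h1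
  rw [hA.quadForm_eq, norm_mul, Complex.norm_real, Real.norm_of_nonneg (by positivity)]
  calc _ = (1 + ‖w.2‖) ^ m * ((1 + ‖w.1‖) ^ m *
        ‖pairing (coh (sigmaL n) g w.1) (P (P f₁ (coh (sigmaL n) g w.2)) f₂)‖) := by ring
    _ ≤ (1 + ‖w.2‖) ^ m * (C * sn M (P (P f₁ (coh (sigmaL n) g w.2)) f₂)) :=
        mul_le_mul_of_nonneg_left (h _ _) (by positivity)
    _ = C * ((1 + ‖w.2‖) ^ m * sn M (P (P f₁ (coh (sigmaL n) g w.2)) f₂)) := by ring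
    _ ≤ C * D := mul_le_mul_of_nonneg_left h1 hC.le

theorem continuous_pairing_comp {W : Type} [TopologicalSpace W] {a b : W → Sch n}
    (ha : Continuous a) (hb : Continuous b) : Continuous fun w => pairing (a w) (b w) := by
  have : Continuous fun w => (a w, b w) := ha.prodMk hb
  exact continuous_pairing.comp this

theorem HypothesisA.continuous_quadForm {W : Type} [TopologicalSpace W] (hA : HypothesisA P)
    (f₁ f₂ : Sch n) {a b : W → Sch n} (ha : Continuous a) (hb : Continuous b) :
    Continuous fun w => quadForm P (a w) (b w) f₁ f₂ := by
  have h1 : Continuous fun w => P (a w) f₁ := (hA.continuous_left f₁).comp ha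
  have h2 : Continuous fun w => P (b w) f₂ := (hA.continuous_left f₂).comp hb
  exact continuous_pairing_comp h1 h2

/-- The weights are absorbed into the family of forms, so the uniform boundedness principle makes
the dependence on `f₁, f₂` explicit. The rest is regrouping of coordinates. -/
theorem HypothesisB.exists_quadForm_coh_uniform_bound {hA : HypothesisA P} (hB : HypothesisB hA)
    (m : ℕ) : ∃ N : ℕ, ∃ C : ℝ, 0 < C ∧
      ∀ (w : (Phase n × Phase n) × (Phase n × Phase n)) (f₁ f₂ : Sch n), (1 + ‖w‖) ^ m *
        ‖quadForm P (coh (sigmaL n) g (w.1.1, w.2.1)) (coh (sigmaL n) g (w.1.2, w.2.2)) f₁ f₂‖ ≤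
          C * sn N f₁ * sn N f₂ := by
  obtain ⟨N, C, hC, h⟩ := exists_uniform_sn_bound_bilin
    (fun w : (Phase n × Phase n) × (Phase n × Phase n) =>
      (((1 + ‖w.1‖) ^ m * (1 + ‖w.2‖) ^ m : ℝ) : ℂ) •
        quadForm P (coh (sigmaL n) g w.1) (coh (sigmaL n) g w.2))
    (fun w f₂ => continuous_const.mul (continuous_pairing.comp
      ((hA.continuous_right _).prodMk continuous_const)))
    (fun w f₁ => continuous_const.mul (continuous_pairing.comp
      (continuous_const.prodMk (hA.continuous_right _))))
    (hB.exists_quadForm_coh_bound g m)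
  refine ⟨N, C, hC, fun w f₁ f₂ => ?_⟩
  have h1 := h ((w.1.1, w.2.1), (w.1.2, w.2.2)) f₁ f₂
  rw [LinearMap.smul_apply, LinearMap.smul_apply, norm_smul, Complex.norm_real,
    Real.norm_of_nonneg (by positivity)] at h1
  refine le_trans (mul_le_mul_of_nonneg_right ?_ (norm_nonneg _)) h1
  rw [← mul_pow]
  gcongr
  have h2 : ‖w‖ ≤ max ‖((w.1.1, w.2.1) : Phase n × Phase n)‖
      ‖((w.1.2, w.2.2) : Phase n × Phase n)‖ := by
    refine max_le (max_le ?_ ?_) (max_le ?_ ?_)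
    · exact (norm_fst_le ((w.1.1, w.2.1) : Phase n × Phase n)).trans (le_max_left _ _)
    · exact (norm_fst_le ((w.1.2, w.2.2) : Phase n × Phase n)).trans (le_max_right _ _)
    · exact (norm_snd_le ((w.1.1, w.2.1) : Phase n × Phase n)).trans (le_max_left _ _)
    · exact (norm_snd_le ((w.1.2, w.2.2) : Phase n × Phase n)).trans (le_max_right _ _)
  have h3 := norm_nonneg ((w.1.1, w.2.1) : Phase n × Phase n)
  have h4 := norm_nonneg ((w.1.2, w.2.2) : Phase n × Phase n)
  rcases max_cases ‖((w.1.1, w.2.1) : Phase n × Phase n)‖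
      ‖((w.1.2, w.2.2) : Phase n × Phase n)‖ with ⟨e, -⟩ | ⟨e, -⟩ <;> rw [e] at h2 <;> nlinarith

theorem toDist2_eq (F : Sch2 n) : toDist2 F = regular ((haar n).prod (haar n)) F := rfl

theorem toDist2_symm (F G : Sch2 n) : toDist2 F G = toDist2 G F := by
  rw [toDist2_apply, toDist2_apply]
  simp_rw [mul_comm]

theorem toDist2_tensor (f₁ f₂ g₁ g₂ : Sch n) :
    toDist2 (tensor f₁ f₂) (tensor g₁ g₂) = pairing f₁ g₁ * pairing f₂ g₂ := by
  rw [toDist2_eq, regular_tensor, ← toDist_apply, ← toDist_apply]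
  rfl

/-- A tempered distribution on `Ξ × Ξ` is determined by its values on tensor products. -/
theorem dist2_ext {u v : Dist2 n} (h : ∀ f₁ f₂, u (tensor f₁ f₂) = v (tensor f₁ f₂)) : u = v := by
  obtain ⟨g, hg⟩ := exists_window (haar n)
  exact (isFourier_phase_prod n).ext_tensor hg h

/-- The map `R` on `𝓢(Ξ × Ξ)`. -/
theorem HypothesisB.exists_rMap {hA : HypothesisA P} (hB : HypothesisB hA) :
    ∃ R : Sch2 n →L[ℂ] Sch2 n, ∀ f₁ f₂ g₁ g₂,
      toDist2 (R (tensor f₁ f₂)) (tensor g₁ g₂) = pairing (P g₁ f₁) (P g₂ f₂) := by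
  obtain ⟨g, hg⟩ := exists_window (haar n)
  exact (isFourier_phase n).exists_operator (isFourier_phase_prod n) hg (quadForm P)
    (fun f₁ f₂ => (pairingL n).compl₁₂ (P.flip f₁) (P.flip f₂)) (fun _ _ _ _ => rfl)
    (fun f₁ f₂ => hA.continuous_quadForm f₁ f₂ continuous_fst continuous_snd)
    (hB.exists_quadForm_coh_uniform_bound g)

end Algebra

/-! ### Reflection, slices and exchange of variables -/

section Reflection

variable {V : Type} [NormedAddCommGroup V] [NormedSpace ℝ V]

/-- The reflection `f ↦ f(-·)`. -/
noncomputable def reflect : 𝓢(V, ℂ) →L[ℂ] 𝓢(V, ℂ) :=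
  SchwartzMap.compCLMOfContinuousLinearEquiv ℂ (ContinuousLinearEquiv.neg ℝ)

theorem reflect_apply (f : 𝓢(V, ℂ)) (x : V) : reflect f x = f (-x) := rfl

theorem reflect_reflect (f : 𝓢(V, ℂ)) : reflect (reflect f) = f := by
  ext x
  simp [reflect_apply]

/-- The partial evaluation `F ↦ F(x, ·)`. -/
noncomputable def slice (x : V) : 𝓢(V × V, ℂ) →L[ℂ] 𝓢(V, ℂ) :=
  SchwartzMap.compCLM ℂ (g := fun y => (x, y))
    (by
      have h := (Function.HasTemperateGrowth.const (E := V) ((x, 0) : V × V)).add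
        (ContinuousLinearMap.inr ℝ V V).hasTemperateGrowth
      convert h using 1
      funext y
      simp)
    ⟨1, 1, fun y => by
      rw [one_mul, pow_one]
      exact (norm_snd_le (x, y)).trans (le_add_of_nonneg_left zero_le_one)⟩

theorem slice_tensor (x : V) (f h : 𝓢(V, ℂ)) : slice x (tensor f h) = f x • h := rfl

/-- The exchange of variables `F(x, y) ↦ F(y, x)`. -/
noncomputable def swapL : 𝓢(V × V, ℂ) →L[ℂ] 𝓢(V × V, ℂ) :=
  SchwartzMap.compCLMOfContinuousLinearEquiv ℂ (ContinuousLinearEquiv.prodComm ℝ V V)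

theorem swapL_apply (F : 𝓢(V × V, ℂ)) (z : V × V) : swapL F z = F (z.2, z.1) := rfl

theorem swapL_swapL (F : 𝓢(V × V, ℂ)) : swapL (swapL F) = F := rfl

theorem swapL_tensor (f h : 𝓢(V, ℂ)) : swapL (tensor f h) = tensor h f := by
  ext z
  rw [swapL_apply, tensor_apply, tensor_apply, mul_comm]

end Reflection

/-! ### Plancherel identity and contraction of one variable -/

section Fourier

variable {V : Type} [NormedAddCommGroup V] [NormedSpace ℝ V] [MeasurableSpace V] [BorelSpace V]
  [FiniteDimensional ℝ V] {μ : Measure V} [μ.IsAddHaarMeasure] {B : V →L[ℝ] V →L[ℝ] ℝ}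
  {F : 𝓢(V, ℂ) →L[ℂ] 𝓢(V, ℂ)} {g : 𝓢(V, ℂ)}

omit [MeasurableSpace V] [BorelSpace V] [FiniteDimensional ℝ V] in
theorem chi_swap (hB : ∀ x y, B x y = -B y x) (x y : V) : chi B x y = chi B (-y) x := by
  rw [chi_neg, chi, hB]
  push_cast
  ring_nf

-- For an antisymmetric form the kernels of the transform and of its inverse coincide.
omit [BorelSpace V] [FiniteDimensional ℝ V] [μ.IsAddHaarMeasure] in
theorem IsFourier.fourier_fourier (hF : IsFourier μ B F) (hB : ∀ x y, B x y = -B y x)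
    (f : 𝓢(V, ℂ)) : F (F f) = f := by
  ext x
  rw [hF.apply, hF.inv f x]
  simp_rw [chi_swap hB _ x]

theorem IsFourier.fourier_reflect (hF : IsFourier μ B F) (f : 𝓢(V, ℂ)) :
    F (reflect f) = reflect (F f) := by
  ext y
  rw [reflect_apply, hF.apply, hF.apply, ← integral_neg_eq_self]
  refine integral_congr_ae (Eventually.of_forall fun x => ?_)
  simp [reflect_apply, chi]

/-- Fubini; exchanging the variables of the kernel changes the sign of the form, whence the
reflection. -/
theorem IsFourier.regular_fourier (hF : IsFourier μ B F) (hB : ∀ x y, B x y = -B y x)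
    (f h : 𝓢(V, ℂ)) : regular μ (F f) h = regular μ f (reflect (F h)) := by
  have := FiniteDimensional.proper ℝ V
  rw [regular_apply _ (SchwartzMap.hasTemperateGrowth _),
    regular_apply _ (SchwartzMap.hasTemperateGrowth _)]
  simp_rw [reflect_apply, hF.apply, neg_neg, ← integral_mul_const, ← integral_const_mul]
  rw [integral_integral_swap]
  · refine integral_congr_ae (Eventually.of_forall fun x => ?_)
    refine integral_congr_ae (Eventually.of_forall fun y => ?_)
    simp only [chi_swap hB x y]
    ring
  · have h1 : Integrable (fun z : V × V => h z.1 * f z.2) (μ.prod μ) :=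
      (SchwartzMap.integrable h).mul_prod (SchwartzMap.integrable f)
    refine h1.mono (Continuous.aestronglyMeasurable ?_) (Eventually.of_forall fun z => ?_)
    · have : Continuous fun z : V × V => chi B (-z.1) z.2 :=
        (contDiff_chi B (m := 0)).continuous.comp (continuous_fst.neg.prodMk continuous_snd)
      exact (this.mul (f.continuous.comp continuous_snd)).mul (h.continuous.comp continuous_fst)
    · simp only [Function.uncurry, norm_mul, norm_chi, one_mul]
      rw [mul_comm]

/-- The Plancherel identity. -/
theorem IsFourier.regular_fourier_reflect_fourier (hF : IsFourier μ B F)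
    (hB : ∀ x y, B x y = -B y x) (f h : 𝓢(V, ℂ)) :
    regular μ (F f) (reflect (F h)) = regular μ f h := by
  rw [hF.regular_fourier hB, hF.fourier_reflect, reflect_reflect, hF.fourier_fourier hB]

omit [BorelSpace V] in
theorem IsFourier.fourier_tensor (hF : IsFourier μ B F) {F2 : 𝓢(V × V, ℂ) →L[ℂ] 𝓢(V × V, ℂ)}
    (hF2 : IsFourier (μ.prod μ) (prodForm B) F2) (f h : 𝓢(V, ℂ)) :
    F2 (tensor f h) = tensor (F f) (F h) := by
  have := FiniteDimensional.proper ℝ V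
  ext z
  rw [hF2.apply, tensor_apply, hF.apply, hF.apply, ← integral_prod_mul]
  refine integral_congr_ae (Eventually.of_forall fun x => ?_)
  simp only [chi_prodForm, tensor_apply, Prod.fst_neg, Prod.snd_neg]
  ring

/-- Contraction of the second variable with a Schwartz function. -/
theorem IsFourier.exists_contraction (hF : IsFourier μ B F)
    {F2 : 𝓢(V × V, ℂ) →L[ℂ] 𝓢(V × V, ℂ)} (hF2 : IsFourier (μ.prod μ) (prodForm B) F2)
    (hg : ∫ x, g x * g x ∂μ = 1) (h : 𝓢(V, ℂ)) :
    ∃ T : 𝓢(V × V, ℂ) →L[ℂ] 𝓢(V, ℂ), ∀ f k, T (tensor f k) = regular μ h k • f := by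
  have := FiniteDimensional.proper ℝ V
  obtain ⟨N₁, C₁, hC₁, h₁⟩ := exists_norm_le_sn (regular μ h)
  -- The coefficient of the first factor times the pairing of the second with `h`: superposing
  -- coherent states with these weights rebuilds the first factor.
  obtain ⟨c, -, hc2, hc3, hc4⟩ := hF.exists_kernel_extension hF2 hg
    (fun w : V × V => (LinearMap.mul ℂ ℂ).compl₁₂ (stft g μ B w : 𝓢(V, ℂ) →ₗ[ℂ] ℂ)
      (regular μ h : 𝓢(V, ℂ) →ₗ[ℂ] ℂ))
    (fun f k => (continuous_stft g μ B f).mul continuous_const) fun K => by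
      obtain ⟨M, C, hC, hd⟩ := hF.stft_decay g K
      refine ⟨max M N₁, C * C₁, by positivity, fun w f k => ?_⟩
      change (1 + ‖w‖) ^ K * ‖stft g μ B w f * regular μ h k‖ ≤ _
      rw [norm_mul, ← mul_assoc]
      calc _ ≤ (C * sn M f) * (C₁ * sn N₁ k) :=
            mul_le_mul (hd w f) (h₁ k) (norm_nonneg _) (by positivity)
        _ ≤ (C * sn (max M N₁) f) * (C₁ * sn (max M N₁) k) := by
            gcongr
            · exact sn_mono (le_max_left _ _) f
            · exact sn_mono (le_max_right _ _) k
        _ = _ := by ring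
  choose A hA0 hA' using sn_coh_le B g
  obtain ⟨T, hT⟩ := exists_superposition_clm (μ.prod μ) (continuous_coh B g)
    (fun N => (hA0 N).le) hA' c hc3 hc4
  refine ⟨T, fun f k => ?_⟩
  ext x
  let u : 𝓢(V, ℂ) →L[ℂ] ℂ := ⟨⟨⟨fun f => f x, fun _ _ => rfl⟩, fun _ _ => rfl⟩, continuous_eval x⟩
  have h2 := hT (tensor f k) u
  have h3 := hF.apply_eq_integral hg u f
  change T (tensor f k) x = regular μ h k * u f
  refine h2.trans ?_
  rw [h3, ← integral_const_mul]
  refine integral_congr_ae (Eventually.of_forall fun w => ?_)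
  simp only [hc2]
  change stft g μ B w f * regular μ h k * u (coh B g w) = _
  ring

end Fourier

/-! ### The square of R is the identity -/

section Involution

variable {n : ℕ} {P : Sch n →ₗ[ℂ] Sch n →ₗ[ℂ] Sch n}

theorem IsFourier.regular_injective {V : Type} [NormedAddCommGroup V] [NormedSpace ℝ V]
    [MeasurableSpace V] [BorelSpace V] [FiniteDimensional ℝ V] {μ : Measure V} [μ.IsAddHaarMeasure]
    {B : V →L[ℝ] V →L[ℝ] ℝ} {F : 𝓢(V, ℂ) →L[ℂ] 𝓢(V, ℂ)} {g : 𝓢(V, ℂ)} (hF : IsFourier μ B F)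
    (hg : ∫ x, g x * g x ∂μ = 1) {f h : 𝓢(V, ℂ)} (e : ∀ k, regular μ f k = regular μ h k) :
    f = h := by
  ext x
  rw [← hF.reconstruct hg f x, ← hF.reconstruct hg h x]
  simp_rw [stft, regular_symm μ (coh B g _), e]

theorem sch_ext {f h : Sch n} (e : ∀ k, pairing f k = pairing h k) : f = h := by
  obtain ⟨g, hg⟩ := exists_window (haar n)
  refine (isFourier_phase n).regular_injective hg fun k => ?_
  have := e k
  rwa [← toDist_apply, ← toDist_apply] at this

theorem toDist2_injective : Function.Injective (toDist2 (n := n)) := fun F G e => by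
  obtain ⟨g, hg⟩ := exists_window (haar n)
  exact (isFourier_phase_prod n).regular_injective (integral_tensor_sq hg) fun k =>
    congrArg (fun u : Dist2 n => u k) e

theorem sigmaL_antisymm (X Y : Phase n) : sigmaL n X Y = -sigmaL n Y X := by
  simp only [sigmaL_apply, sigma]
  ring

theorem prodForm_sigmaL_antisymm (X Y : Phase n × Phase n) :
    prodForm (sigmaL n) X Y = -prodForm (sigmaL n) Y X := by
  rw [prodForm_apply, prodForm_apply, sigmaL_antisymm X.1, sigmaL_antisymm X.2]
  ring

theorem pairing_fourier (f h : Sch n) : pairing ((phaseModel n).fourier f) h =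
    pairing f (reflect ((phaseModel n).fourier h)) := by
  rw [← toDist_apply, ← toDist_apply]
  exact (isFourier_phase n).regular_fourier sigmaL_antisymm f h

theorem pairing_fourier_reflect_fourier (f h : Sch n) : pairing ((phaseModel n).fourier f)
    (reflect ((phaseModel n).fourier h)) = pairing f h := by
  rw [← toDist_apply, ← toDist_apply]
  exact (isFourier_phase n).regular_fourier_reflect_fourier sigmaL_antisymm f h

theorem toDist2_fourier (F H : Sch2 n) : toDist2 ((phaseModel n).prod.fourier F) H =
    toDist2 F (reflect ((phaseModel n).prod.fourier H)) :=
  (isFourier_phase_prod n).regular_fourier prodForm_sigmaL_antisymm F H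

theorem toDist2_fourier_reflect_fourier (F H : Sch2 n) :
    toDist2 ((phaseModel n).prod.fourier F) (reflect ((phaseModel n).prod.fourier H)) =
      toDist2 F H :=
  (isFourier_phase_prod n).regular_fourier_reflect_fourier prodForm_sigmaL_antisymm F H

theorem fourier_tensor (f h : Sch n) : (phaseModel n).prod.fourier (tensor f h) =
    tensor ((phaseModel n).fourier f) ((phaseModel n).fourier h) :=
  (isFourier_phase n).fourier_tensor (isFourier_phase_prod n) f h

theorem expDist_neg_apply (Z : Phase n) (f : Sch n) :
    expDist (-Z) f = (phaseModel n).fourier f Z := by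
  rw [(isFourier_phase n).apply, chi_sigmaL, expDist_apply]
  rfl

/-- `R` is a continuous operator on `𝓢(Ξ × Ξ)` that represents `⟨g₁ # f₁, g₂ # f₂⟩`. -/
def IsKernelMap (P : Sch n →ₗ[ℂ] Sch n →ₗ[ℂ] Sch n) (R : Sch2 n →L[ℂ] Sch2 n) : Prop :=
  ∀ f₁ f₂ g₁ g₂, toDist2 (R (tensor f₁ f₂)) (tensor g₁ g₂) = pairing (P g₁ f₁) (P g₂ f₂)

variable {R : Sch2 n →L[ℂ] Sch2 n}

/-- Applied to the kernel $\mathbf R(f\otimes g)$, contraction with $h$ returns $f\#h\#g$ as a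
Schwartz function, and it depends continuously on the kernel. -/
theorem exists_contraction (h : Sch n) : ∃ T : Sch2 n →L[ℂ] Sch n,
    (∀ f k, T (tensor f k) = pairing h k • f) ∧
      ∀ a F, pairing a (T F) = toDist2 F (tensor a h) := by
  obtain ⟨g, hg⟩ := exists_window (haar n)
  obtain ⟨T, hT⟩ := (isFourier_phase n).exists_contraction (isFourier_phase_prod n) hg h
  have hT' : ∀ f k, T (tensor f k) = pairing h k • f := fun f k => by
    rw [hT, ← toDist_apply]
    rfl
  refine ⟨T, hT', fun a F => ?_⟩
  have : toDist a ∘L T = toDist2 (tensor a h) := dist2_ext fun f k => by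
    rw [ContinuousLinearMap.comp_apply, hT', map_smul, toDist2_tensor, toDist_apply, smul_eq_mul,
      mul_comm]
  rw [toDist2_symm, ← this, ContinuousLinearMap.comp_apply, toDist_apply]

/-- As $\mathbf R(f\otimes g)$ is the kernel of $h\mapsto f\#h\#g$, integrating its first variable
against $\mathfrak e_{-Z}$ gives the function $g\#\mathfrak e_{-Z}\#f$ of the second. The remaining
transform acts on that variable. -/
theorem IsKernelMap.slice_fourier (hR : IsKernelMap P R) {hA : HypothesisA P} (hB : HypothesisB hA)
    (f g : Sch n) (Z : Phase n) :
    slice Z ((phaseModel n).prod.fourier (R (tensor f g))) =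
      (phaseModel n).fourier (hB.sandwich g (expDist (-Z)) f) := by
  refine sch_ext fun h => ?_
  rw [pairing_fourier, hB.pairing_sandwich]
  obtain ⟨T, hT, hT'⟩ := exists_contraction (reflect ((phaseModel n).fourier h))
  have e1 : P (P f (reflect ((phaseModel n).fourier h))) g = T (R (tensor f g)) :=
    sch_ext fun a => by
      rw [pairing_comm _ a, pairing_comm _ a, hT', hR, hA.pairing_mul_left, hA.assoc]
  -- Both sides are continuous in the kernel, so tensor products suffice, although $\mathbf
  -- R(f\otimes g)$ is not one.
  have e2 : (toDist h ∘L slice Z) ∘L (phaseModel n).prod.fourier = expDist (-Z) ∘L T :=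
    dist2_ext fun a b => by
      simp only [ContinuousLinearMap.comp_apply, fourier_tensor, slice_tensor, hT, map_smul,
        expDist_neg_apply, toDist_apply, smul_eq_mul]
      rw [pairing_comm h, pairing_fourier, pairing_comm b, mul_comm]
  rw [e1, pairing_comm, ← toDist_apply]
  exact congrArg (fun u : Dist2 n => u (R (tensor f g))) e2

/-- Factored arguments allow the four-fold product to be cut between $f$ and $f'$ and between $g'$
and $g$, leaving each exponential between Schwartz functions. -/
theorem HypothesisB.thetaPairing_mul {hA : HypothesisA P} (hB : HypothesisB hA)
    (f f' g g' : Sch n) (Z : Phase n) : hB.thetaPairing Z (P f f') (P g' g) =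
      pairing (hB.sandwich g (expDist (-Z)) f) (hB.sandwich f' (expDist Z) g') := by
  have e : hB.sandwich (P f f') (expDist Z) (P g' g) =
      P (P f (hB.sandwich f' (expDist Z) g')) g := sch_ext fun h => by
    rw [hB.pairing_sandwich, hA.pairing_mul_left, hA.pairing_cyclic, hA.pairing_mul_left,
      hB.pairing_sandwich]
    simp only [hA.assoc]
  rw [HypothesisB.thetaPairing, HypothesisB.tripleApply, e, hB.pairing_sandwich]

/-- The two factors are slices of transformed kernels at $Z$ and $-Z$. Plancherel in the second
variable makes the integrand a product of slices, and Plancherel on the product space then removes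
both transforms. -/
theorem IsKernelMap.integral_thetaPairing (hR : IsKernelMap P R) {hA : HypothesisA P}
    (hB : HypothesisB hA) (f f' g g' : Sch n) :
    ∫ Z, hB.thetaPairing Z (P f f') (P g' g) ∂(haar n) =
      toDist2 (R (tensor f g)) (R (tensor g' f')) := by
  set K := (phaseModel n).prod.fourier (R (tensor f g)) with hK
  set K' := (phaseModel n).prod.fourier (R (tensor g' f')) with hK'
  have h1 : ∀ Z, hB.thetaPairing Z (P f f') (P g' g) =
      ∫ W, K (Z, W) * reflect K' (Z, W) ∂(haar n) := fun Z => by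
    rw [hB.thetaPairing_mul, ← pairing_fourier_reflect_fourier, ← hR.slice_fourier hB, ← hK]
    have h2 := hR.slice_fourier hB g' f' (-Z)
    rw [neg_neg, ← hK'] at h2
    rw [← h2]
    rfl
  simp_rw [h1]
  rw [← toDist2_fourier_reflect_fourier, ← hK, ← hK', toDist2_apply, integral_prod]
  refine (SchwartzMap.integrable (SchwartzMap.smulLeftCLM ℂ K (reflect K'))).congr
    (Eventually.of_forall fun p => ?_)
  rw [SchwartzMap.smulLeftCLM_apply_apply K.hasTemperateGrowth, smul_eq_mul]

/-- Hypothesis (C) evaluates the integral over $Z$ as $\int f\#f'\cdot\int g'\#g$, and (A) replaces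
both products by pointwise ones. -/
theorem IsKernelMap.toDist2_apply_apply (hR : IsKernelMap P R) {hA : HypothesisA P}
    {hB : HypothesisB hA} (hC : HypothesisC hB) (f f' g g' : Sch n) :
    toDist2 (R (tensor f g)) (R (tensor g' f')) = toDist2 (tensor f g) (tensor f' g') := by
  rw [← hR.integral_thetaPairing hB, hC, hA.integral_mul, hA.integral_mul, toDist2_tensor,
    pairing_comm g]
  rfl

/-- On tensors the pairing is $\int g_1\#f_1\#g_2\#f_2$. A cyclic rotation exchanges the roles of
the $f$'s and $g$'s and reverses the order of the $g$'s. Two density arguments remove the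
restriction to tensors. -/
theorem IsKernelMap.toDist2_apply_left (hR : IsKernelMap P R) (hA : HypothesisA P) (F H : Sch2 n) :
    toDist2 (R F) H = toDist2 F (R (swapL H)) := by
  have h1 : ∀ g₁ g₂, toDist2 (tensor g₁ g₂) ∘L R = toDist2 (R (tensor g₂ g₁)) := fun g₁ g₂ =>
    dist2_ext fun f₁ f₂ => by
      rw [ContinuousLinearMap.comp_apply, toDist2_symm, hR, hR, hA.pairing_mul_left,
        pairing_comm, ← hA.assoc, hA.pairing_mul_left]
  have h2 : toDist2 (R F) = toDist2 F ∘L R ∘L swapL := dist2_ext fun g₁ g₂ => by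
    rw [ContinuousLinearMap.comp_apply, ContinuousLinearMap.comp_apply, swapL_tensor,
      toDist2_symm F, ← h1, toDist2_symm]
    rfl
  exact congrArg (fun u : Dist2 n => u H) h2

/-- Transposing the outer `R` introduces a swap, which is exactly the reversed order in
`toDist2_apply_apply`. -/
theorem IsKernelMap.apply_apply (hR : IsKernelMap P R) {hA : HypothesisA P}
    {hB : HypothesisB hA} (hC : HypothesisC hB) (F : Sch2 n) : R (R F) = F := by
  have h1 : ∀ f g, R (R (tensor f g)) = tensor f g := fun f g =>
    toDist2_injective (dist2_ext fun f' g' => by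
      rw [hR.toDist2_apply_left hA, swapL_tensor, hR.toDist2_apply_apply hC])
  refine toDist2_injective (ContinuousLinearMap.ext fun H => ?_)
  have h2 : (toDist2 H ∘L R) ∘L R = toDist2 H := dist2_ext fun f g => by
    rw [ContinuousLinearMap.comp_apply, ContinuousLinearMap.comp_apply, h1]
  rw [toDist2_symm, toDist2_symm F]
  exact congrArg (fun u : Dist2 n => u F) h2

end Involution

/-! ### Continuity of the embedding into the strong dual -/

section Dual

variable {V : Type} [NormedAddCommGroup V] [NormedSpace ℝ V] [MeasurableSpace V] [BorelSpace V]
  [SecondCountableTopology V] (μ : Measure V) [μ.HasTemperateGrowth]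

theorem exists_regular_bound : ∃ N : ℕ, ∃ C : ℝ, 0 < C ∧ ∀ f h : 𝓢(V, ℂ),
    ‖regular μ f h‖ ≤ C * sn N f * sn N h := by
  let b : 𝓢(V, ℂ) →ₗ[ℂ] 𝓢(V, ℂ) →ₗ[ℂ] ℂ := LinearMap.mk₂ ℂ (fun f h => regular μ f h)
    (fun f f' h => by simp only [regular_symm μ _ h, map_add])
    (fun a f h => by simp only [regular_symm μ _ h, map_smul])
    (fun f h h' => by simp only [map_add]) (fun a f h => by simp only [map_smul])
  obtain ⟨N, C, hC, h⟩ := exists_uniform_sn_bound_bilin (fun _ : Unit => b)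
    (fun _ h => (regular μ h).continuous.congr fun f => regular_symm μ h f)
    (fun _ f => (regular μ f).continuous) fun f g => ⟨_, fun _ => le_rfl⟩
  exact ⟨N, C, hC, h ()⟩

/-- The embedding of the Schwartz space into its strong dual. -/
noncomputable def regularL : 𝓢(V, ℂ) →L[ℂ] 𝓢(V, ℂ) →L[ℂ] ℂ where
  toFun f := regular μ f
  map_add' f f' := by
    ext h
    rw [add_apply, regular_symm, map_add, regular_symm μ h, regular_symm μ h]
  map_smul' a f := by
    ext h
    rw [smul_apply, regular_symm, map_smul, regular_symm μ h]
    rfl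
  cont := by
    refine continuous_of_continuousAt_zero
      (AddMonoidHom.mk' (fun f : 𝓢(V, ℂ) => regular μ f) fun f f' => by
        ext h
        rw [add_apply, regular_symm, map_add, regular_symm μ h, regular_symm μ h]) ?_
    obtain ⟨N, C, hC, hb⟩ := exists_regular_bound μ
    rw [ContinuousAt, map_zero,
      (ContinuousLinearMap.hasBasis_nhds_zero_of_basis Metric.nhds_basis_ball).tendsto_right_iff]
    rintro ⟨S, ε⟩ ⟨hS, hε⟩
    -- On a bounded set the seminorm of the test function is below a fixed `r`, so the bilinear
    -- bound is uniform there.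
    obtain ⟨r, hr, hS'⟩ := ((schwartz_withSeminorms ℂ V ℂ).isVonNBounded_iff_finset_seminorm_bounded.1
      hS) (Finset.Iic (N, N))
    have h1 : Tendsto (fun f : 𝓢(V, ℂ) => C * sn N f * r) (𝓝 0) (𝓝 0) := by
      have := ((continuous_const.mul (continuous_sn (V := V) N)).mul
        (continuous_const (y := r))).tendsto (f := fun f => C * sn N f * r) 0
      simpa using this
    filter_upwards [h1.eventually_lt_const hε] with f hf h hh
    rw [mem_ball_zero_iff]
    refine ((hb f h).trans ?_).trans_lt hf
    exact mul_le_mul_of_nonneg_left (hS' h hh).le (by positivity)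

end Dual

/-! ### Extension to tempered distributions by transposition -/

section Extension

variable {n : ℕ}

/-- The extension is precomposition with the transpose `e'`, which is a homeomorphism for both
topologies because `e'` is an isomorphism; `he` says that it agrees with `e` on Schwartz functions.
-/
theorem isTopIsoExtending_of_transpose {T : Sch2 n →L[ℂ] Dist2 n} (e e' : Sch2 n ≃L[ℂ] Sch2 n)
    (hT : ∀ F, T F = toDist2 (e F)) (he : ∀ F H, toDist2 (e F) H = toDist2 F (e' H)) :
    IsTopIsoExtending T := by
  refine ⟨e, hT, ContinuousLinearEquiv.equivOfInverse
    (ContinuousLinearMap.precomp ℂ (e' : Sch2 n →L[ℂ] Sch2 n))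
    (ContinuousLinearMap.precomp ℂ (e'.symm : Sch2 n →L[ℂ] Sch2 n))
    (fun u => ContinuousLinearMap.ext fun H => congrArg u (e'.apply_symm_apply H))
    (fun u => ContinuousLinearMap.ext fun H => congrArg u (e'.symm_apply_apply H)),
    fun F => ContinuousLinearMap.ext fun H => (he F H).symm,
    ContinuousLinearEquiv.equivOfInverse
    (PointwiseConvergenceCLM.precomp ℂ (e' : Sch2 n →L[ℂ] Sch2 n))
    (PointwiseConvergenceCLM.precomp ℂ (e'.symm : Sch2 n →L[ℂ] Sch2 n))
    (fun u => ContinuousLinearMap.ext fun H => congrArg u (e'.apply_symm_apply H))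
    (fun u => ContinuousLinearMap.ext fun H => congrArg u (e'.symm_apply_apply H)),
    fun u => rfl⟩

/-- Density of tensors is used once in each argument; evaluation at a fixed test function is
continuous on the strong dual. -/
theorem sch2_dist2_ext {S T : Sch2 n →L[ℂ] Dist2 n} (h : ∀ f₁ f₂ g₁ g₂ : Sch n,
    S (tensor f₁ f₂) (tensor g₁ g₂) = T (tensor f₁ f₂) (tensor g₁ g₂)) : S = T := by
  have h1 : ∀ f₁ f₂, S (tensor f₁ f₂) = T (tensor f₁ f₂) := fun f₁ f₂ => dist2_ext (h f₁ f₂)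
  refine ContinuousLinearMap.ext fun F => ContinuousLinearMap.ext fun H => ?_
  let ev : (Sch2 n →L[ℂ] Dist2 n) → Dist2 n := fun S =>
    ⟨⟨⟨fun F => S F H, fun F G => congrArg (fun u : Dist2 n => u H) (map_add S F G)⟩,
      fun a F => congrArg (fun u : Dist2 n => u H) (map_smul S a F)⟩,
      (continuous_eval_const H).comp S.continuous⟩
  have h2 : ev S = ev T := dist2_ext fun f₁ f₂ => congrArg (fun u : Dist2 n => u H) (h1 f₁ f₂)
  exact congrArg (fun u : Dist2 n => u F) h2

/-- The exchange of variables as an isomorphism of `𝓢(Ξ × Ξ)`. -/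
noncomputable def swapEquiv (n : ℕ) : Sch2 n ≃L[ℂ] Sch2 n :=
  ContinuousLinearEquiv.equivOfInverse swapL swapL swapL_swapL swapL_swapL

/-- The reflection as an isomorphism of `𝓢(Ξ × Ξ)`. -/
noncomputable def reflectEquiv (n : ℕ) : Sch2 n ≃L[ℂ] Sch2 n :=
  ContinuousLinearEquiv.equivOfInverse reflect reflect reflect_reflect reflect_reflect

theorem fourier_prod_fourier_prod (F : Sch2 n) :
    (phaseModel n).prod.fourier ((phaseModel n).prod.fourier F) = F :=
  (isFourier_phase_prod n).fourier_fourier prodForm_sigmaL_antisymm F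

/-- The symplectic Fourier transform as an isomorphism of `𝓢(Ξ × Ξ)`. -/
noncomputable def fourierEquiv (n : ℕ) : Sch2 n ≃L[ℂ] Sch2 n :=
  ContinuousLinearEquiv.equivOfInverse (phaseModel n).prod.fourier (phaseModel n).prod.fourier
    fourier_prod_fourier_prod fourier_prod_fourier_prod

/-- The change of variables `C` as an isomorphism of `𝓢(Ξ × Ξ)`. -/
noncomputable def compCEquiv (n : ℕ) : Sch2 n ≃L[ℂ] Sch2 n :=
  ContinuousLinearEquiv.equivOfInverse (compC n)
    (SchwartzMap.compCLMOfContinuousLinearEquiv ℂ (changeVar n).symm)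
    (fun F => by
      ext z
      change F (changeVar n ((changeVar n).symm z)) = F z
      rw [ContinuousLinearEquiv.apply_symm_apply])
    (fun F => by
      ext z
      change F ((changeVar n).symm (changeVar n z)) = F z
      rw [ContinuousLinearEquiv.symm_apply_apply])

/-- A skew product over negation, whose fibre maps `y ↦ x - y` preserve the measure. -/
theorem measurePreserving_neg_prod_sub {V : Type} [NormedAddCommGroup V] [NormedSpace ℝ V]
    [MeasurableSpace V] [BorelSpace V] [FiniteDimensional ℝ V] (μ : Measure V)
    [μ.IsAddHaarMeasure] :
    MeasurePreserving (fun p : V × V => (-p.1, p.1 - p.2)) (μ.prod μ) (μ.prod μ) :=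
  have := FiniteDimensional.proper ℝ V
  (Measure.measurePreserving_neg μ).skew_product (g := fun x y => x - y)
    (measurable_fst.sub measurable_snd)
    (Eventually.of_forall fun x => (Measure.measurePreserving_sub_left μ x).map_eq)

theorem toDist2_compC (F H : Sch2 n) :
    toDist2 (compC n F) H = toDist2 F ((compCEquiv n).symm H) := by
  rw [toDist2_apply, toDist2_apply]
  have h := (show MeasurePreserving (changeVar n) ((haar n).prod (haar n)) ((haar n).prod (haar n))
    from measurePreserving_neg_prod_sub (haar n)).integral_comp
      (changeVar n).toHomeomorph.measurableEmbedding fun p => F p * (compCEquiv n).symm H p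
  rw [← h]
  refine integral_congr_ae (Eventually.of_forall fun z => ?_)
  change _ = F (changeVar n z) * H ((changeVar n).symm (changeVar n z))
  rw [ContinuousLinearEquiv.symm_apply_apply]
  rfl

theorem compCDist_toDist2 (F : Sch2 n) : compCDist n (toDist2 F) = toDist2 (compC n F) :=
  ContinuousLinearMap.ext fun H => (toDist2_compC F H).symm

end Extension

/-! ### The canonical mappings and their transposes -/

section Maps

variable {n : ℕ} {P : Sch n →ₗ[ℂ] Sch n →ₗ[ℂ] Sch n} {R : Sch2 n →L[ℂ] Sch2 n}

/-- The embedding `𝓢(Ξ × Ξ) → 𝓢'(Ξ × Ξ)` as a continuous linear map. -/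
noncomputable def toDist2L (n : ℕ) : Sch2 n →L[ℂ] Dist2 n := regularL (haar2 n)

theorem toDist2L_apply (F : Sch2 n) : toDist2L n F = toDist2 F := rfl

theorem IsKernelMap.isRMap (hR : IsKernelMap P R) : IsRMap P (toDist2L n ∘L R) := hR

/-- The transforms on $g_1,g_2$ form the transform of $g_1\otimes g_2$, which crosses the pairing as
its transpose, the transform followed by reflection. -/
theorem IsKernelMap.isNMap (hR : IsKernelMap P R) :
    IsNMap P (toDist2L n ∘L reflect ∘L (phaseModel n).prod.fourier ∘L R) := fun f₁ f₂ g₁ g₂ => by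
  rw [ContinuousLinearMap.comp_apply, toDist2L_apply, toDist2_symm]
  change toDist2 _ (reflect ((phaseModel n).prod.fourier (R (tensor f₁ f₂)))) = _
  rw [← toDist2_fourier, fourier_tensor, toDist2_symm, hR, fourier_phase_eq, fourier_phase_eq]

theorem IsRMap.unique {S T : Sch2 n →L[ℂ] Dist2 n} (hS : IsRMap P S) (hT : IsRMap P T) : S = T :=
  sch2_dist2_ext fun f₁ f₂ g₁ g₂ => (hS f₁ f₂ g₁ g₂).trans (hT f₁ f₂ g₁ g₂).symm

theorem IsNMap.unique {S T : Sch2 n →L[ℂ] Dist2 n} (hS : IsNMap P S) (hT : IsNMap P T) : S = T :=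
  sch2_dist2_ext fun f₁ f₂ g₁ g₂ => (hS f₁ f₂ g₁ g₂).trans (hT f₁ f₂ g₁ g₂).symm

/-- The canonical mapping `R` as an isomorphism of `𝓢(Ξ × Ξ)`. -/
noncomputable def IsKernelMap.equiv (hR : IsKernelMap P R) {hA : HypothesisA P}
    {hB : HypothesisB hA} (hC : HypothesisC hB) : Sch2 n ≃L[ℂ] Sch2 n :=
  ContinuousLinearEquiv.equivOfInverse R R (hR.apply_apply hC) (hR.apply_apply hC)

/-- The canonical mapping `N` as an isomorphism of `𝓢(Ξ × Ξ)`. -/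
noncomputable def IsKernelMap.equivN (hR : IsKernelMap P R) {hA : HypothesisA P}
    {hB : HypothesisB hA} (hC : HypothesisC hB) : Sch2 n ≃L[ℂ] Sch2 n :=
  ((hR.equiv hC).trans (fourierEquiv n)).trans (reflectEquiv n)

/-- The transpose of the canonical mapping `N`. -/
noncomputable def IsKernelMap.equivN' (hR : IsKernelMap P R) {hA : HypothesisA P}
    {hB : HypothesisB hA} (hC : HypothesisC hB) : Sch2 n ≃L[ℂ] Sch2 n :=
  ((fourierEquiv n).trans (swapEquiv n)).trans (hR.equiv hC)

theorem IsKernelMap.toDist2_equivN (hR : IsKernelMap P R) {hA : HypothesisA P}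
    {hB : HypothesisB hA} (hC : HypothesisC hB) (F H : Sch2 n) :
    toDist2 (hR.equivN hC F) H = toDist2 F (hR.equivN' hC H) := by
  change toDist2 (reflect ((phaseModel n).prod.fourier (R F))) H =
    toDist2 F (R (swapL ((phaseModel n).prod.fourier H)))
  rw [← hR.toDist2_apply_left hA, toDist2_symm, ← toDist2_fourier, toDist2_symm]

end Maps

end ModulationMaps

/-! ### The theorem for R, N and both versions of M -/

theorem mainTheorem4 (n : ℕ)
    (P : ModulationMaps.Sch n →ₗ[ℂ] ModulationMaps.Sch n →ₗ[ℂ] ModulationMaps.Sch n)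
    (hA : ModulationMaps.HypothesisA P) (hB : ModulationMaps.HypothesisB hA)
    (hC : ModulationMaps.HypothesisC hB) :
    (∃! R : ModulationMaps.Sch2 n →L[ℂ] ModulationMaps.Dist2 n, ModulationMaps.IsRMap P R) ∧
    (∃! N : ModulationMaps.Sch2 n →L[ℂ] ModulationMaps.Dist2 n, ModulationMaps.IsNMap P N) ∧
    (∀ R : ModulationMaps.Sch2 n →L[ℂ] ModulationMaps.Dist2 n, ModulationMaps.IsRMap P R →
      ModulationMaps.IsTopIsoExtending R) ∧
    (∀ N : ModulationMaps.Sch2 n →L[ℂ] ModulationMaps.Dist2 n, ModulationMaps.IsNMap P N →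
      ModulationMaps.IsTopIsoExtending N ∧
      ModulationMaps.IsTopIsoExtending (N ∘L ModulationMaps.compC n) ∧
      ModulationMaps.IsTopIsoExtending (ModulationMaps.compCDist n ∘L N)) := by
  obtain ⟨R, hR : ModulationMaps.IsKernelMap P R⟩ := hB.exists_rMap
  refine ⟨⟨_, hR.isRMap, fun S hS => hS.unique hR.isRMap⟩,
    ⟨_, hR.isNMap, fun S hS => hS.unique hR.isNMap⟩, fun S hS => ?_, fun N hN => ?_⟩
  · rw [hS.unique hR.isRMap]
    exact ModulationMaps.isTopIsoExtending_of_transpose (hR.equiv hC)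
      ((ModulationMaps.swapEquiv n).trans (hR.equiv hC)) (fun F => rfl)
      fun F H => hR.toDist2_apply_left hA F H
  · rw [hN.unique hR.isNMap]
    refine ⟨ModulationMaps.isTopIsoExtending_of_transpose (hR.equivN hC) (hR.equivN' hC)
        (fun F => rfl) (hR.toDist2_equivN hC),
      -- Transposition reverses compositions, and the transpose of $\mathbf C$ is its inverse since
      -- $C$ preserves $dX\,dY$.
      ModulationMaps.isTopIsoExtending_of_transpose
        ((ModulationMaps.compCEquiv n).trans (hR.equivN hC))
        ((hR.equivN' hC).trans (ModulationMaps.compCEquiv n).symm) (fun F => rfl)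
        fun F H => (hR.toDist2_equivN hC _ H).trans (ModulationMaps.toDist2_compC F _),
      ModulationMaps.isTopIsoExtending_of_transpose
        ((hR.equivN hC).trans (ModulationMaps.compCEquiv n))
        ((ModulationMaps.compCEquiv n).symm.trans (hR.equivN' hC))
        (fun F => ModulationMaps.compCDist_toDist2 _)
        fun F H => (ModulationMaps.toDist2_compC _ H).trans (hR.toDist2_equivN hC F _)⟩
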